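/- Let $p$ be a prime, $d\ge 2$ and $m\ge 1$ integers with $p\ge 3d$. Let $\mathcal K_m\subset\mathbb C_p$ be the unramified extension of $\mathbb Q_p$ of degree $m$, let $\mathcal T_m=\{x: x^{p^m}=x\}$ be its Teichmüller set, let $\pi\in\mathbb C_p$ satisfy $\pi^{p-1}=-p$, and let $\tau$ be the Frobenius: the automorphism of $\mathcal K_m(\pi)$ over $\mathbb Q_p$ with $\tau(\pi)=\pi$ and $\tau(x)=x^p$ for $x\in\mathcal T_m$. Let $g(X)=a_1X+\dots+a_dX^d$ with all $a_i\in\mathcal T_m$ and $a_d\ne 0$ (that is, $g$ is the Teichmüller lift of a polynomial of degree $d$ over $\mathbb F_{p^m}$ without constant term). Let $\mathcal H^\dagger$ be the space of overconvergent functions on $|x|=1$, i.e. of Laurent series $\sum_{n\in\mathbb Z}u_nX^n$ over $\mathbb C_p$ that converge on some annulus $1/r<|x|<r$ with $r>1$. Put $D=X\frac{d}{dX}+\pi Xg'(X)$, and let $D^\tau$ be the same operator for $g^\tau$, the polynomial obtained by applying $\tau$ to the coefficients of $g$. Put $\theta(X)=\exp(\pi X-\pi X^p)$, $F(X)=\prod_{i=1}^d\theta(a_iX^i)$,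 $\psi_p(\sum_n u_nX^n)=\sum_n u_{pn}X^n$ and $\beta=\psi_p\circ F$. Then there is exactly one matrix $M=(m_{ij})_{0\le i,j\le d-1}$ over $\mathcal K_m(\pi)$ such that $\beta(X^j)\equiv\sum_{i=0}^{d-1}m_{ij}X^i$ modulo $D^\tau\mathcal H^\dagger$ for $0\le j\le d-1$, namely the matrix of the map $\mathcal H^\dagger/D\mathcal H^\dagger\to\mathcal H^\dagger/D^\tau\mathcal H^\dagger$ induced by $\beta$, in the basis $1,X,\dots,X^{d-1}$. Let $\Gamma=(m_{ij})_{1\le i,j\le d-1}$ and $A=\Gamma^{\tau^{m-1}}\cdots\Gamma^{\tau}\,\Gamma$, and let $\mathcal M_n$ be the sum of the principal $n\times n$ minors of $A$, so that $\det(\mathbf I_{d-1}-TA)=1+\sum_{n=1}^{d-1}(-1)^n\mathcal M_nT^n$. For $1\le n\le d-1$ put $$Y_n=\min_{\sigma\in S_n}\sum_{k=1}^n\left\lceil\tfrac{pk-\sigma(k)}{d}\right\rceil,\qquad \Sigma_n=\Big\{\sigma\in S_n:\ \sum_{k=1}^n\left\lceil\tfrac{pk-\sigma(k)}{d}\right\rceil=Y_n\Big\},$$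 let $j_i$ be the least positive integer congruent to $pi$ modulo $d$, let $B_n=\{1\le i\le n:\ j_i\le n\}$, and $$\mathcal P_n(a_1,\dots,a_d)=\sum_{\sigma\in\Sigma_n}\operatorname{sgn}(\sigma)\prod_{i=1}^n\left\{g^{\lceil (pi-\sigma(i))/d\rceil}\right\}_{pi-\sigma(i)},$$ where $\{P\}_k$ denotes the coefficient of $X^k$ in the polynomial $P$. Then for every $1\le n\le d-1$ $$\mathcal M_n\equiv\frac{N_{\mathcal K_m/\mathbb Q_p}\big(\mathcal P_n(a_1,\dots,a_d)\big)}{\Big(\prod_{1\le i\le n,\ i\notin B_n}\lceil\frac{pi}{d}\rceil!\ \prod_{i\in B_n}\big(\lceil\frac{pi}{d}\rceil-1\big)!\Big)^m}\,\pi^{mY_n}\pmod{\pi^{mY_n+1}},$$ where $x\equiv y\pmod{\pi^k}$ means that $\pi^{-k}(x-y)$ is integral. -/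

import Mathlib

open scoped PowerSeries

namespace OpenStratum

noncomputable section

section Combinatorics

/-- The exponent `⌈(p i - j) / d⌉` (only used when `j ≤ p i`). -/
def expo (p d i j : ℕ) : ℕ := ⌈((p : ℚ) * i - j) / d⌉₊

/-- For `σ ∈ S_n`, the sum `∑_{k=1}^n ⌈(p k - σ(k)) / d⌉`. The set `{1, …, n}` is modelled by
`Fin n` through `k ↦ k + 1`. -/
def weight (p d n : ℕ) (σ : Equiv.Perm (Fin n)) : ℕ :=
  ∑ k : Fin n, expo p d (k + 1) (σ k + 1)

/-- `Y_n`, the minimum of the weights over `S_n`. -/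
def Y (p d n : ℕ) : ℕ := Finset.univ.inf' Finset.univ_nonempty (weight p d n)

/-- `Σ_n`, the permutations of minimal weight. -/
def extremal (p d n : ℕ) : Finset (Equiv.Perm (Fin n)) :=
  Finset.univ.filter fun σ => weight p d n σ = Y p d n

/-- `j_i`, the least positive integer congruent to `p i` modulo `d`. -/
def jres (p d i : ℕ) : ℕ := sInf {j : ℕ | 0 < j ∧ j ≡ p * i [MOD d]}

/-- `B_n = {1 ≤ i ≤ n : j_i ≤ n}`. -/
def B (p d n : ℕ) : Finset ℕ := (Finset.Icc 1 n).filter fun i => jres p d i ≤ n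

/-- `𝒫_n(a_1, …, a_d)` for `g = ∑ a_i X^i`. -/
def hasseP {R : Type*} [CommRing R] (p d n : ℕ) (g : Polynomial R) : R :=
  ∑ σ ∈ extremal p d n, ((Equiv.Perm.sign σ : ℤ) : R) *
    ∏ k : Fin n, (g ^ expo p d (k + 1) (σ k + 1)).coeff (p * (k + 1) - (σ k + 1))

/-- `∏_{i ∉ B_n} ⌈p i / d⌉! · ∏_{i ∈ B_n} (⌈p i / d⌉ - 1)!`, with `i` in `{1, …, n}`. -/
def denom (p d n : ℕ) : ℕ :=
  (∏ i ∈ Finset.Icc 1 n \ B p d n, (⌈((p : ℚ) * i) / d⌉₊).factorial) *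
    ∏ i ∈ B p d n, (⌈((p : ℚ) * i) / d⌉₊ - 1).factorial

end Combinatorics

section Fields

variable (p : ℕ) [Fact p.Prime]

/-- The Teichmüller set of the unramified extension of degree `m` of `ℚ_p`: zero and the
`(p ^ m - 1)`-th roots of unity. -/
def teich (m : ℕ) : Set ℂ_[p] := {x | x ^ p ^ m = x}

/-- The unramified extension `K_m` of degree `m` of `ℚ_p` (for `m ≥ 1`), inside `ℂ_p`. -/
def K (m : ℕ) : IntermediateField ℚ_[p] ℂ_[p] := IntermediateField.adjoin ℚ_[p] (teich p m)

/-- The field `K_m(π)`. -/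
def L (m : ℕ) (π : ℂ_[p]) : IntermediateField ℚ_[p] ℂ_[p] :=
  IntermediateField.adjoin ℚ_[p] (insert π (teich p m))

variable {p}

theorem K_le_L (m : ℕ) (π : ℂ_[p]) : K p m ≤ L p m π :=
  IntermediateField.adjoin.mono _ _ _ (Set.subset_insert _ _)

theorem pi_mem_L (m : ℕ) (π : ℂ_[p]) : π ∈ L p m π :=
  IntermediateField.subset_adjoin _ _ (Set.mem_insert _ _)

/-- `τ` is the Frobenius of `K_m(π)`: it is trivial on `ℚ_p(π)` and acts as the `p`-th power map
on the Teichmüller set. -/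
def IsFrobenius {m : ℕ} {π : ℂ_[p]} (τ : L p m π ≃ₐ[ℚ_[p]] L p m π) : Prop :=
  τ ⟨π, pi_mem_L m π⟩ = ⟨π, pi_mem_L m π⟩ ∧
    ∀ x : L p m π, (x : ℂ_[p]) ∈ teich p m → τ x = x ^ p

/-- A polynomial over `K_m`, seen over `ℂ_p`. -/
def toC {m : ℕ} (g : Polynomial (K p m)) : Polynomial ℂ_[p] :=
  g.map (algebraMap (K p m) ℂ_[p])

/-- The conjugate polynomial `g^τ`, seen over `ℂ_p`. -/
def conjC {m : ℕ} {π : ℂ_[p]} (τ : L p m π ≃ₐ[ℚ_[p]] L p m π) (g : Polynomial (K p m)) :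
    Polynomial ℂ_[p] :=
  ((g.map (IntermediateField.inclusion (K_le_L m π)).toRingHom).map
    (τ : L p m π →+* L p m π)).map (algebraMap (L p m π) ℂ_[p])

end Fields

section Dwork

variable {p : ℕ} [Fact p.Prime]

/-- The Laurent series `∑_{n ∈ ℤ} u_n X^n` is an overconvergent function on `|x| = 1`: it
converges on some annulus `1/r < |x| < r` with `r > 1`. -/
def Overconvergent (u : ℤ → ℂ_[p]) : Prop :=
  ∃ r : ℝ, 1 < r ∧ ∃ C : ℝ, ∀ n : ℤ, ‖u n‖ * r ^ n.natAbs ≤ C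

/-- The monomial `X^n`. -/
def mono (n : ℤ) : ℤ → ℂ_[p] := Pi.single n 1

/-- The operator `D = X d/dX + π X g'(X) = H⁻¹ ∘ X d/dX ∘ H`, where `H = exp(π g)`. -/
def D (π : ℂ_[p]) (g : Polynomial ℂ_[p]) (u : ℤ → ℂ_[p]) : ℤ → ℂ_[p] := fun n =>
  (n : ℂ_[p]) * u n +
    π * ∑ i ∈ Finset.range (g.natDegree + 1), (i : ℂ_[p]) * g.coeff i * u (n - i)

/-- Dwork's splitting function `θ(X) = exp(π X - π X^p)`. -/
def theta (π : ℂ_[p]) : ℂ_[p]⟦X⟧ :=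
  (PowerSeries.exp ℂ_[p]).subst
    (PowerSeries.C π * PowerSeries.X - PowerSeries.C π * PowerSeries.X ^ p : ℂ_[p]⟦X⟧)

/-- `F(X) = ∏_{i=1}^d θ(a_i X^i)`. -/
def F (π : ℂ_[p]) (g : Polynomial ℂ_[p]) : ℂ_[p]⟦X⟧ :=
  ∏ i ∈ Finset.Icc 1 g.natDegree,
    (theta π).subst (PowerSeries.C (g.coeff i) * PowerSeries.X ^ i : ℂ_[p]⟦X⟧)

/-- Multiplication of a Laurent series by a power series. -/
def mulSeries (f : ℂ_[p]⟦X⟧) (u : ℤ → ℂ_[p]) : ℤ → ℂ_[p] := fun n =>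
  ∑' k : ℕ, PowerSeries.coeff k f * u (n - k)

/-- `ψ_p (∑ u_n X^n) = ∑ u_{pn} X^n`. -/
def psi (u : ℤ → ℂ_[p]) : ℤ → ℂ_[p] := fun n => u (p * n)

/-- `β = ψ_p ∘ F`. -/
def beta (π : ℂ_[p]) (g : Polynomial ℂ_[p]) (u : ℤ → ℂ_[p]) : ℤ → ℂ_[p] :=
  psi (mulSeries (F π g) u)

/-- `M` is the matrix, in the bases given by `1, X, …, X^{d-1}`, of the map
`H† / D H† → H† / D^τ H†` induced by `β` (`β` carries `D H†` into `D^τ H†`, where `D^τ` is the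
operator `D` for the conjugate polynomial `g^τ`): for each `j`, one has
`β(X^j) ≡ ∑_i M_{ij} X^i` modulo `D^τ H†`. -/
def IsBetaMatrix {m : ℕ} {π : ℂ_[p]} (τ : L p m π ≃ₐ[ℚ_[p]] L p m π) (d : ℕ)
    (g : Polynomial (K p m)) (M : Matrix (Fin d) (Fin d) (L p m π)) : Prop :=
  ∀ j : Fin d, ∃ u : ℤ → ℂ_[p], Overconvergent u ∧
    beta π (toC g) (mono (j : ℕ)) - ∑ i : Fin d, (M i j : ℂ_[p]) • mono (i : ℕ) =
      D π (conjC τ g) u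

end Dwork

section Matrices

/-- The submatrix `Γ = (m_{ij})_{1 ≤ i, j ≤ d-1}` of `M = (m_{ij})_{0 ≤ i, j ≤ d-1}`. -/
def Gam {R : Type*} {d : ℕ} (M : Matrix (Fin d) (Fin d) R) :
    Matrix (Fin (d - 1)) (Fin (d - 1)) R :=
  Matrix.of fun i j => M ⟨i + 1, by omega⟩ ⟨j + 1, by omega⟩

/-- The product `Γ^{τ^{m-1}} Γ^{τ^{m-2}} ⋯ Γ^τ Γ`. -/
def twistedProd {R : Type*} [CommRing R] {N : ℕ} (τ : R → R) (G : Matrix (Fin N) (Fin N) R) :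
    ℕ → Matrix (Fin N) (Fin N) R
  | 0 => 1
  | k + 1 => G.map (τ^[k]) * twistedProd τ G k

/-- The sum of the principal `n × n` minors of `A`. -/
def minorSum {R : Type*} [CommRing R] {N : ℕ} (A : Matrix (Fin N) (Fin N) R) (n : ℕ) : R :=
  ∑ S ∈ (Finset.univ : Finset (Fin N)).powersetCard n,
    (A.submatrix (Subtype.val : S → Fin N) Subtype.val).det

end Matrices

/-- `x ≡ y` modulo `π ^ k` in the ring of integers of `ℂ_p`, that is `v(x - y) ≥ k v(π)`. -/
def CongrModPow {p : ℕ} [Fact p.Prime] (π : ℂ_[p]) (k : ℕ) (x y : ℂ_[p]) : Prop :=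
  ‖x - y‖ ≤ ‖π‖ ^ k

end

end OpenStratum

/-! Matrix entries. Since `β(X^j) = ∑ F_{pn-j} X^n`, the entry `m_{ij}` is `F_{pi-j}` plus what
comes from rewriting the monomials of degree `≥ d` modulo `D^τ`. Rewriting `X^n` costs at most
`|π|^(-n/d)`, while `|F_n| ≤ |π|^(n/2d)` always and `|F_n| ≤ |π|^(n/d)` for `n < p^2`. These bounds
come from the factorisation of `θ` into an Artin–Hasse series, which is integral, and a tail in
powers of `X^(p^2)`. With `p ≥ 3d` the rewritten part is negligible. Comparing `F` with the
truncated exponential of `πg` then gives `m_{ij} ≡ π^e/e! {g^e}_{pi-j}` modulo `π^(e+1)`, where `e =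
⌈(pi-j)/d⌉` (`exists_frobenius_matrix`).

Minors. By the Leibniz formula the leading `n × n` minor of `Γ` is `𝒫_n/denom · π^(Y_n)` modulo
`π^(Y_n+1)`: the non-extremal permutations are smaller, and the extremal ones share their
factorials. For a minor with rows `f` and columns `h`, each row index outside `{1, …, n}` gains two
powers of `π` and each column index outside loses at most one (`Y_add_le_sum_expo`). In a product of
matrices the columns of one factor are the rows of the next, so every excursion outside `{1, …, n}`
is a net gain. Modulo `π^(mY_n+1)` only the product of the conjugates of the leading minor of `Γ`
survives in `ℳ_n` (`norm_minorSum_sub_le`). This product is a norm from `K_m`, because the powers of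
Frobenius exhaust the Galois group (`IsFrobenius.norm_eq_prod`).

Uniqueness of `M`. It must be shown that no nonzero polynomial of degree `< d` lies in the image of
`D`. If `D u` is such a polynomial, then multiplication by `exp(πg)` turns `D` into `X d/dX` and
forces `u` to have no negative part (`exists_toLaurent_of_D_eq`). If `u` decays fast, the top
coefficient of `D` gives `u = 0` directly. Otherwise apply `β`: the relation `β D = p D^τ β`
replaces `u` by a series of better decay and the polynomial by its image under the matrix of `β`.
Since `𝒫_{d-1}` is a unit, `Γ` is invertible, and induction on the decay concludes
(`Dps_eq_zero_of_coeff_eq_zero`). -/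

open scoped PowerSeries

namespace OpenStratum

noncomputable section

/-! ### Logarithmic derivatives of power series -/

section EulerOperator

variable {R : Type*}

/-- The Euler operator `X d/dX` on power series. -/
def eul [CommRing R] : Derivation R R⟦X⟧ R⟦X⟧ :=
  (PowerSeries.X : R⟦X⟧) • PowerSeries.derivative R

theorem coeff_eul [CommRing R] (f : R⟦X⟧) (n : ℕ) :
    PowerSeries.coeff n (eul f) = n * PowerSeries.coeff n f := by
  change PowerSeries.coeff n (PowerSeries.X * PowerSeries.derivative R f) = _
  cases n with
  | zero => simp
  | succ n => rw [PowerSeries.coeff_succ_X_mul, PowerSeries.coeff_derivative]; push_cast; ring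

theorem coeff_zero_mul' [CommRing R] (f g : R⟦X⟧) :
    PowerSeries.coeff 0 (f * g) = PowerSeries.coeff 0 f * PowerSeries.coeff 0 g := by simp

theorem coeff_zero_pow' [CommRing R] (f : R⟦X⟧) (n : ℕ) :
    PowerSeries.coeff 0 (f ^ n) = PowerSeries.coeff 0 f ^ n := by simp

theorem eul_mul [CommRing R] (f g : R⟦X⟧) : eul (f * g) = eul f * g + f * eul g := by
  rw [Derivation.leibniz]; simp only [smul_eq_mul]; ring

/-- Logarithmic derivatives turn products into sums. An equation `eul f = A * f` plays the role of
an exponential formula for `f`, so that identities between exponentials can be checked without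
composing series. -/
theorem eul_mul_of_eq [CommRing R] {f g A B : R⟦X⟧} (hf : eul f = A * f) (hg : eul g = B * g) :
    eul (f * g) = (A + B) * (f * g) := by
  rw [eul_mul, hf, hg]; ring

theorem eul_prod_of_eq [CommRing R] {ι : Type*} (s : Finset ι) (f A : ι → R⟦X⟧)
    (h : ∀ i ∈ s, eul (f i) = A i * f i) :
    eul (∏ i ∈ s, f i) = (∑ i ∈ s, A i) * ∏ i ∈ s, f i := by
  classical
  induction s using Finset.induction_on with
  | empty => simp
  | insert a s ha ih =>
    rw [Finset.prod_insert ha, Finset.sum_insert ha]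
    exact eul_mul_of_eq (h _ (Finset.mem_insert_self _ _))
      (ih fun i hi => h i (Finset.mem_insert_of_mem hi))

theorem eul_pow_of_eq [CommRing R] {f A : R⟦X⟧} (hf : eul f = A * f) (n : ℕ) :
    eul (f ^ n) = (n * A) * f ^ n := by
  have := eul_prod_of_eq (Finset.range n) (fun _ => f) (fun _ => A) fun _ _ => hf
  simpa using this

theorem eul_map {S : Type*} [CommRing R] [CommRing S] (φ : R →+* S) (f : R⟦X⟧) :
    eul (PowerSeries.map φ f) = PowerSeries.map φ (eul f) := by
  ext n; simp [coeff_eul]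

/-- A power series is determined by its logarithmic derivative and its constant term. -/
theorem eq_of_eul_eq [Field R] [CharZero R] {A U V : R⟦X⟧} (hA : PowerSeries.coeff 0 A = 0)
    (hU : eul U = A * U) (hV : eul V = A * V)
    (h0 : PowerSeries.coeff 0 U = PowerSeries.coeff 0 V) : U = V := by
  ext n
  induction n using Nat.strong_induction_on with
  | _ n ih =>
    rcases Nat.eq_zero_or_pos n with rfl | hn
    · exact h0
    have h1 := congrArg (PowerSeries.coeff n) hU
    have h2 := congrArg (PowerSeries.coeff n) hV
    rw [coeff_eul, PowerSeries.coeff_mul] at h1 h2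
    -- Since `A` has no constant term, the right-hand side only involves coefficients of index less
    -- than `n`.
    have h3 : (n : R) * PowerSeries.coeff n U = n * PowerSeries.coeff n V := by
      rw [h1, h2]
      refine Finset.sum_congr rfl fun x hx => ?_
      rw [Finset.HasAntidiagonal.mem_antidiagonal] at hx
      rcases Nat.eq_zero_or_pos x.1 with h | h
      · rw [h, hA]; simp
      · rw [ih x.2 (by omega)]
    exact mul_left_cancel₀ (by exact_mod_cast hn.ne') h3

/-- The coefficients of the solution of `X U' = A U`, `U(0) = 1`. -/
def odeCoeff [Field R] (A : ℕ → R) : ℕ → R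
  | 0 => 1
  | n + 1 => (∑ k : Fin (n + 1), A (n + 1 - k) * odeCoeff A k) / (n + 1)

/-- The solution of `X U' = A U`, `U(0) = 1`. -/
def odeSol [Field R] (A : R⟦X⟧) : R⟦X⟧ :=
  PowerSeries.mk (odeCoeff fun n => PowerSeries.coeff n A)

theorem coeff_zero_odeSol [Field R] (A : R⟦X⟧) : PowerSeries.coeff 0 (odeSol A) = 1 := by
  rw [odeSol, PowerSeries.coeff_mk, odeCoeff]

theorem eul_odeSol [Field R] [CharZero R] {A : R⟦X⟧} (hA : PowerSeries.coeff 0 A = 0) :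
    eul (odeSol A) = A * odeSol A := by
  ext n
  rw [coeff_eul]
  cases n with
  | zero => rw [PowerSeries.coeff_mul]; simp [hA]
  | succ n =>
    rw [mul_comm A, PowerSeries.coeff_mul, Finset.Nat.sum_antidiagonal_eq_sum_range_succ_mk,
      Finset.sum_range_succ]
    simp only [Nat.sub_self, hA, mul_zero, add_zero]
    rw [odeSol, PowerSeries.coeff_mk, odeCoeff, Finset.sum_range]
    have : ((n : R) + 1) ≠ 0 := by exact_mod_cast n.succ_ne_zero
    push_cast
    rw [mul_div_cancel₀ _ this]
    refine Finset.sum_congr rfl fun k _ => ?_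
    rw [PowerSeries.coeff_mk]; ring

theorem hasSubst_monomial [CommRing R] (a : R) {i : ℕ} (hi : i ≠ 0) :
    PowerSeries.HasSubst (PowerSeries.C a * PowerSeries.X ^ i : R⟦X⟧) :=
  PowerSeries.HasSubst.of_constantCoeff_zero' (by simp [hi])

theorem coeff_subst_monomial [CommRing R] (f : R⟦X⟧) (a : R) {i : ℕ} (hi : i ≠ 0) (n : ℕ) :
    PowerSeries.coeff n (f.subst (PowerSeries.C a * PowerSeries.X ^ i : R⟦X⟧)) =
      if i ∣ n then PowerSeries.coeff (n / i) f * a ^ (n / i) else 0 := by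
  rw [PowerSeries.coeff_subst' (hasSubst_monomial a hi)]
  have key : ∀ k : ℕ, PowerSeries.coeff n ((PowerSeries.C a * PowerSeries.X ^ i : R⟦X⟧) ^ k) =
      if n = i * k then a ^ k else 0 := by
    intro k
    rw [mul_pow, ← pow_mul, ← map_pow, PowerSeries.coeff_C_mul_X_pow]
  simp only [key, smul_eq_mul]
  split_ifs with h
  · obtain ⟨k, rfl⟩ := h
    rw [Nat.mul_div_cancel_left _ (Nat.pos_of_ne_zero hi), finsum_eq_single _ k]
    · simp
    · intro l hl
      rw [if_neg, mul_zero]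
      intro h
      exact hl (Nat.eq_of_mul_eq_mul_left (Nat.pos_of_ne_zero hi) h).symm
  · rw [finsum_eq_zero_of_forall_eq_zero]
    intro k
    rw [if_neg, mul_zero]
    rintro rfl
    exact h (dvd_mul_right _ _)

theorem eul_subst_monomial [CommRing R] {f A : R⟦X⟧} (a : R) {i : ℕ} (hi : i ≠ 0)
    (hf : eul f = A * f) :
    eul (f.subst (PowerSeries.C a * PowerSeries.X ^ i : R⟦X⟧)) =
      ((i : R⟦X⟧) * A.subst (PowerSeries.C a * PowerSeries.X ^ i : R⟦X⟧)) *
        f.subst (PowerSeries.C a * PowerSeries.X ^ i : R⟦X⟧) := by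
  rw [mul_assoc, ← PowerSeries.subst_mul (hasSubst_monomial a hi), ← hf]
  ext n
  rw [coeff_eul, ← map_natCast (PowerSeries.C (R := R)), PowerSeries.coeff_C_mul,
    coeff_subst_monomial _ _ hi, coeff_subst_monomial _ _ hi]
  split_ifs with h
  · obtain ⟨k, rfl⟩ := h
    rw [Nat.mul_div_cancel_left _ (Nat.pos_of_ne_zero hi), coeff_eul]
    push_cast; ring
  · simp

theorem subst_monomial_monomial [CommRing R] (a c : R) {i : ℕ} (hi : i ≠ 0) (k : ℕ) :
    (PowerSeries.C c * PowerSeries.X ^ k : R⟦X⟧).subst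
      (PowerSeries.C a * PowerSeries.X ^ i : R⟦X⟧) =
      PowerSeries.C (c * a ^ k) * PowerSeries.X ^ (i * k) := by
  ext n
  rw [coeff_subst_monomial _ _ hi, PowerSeries.coeff_C_mul_X_pow, PowerSeries.coeff_C_mul_X_pow]
  by_cases h : i ∣ n
  · obtain ⟨l, rfl⟩ := h
    rw [if_pos (dvd_mul_right _ _), Nat.mul_div_cancel_left _ (Nat.pos_of_ne_zero hi)]
    by_cases hl : l = k
    · subst hl; simp
    · rw [if_neg hl, if_neg, zero_mul]
      exact fun h => hl (Nat.eq_of_mul_eq_mul_left (Nat.pos_of_ne_zero hi) h)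
  · rw [if_neg h, if_neg]
    rintro rfl
    exact h (dvd_mul_right _ _)

end EulerOperator

/-! ### Absolute values of integers, factorials and `π` -/

section Norms

variable {p : ℕ} [Fact p.Prime]

theorem norm_natCast_eq_padic (n : ℕ) : ‖(n : ℂ_[p])‖ = ‖(n : ℚ_[p])‖ := by
  rw [← map_natCast (algebraMap ℚ_[p] ℂ_[p]), norm_algebraMap']

theorem norm_natCast_le_one (n : ℕ) : ‖(n : ℂ_[p])‖ ≤ 1 :=
  IsUltrametricDist.norm_natCast_le_one _ n

theorem norm_natCast_eq_one {n : ℕ} (h0 : 0 < n) (h : n < p) : ‖(n : ℂ_[p])‖ = 1 := by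
  rw [norm_natCast_eq_padic, Padic.norm_natCast_eq_one_iff]
  exact Nat.coprime_of_lt_prime h0.ne' h Fact.out

theorem norm_factorial_eq_one {n : ℕ} (h : n < p) : ‖(n.factorial : ℂ_[p])‖ = 1 := by
  rw [norm_natCast_eq_padic, Padic.norm_natCast_eq_one_iff]
  exact (Nat.Prime.coprime_iff_not_dvd Fact.out).2 fun hd =>
    absurd ((Nat.Prime.dvd_factorial Fact.out).1 hd) (by omega)

theorem norm_natCast_prime : ‖(p : ℂ_[p])‖ = (p : ℝ)⁻¹ := by
  rw [norm_natCast_eq_padic, Padic.norm_p]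

theorem norm_natCast_le_of_dvd {a b : ℕ} (h : a ∣ b) : ‖(b : ℂ_[p])‖ ≤ ‖(a : ℂ_[p])‖ := by
  obtain ⟨c, rfl⟩ := h
  rw [Nat.cast_mul, norm_mul]
  exact mul_le_of_le_one_right (norm_nonneg _) (norm_natCast_le_one _)

variable {π : ℂ_[p]}

theorem norm_pi_pow (hπ : π ^ (p - 1) = -(p : ℂ_[p])) : ‖π‖ ^ (p - 1) = (p : ℝ)⁻¹ := by
  rw [← norm_pow, hπ, norm_neg, norm_natCast_prime]

theorem norm_pi_lt_one (hπ : π ^ (p - 1) = -(p : ℂ_[p])) : ‖π‖ < 1 := by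
  by_contra h
  have h1 := one_le_pow₀ (n := p - 1) (not_lt.1 h)
  rw [norm_pi_pow hπ] at h1
  have : (1 : ℝ) < p := by exact_mod_cast (Fact.out : p.Prime).one_lt
  exact absurd (inv_lt_one_of_one_lt₀ this) (not_lt.2 h1)

theorem pi_ne_zero (hπ : π ^ (p - 1) = -(p : ℂ_[p])) : π ≠ 0 := by
  rintro rfl
  have h2 := (Fact.out : p.Prime).two_le
  rw [zero_pow (by omega)] at hπ
  have : (p : ℂ_[p]) ≠ 0 := by exact_mod_cast (by omega : p ≠ 0)
  exact this (neg_eq_zero.1 hπ.symm)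

theorem norm_pi_pos (hπ : π ^ (p - 1) = -(p : ℂ_[p])) : 0 < ‖π‖ :=
  norm_pos_iff.2 (pi_ne_zero hπ)

theorem pi_pow_prime (hπ : π ^ (p - 1) = -(p : ℂ_[p])) : π ^ p = -(p * π) := by
  have h2 := (Fact.out : p.Prime).two_le
  have h := pow_succ π (p - 1)
  rw [Nat.sub_add_cancel (by omega), hπ] at h
  rw [h, neg_mul]

/-- Legendre's formula `(p-1) v_p(n!) = n - s_p(n)`, with the digit sum `s_p(n)` discarded. -/
theorem sub_one_mul_padicValNat_factorial_le (n : ℕ) :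
    (p - 1) * padicValNat p n.factorial ≤ n := by
  rw [sub_one_mul_padicValNat_factorial]; omega

theorem norm_factorial_padic (n : ℕ) :
    ‖(n.factorial : ℚ_[p])‖ = ((p : ℝ)⁻¹) ^ padicValNat p n.factorial := by
  rw [Padic.norm_eq_zpow_neg_valuation (by exact_mod_cast n.factorial_ne_zero),
    Padic.valuation_natCast, zpow_neg, zpow_natCast, inv_pow]

theorem inv_prime_le_one : (p : ℝ)⁻¹ ≤ 1 :=
  inv_le_one_of_one_le₀ (by exact_mod_cast (Fact.out : p.Prime).one_lt.le)

/-- Legendre's formula together with `|π|^(p-1) = 1/p`. It says that `exp(πX)` has integral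
coefficients. -/
theorem norm_pi_pow_le_factorial (hπ : π ^ (p - 1) = -(p : ℂ_[p])) (n : ℕ) :
    ‖π‖ ^ n ≤ ‖(n.factorial : ℂ_[p])‖ := by
  have h2 := (Fact.out : p.Prime).two_le
  rw [norm_natCast_eq_padic, norm_factorial_padic]
  refine le_of_pow_le_pow_left₀ (n := p - 1) (by omega) (by positivity) ?_
  rw [← pow_mul, mul_comm, pow_mul, norm_pi_pow hπ, ← pow_mul]
  refine pow_le_pow_of_le_one (by positivity) inv_prime_le_one ?_
  rw [mul_comm]
  exact sub_one_mul_padicValNat_factorial_le n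

/-- For `p ≥ 3` Legendre's formula gives `2 v_p(n!) ≤ n`, hence `n - v_p(n!) ≥ 1`. In other words
`exp(pX) ≡ 1` modulo `p`. -/
theorem norm_prime_pow_div_factorial_le (hp3 : 3 ≤ p) {n : ℕ} (hn : n ≠ 0) :
    ‖(p : ℚ_[p]) ^ n / (n.factorial : ℚ_[p])‖ ≤ (p : ℝ)⁻¹ := by
  have h := sub_one_mul_padicValNat_factorial_le (p := p) n
  have h1 : 2 * padicValNat p n.factorial ≤ (p - 1) * padicValNat p n.factorial :=
    Nat.mul_le_mul_right _ (by omega)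
  have hp0 : (0 : ℝ) < (p : ℝ)⁻¹ := inv_pos.2 (by exact_mod_cast (by omega : 0 < p))
  rw [norm_div, norm_pow, Padic.norm_p, norm_factorial_padic, div_le_iff₀ (by positivity),
    ← pow_succ']
  exact pow_le_pow_of_le_one hp0.le inv_prime_le_one (by omega)

theorem norm_sub_le_max_norm {R : Type*} [SeminormedAddCommGroup R] [IsUltrametricDist R] (x y : R) :
    ‖x - y‖ ≤ max ‖x‖ ‖y‖ := by
  rw [sub_eq_add_neg, ← norm_neg y]
  exact IsUltrametricDist.norm_add_le_max _ _

theorem norm_coeff_mul_le {R : Type*} [NormedField R] [IsUltrametricDist R] {f g : R⟦X⟧} {n : ℕ}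
    {B : ℝ} (hB : 0 ≤ B)
    (h : ∀ a b, a + b = n → ‖PowerSeries.coeff a f‖ * ‖PowerSeries.coeff b g‖ ≤ B) :
    ‖PowerSeries.coeff n (f * g)‖ ≤ B := by
  rw [PowerSeries.coeff_mul]
  refine IsUltrametricDist.norm_sum_le_of_forall_le_of_nonneg hB fun x hx => ?_
  rw [norm_mul]
  exact h _ _ (Finset.HasAntidiagonal.mem_antidiagonal.1 hx)

end Norms

/-! ### Integrality of the Artin–Hasse exponential -/

section ArtinHasse

variable (p : ℕ) [Fact p.Prime]

open Classical in
/-- The series `∑ X^(p^i)`. -/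
def frobSum (R : Type*) [CommRing R] : R⟦X⟧ :=
  PowerSeries.mk fun n => if ∃ i, n = p ^ i then 1 else 0

theorem coeff_zero_frobSum (R : Type*) [CommRing R] : PowerSeries.coeff 0 (frobSum p R) = 0 := by
  rw [frobSum, PowerSeries.coeff_mk, if_neg]
  rintro ⟨i, hi⟩
  exact (pow_pos (Fact.out : p.Prime).pos i).ne hi

theorem frobSum_eq (R : Type*) [CommRing R] : frobSum p R =
    PowerSeries.X + (frobSum p R).subst (PowerSeries.C 1 * PowerSeries.X ^ p : R⟦X⟧) := by
  have hp := (Fact.out : p.Prime)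
  ext n
  rw [map_add, coeff_subst_monomial _ _ hp.ne_zero, frobSum, PowerSeries.coeff_mk,
    PowerSeries.coeff_X, PowerSeries.coeff_mk, one_pow, mul_one]
  by_cases h1 : n = 1
  · subst h1
    rw [if_pos ⟨0, by simp⟩, if_pos rfl, if_neg (fun h => hp.one_lt.ne' (Nat.dvd_one.1 h)), add_zero]
  rw [if_neg h1, zero_add]
  by_cases hd : p ∣ n
  · obtain ⟨k, rfl⟩ := hd
    rw [if_pos (dvd_mul_right _ _), Nat.mul_div_cancel_left _ hp.pos]
    have : (∃ i, p * k = p ^ i) ↔ ∃ i, k = p ^ i := by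
      constructor
      · rintro ⟨i, hi⟩
        cases i with
        | zero => rw [hi, pow_zero] at h1; exact absurd rfl h1
        | succ i =>
          exact ⟨i, Nat.eq_of_mul_eq_mul_left hp.pos (by rw [hi, pow_succ, mul_comm])⟩
      · rintro ⟨i, rfl⟩
        exact ⟨i + 1, by rw [pow_succ, mul_comm]⟩
    by_cases hk : ∃ i, k = p ^ i
    · rw [if_pos hk, if_pos (this.2 hk)]
    · rw [if_neg hk, if_neg (mt this.1 hk)]
  · rw [if_neg hd, if_neg]
    rintro ⟨i, rfl⟩
    cases i with
    | zero => exact h1 (pow_zero _)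
    | succ i => exact hd (dvd_pow_self _ i.succ_ne_zero)

/-- The Artin–Hasse exponential `exp (∑ X^(p^i) / p^i)`. -/
def artinHasse : ℚ_[p]⟦X⟧ := odeSol (frobSum p ℚ_[p])

/-- With `S = frobSum`, both sides have logarithmic derivative `p S`, because `S(X) = X + S(X^p)`.
The last factor is `exp(pX)`. -/
theorem artinHasse_pow : artinHasse p ^ p =
    (artinHasse p).subst (PowerSeries.C 1 * PowerSeries.X ^ p : ℚ_[p]⟦X⟧) *
      PowerSeries.mk fun n => (p : ℚ_[p]) ^ n / (n.factorial : ℚ_[p]) := by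
  have hp := (Fact.out : p.Prime)
  have h1 := eul_odeSol (coeff_zero_frobSum p ℚ_[p])
  have h2 : eul (PowerSeries.mk fun n => (p : ℚ_[p]) ^ n / (n.factorial : ℚ_[p])) =
      ((p : ℚ_[p]⟦X⟧) * PowerSeries.X) *
        PowerSeries.mk fun n => (p : ℚ_[p]) ^ n / (n.factorial : ℚ_[p]) := by
    ext n
    rw [coeff_eul, mul_assoc, ← map_natCast (PowerSeries.C (R := ℚ_[p])),
      PowerSeries.coeff_C_mul]
    cases n with
    | zero => simp
    | succ n =>
      rw [PowerSeries.coeff_succ_X_mul, PowerSeries.coeff_mk, PowerSeries.coeff_mk,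
        Nat.factorial_succ]
      have : ((n : ℚ_[p]) + 1) ≠ 0 := by exact_mod_cast n.succ_ne_zero
      have h' : (n.factorial : ℚ_[p]) ≠ 0 := by exact_mod_cast n.factorial_ne_zero
      push_cast
      field_simp
      ring
  refine eq_of_eul_eq (A := (p : ℚ_[p]⟦X⟧) * frobSum p ℚ_[p]) ?_ (eul_pow_of_eq h1 p) ?_ ?_
  · rw [← map_natCast (PowerSeries.C (R := ℚ_[p])), PowerSeries.coeff_C_mul,
      coeff_zero_frobSum, mul_zero]
  · rw [artinHasse, eul_mul_of_eq (eul_subst_monomial 1 hp.ne_zero h1) h2]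
    congr 1
    conv_rhs => rw [frobSum_eq]
    ring
  · rw [coeff_zero_pow', coeff_zero_mul', coeff_subst_monomial _ _ hp.ne_zero, artinHasse]
    simp [-PowerSeries.coeff_zero_eq_constantCoeff, coeff_zero_odeSol]

/-- Dwork's argument. Let `h` be the truncation of the series `E` below degree `n`, integral by
induction. In degree `n`, `E^p` exceeds `h^p` by `p e_n`. But `E(X)^p ≡ E(X^p)` because `exp(pX) ≡
1`, and `h(X)^p ≡ h(X^p)`, both modulo `p`. So `p` divides `p e_n`. -/
theorem norm_coeff_artinHasse_le (hp3 : 3 ≤ p) (n : ℕ) :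
    ‖PowerSeries.coeff n (artinHasse p)‖ ≤ 1 := by
  have hp := (Fact.out : p.Prime)
  have hp0 : (0 : ℝ) < (p : ℝ)⁻¹ := inv_pos.2 (by exact_mod_cast hp.pos)
  induction n using Nat.strong_induction_on with
  | _ n ih =>
  have h0 : PowerSeries.coeff 0 (artinHasse p) = 1 := coeff_zero_odeSol _
  rcases Nat.eq_zero_or_pos n with rfl | hn
  · rw [h0, norm_one]
  let a : ℕ → ℤ_[p] := fun i => if h : i < n then ⟨PowerSeries.coeff i (artinHasse p), ih i h⟩ else 0
  let h : Polynomial ℤ_[p] := ∑ i ∈ Finset.range n, Polynomial.monomial i (a i)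
  have hcoef : ∀ i, h.coeff i = a i := by
    intro i
    simp only [h, Polynomial.finsetSum_coeff, Polynomial.coeff_monomial, Finset.sum_ite_eq',
      Finset.mem_range]
    split_ifs with hi
    · rfl
    · have : a i = 0 := dif_neg hi
      exact this.symm
  have ha : ∀ i < n, (a i : ℚ_[p]) = PowerSeries.coeff i (artinHasse p) := by
    intro i hi
    have : a i = ⟨PowerSeries.coeff i (artinHasse p), ih i hi⟩ := dif_pos hi
    rw [this]
  let hQ : ℚ_[p]⟦X⟧ := ((h.map PadicInt.Coe.ringHom : Polynomial ℚ_[p]) : ℚ_[p]⟦X⟧)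
  have hQcoef : ∀ i, PowerSeries.coeff i hQ = (a i : ℚ_[p]) := by
    intro i
    simp only [hQ, Polynomial.coeff_coe, Polynomial.coeff_map, hcoef]
    rfl
  have hdvd : (PowerSeries.X : ℚ_[p]⟦X⟧) ^ n ∣ artinHasse p - hQ := by
    rw [PowerSeries.X_pow_dvd_iff]
    intro i hi
    rw [map_sub, hQcoef, ha i hi, sub_self]
  obtain ⟨R, hR⟩ := hdvd
  have hE : artinHasse p = hQ + PowerSeries.X ^ n * R := by rw [← hR]; ring
  have hR0 : PowerSeries.coeff 0 R = PowerSeries.coeff n (artinHasse p) := by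
    rw [hE, map_add, hQcoef, PowerSeries.coeff_X_pow_mul', if_pos le_rfl, Nat.sub_self]
    simp [a]
  -- The remainder of the expansion is divisible by `X^(2n)`, so in degree `n` only the linear term
  -- counts, with value `p * hQ(0)^(p-1) * R(0) = p e_n`.
  obtain ⟨k, hk⟩ := Polynomial.powAddExpansion hQ (PowerSeries.X ^ n * R) p
  have hleft : PowerSeries.coeff n (artinHasse p ^ p) =
      PowerSeries.coeff n (hQ ^ p) + p * PowerSeries.coeff n (artinHasse p) := by
    have e1 : k * (PowerSeries.X ^ n * R) ^ 2 = PowerSeries.X ^ (n + n) * (k * R ^ 2) := by ring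
    have e2 : (p : ℚ_[p]⟦X⟧) * hQ ^ (p - 1) * (PowerSeries.X ^ n * R) =
      PowerSeries.X ^ n * (PowerSeries.C (p : ℚ_[p]) * (hQ ^ (p - 1) * R)) := by
      rw [map_natCast]; ring
    rw [hE, hk, ← hE, e1, e2, map_add, map_add, PowerSeries.coeff_X_pow_mul',
      PowerSeries.coeff_X_pow_mul', if_pos le_rfl, if_neg (by omega), Nat.sub_self, add_zero,
      PowerSeries.coeff_C_mul, coeff_zero_mul', coeff_zero_pow', hQcoef, ha 0 hn, h0, one_pow,
      one_mul, hR0]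
  let T := (artinHasse p).subst (PowerSeries.C 1 * PowerSeries.X ^ p : ℚ_[p]⟦X⟧)
  have hT : ∀ i ≤ n, PowerSeries.coeff i T =
      (((Polynomial.expand ℤ_[p] p h).coeff i : ℤ_[p]) : ℚ_[p]) := by
    intro i hi
    rw [coeff_subst_monomial _ _ hp.ne_zero, Polynomial.coeff_expand hp.pos]
    split_ifs with hd
    · rw [hcoef, ha, one_pow, mul_one]
      rcases Nat.eq_zero_or_pos i with rfl | hi0
      · simpa using hn
      · exact lt_of_lt_of_le (Nat.div_lt_self hi0 hp.one_lt) hi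
    · rfl
  have hfrob : ‖PowerSeries.coeff n T - PowerSeries.coeff n (hQ ^ p)‖ ≤ (p : ℝ)⁻¹ := by
    have e : PowerSeries.coeff n (hQ ^ p) = (((h ^ p).coeff n : ℤ_[p]) : ℚ_[p]) := by
      simp only [hQ]
      rw [← Polynomial.coe_pow, Polynomial.coeff_coe, ← Polynomial.map_pow, Polynomial.coeff_map]
      rfl
    rw [hT n le_rfl, e, ← PadicInt.coe_sub, ← Polynomial.coeff_sub]
    -- Over the prime field, `h(X^p) = h(X)^p`.
    have hz : PadicInt.toZMod ((Polynomial.expand ℤ_[p] p h - h ^ p).coeff n) = 0 := by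
      rw [← Polynomial.coeff_map, Polynomial.map_sub, Polynomial.map_expand, ZMod.expand_card,
        Polynomial.map_pow, sub_self, Polynomial.coeff_zero]
    rw [← RingHom.mem_ker, PadicInt.ker_toZMod, PadicInt.maximalIdeal_eq_span_p,
      Ideal.mem_span_singleton] at hz
    obtain ⟨y, hy⟩ := hz
    rw [hy, PadicInt.coe_mul, norm_mul, PadicInt.coe_natCast, Padic.norm_p]
    exact mul_le_of_le_one_right hp0.le y.2
  have hright : ‖PowerSeries.coeff n (artinHasse p ^ p) - PowerSeries.coeff n T‖ ≤ (p : ℝ)⁻¹ := by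
    have e : artinHasse p ^ p - T =
        T * (PowerSeries.mk (fun n => (p : ℚ_[p]) ^ n / (n.factorial : ℚ_[p])) - 1) := by
      rw [artinHasse_pow]; ring
    rw [← map_sub, e]
    refine norm_coeff_mul_le hp0.le fun i j hij => ?_
    rw [hT i (by omega)]
    refine (mul_le_of_le_one_left (norm_nonneg _)
      ((Polynomial.expand ℤ_[p] p h).coeff i).2).trans ?_
    rw [map_sub, PowerSeries.coeff_mk, PowerSeries.coeff_one]
    split_ifs with hj
    · simp [hj, hp0.le]
    · rw [sub_zero]; exact norm_prime_pow_div_factorial_le hp3 hj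
  have hfin : ‖(p : ℚ_[p]) * PowerSeries.coeff n (artinHasse p)‖ ≤ (p : ℝ)⁻¹ := by
    rw [show (p : ℚ_[p]) * PowerSeries.coeff n (artinHasse p) =
      (PowerSeries.coeff n (artinHasse p ^ p) - PowerSeries.coeff n T) +
        (PowerSeries.coeff n T - PowerSeries.coeff n (hQ ^ p)) by rw [hleft]; ring]
    exact (IsUltrametricDist.norm_add_le_max _ _).trans (max_le hright hfrob)
  rw [norm_mul, Padic.norm_p] at hfin
  exact le_of_mul_le_mul_left (by rwa [mul_one]) hp0

end ArtinHasse

/-! ### Dwork's splitting function -/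

section SplittingFunction

variable {p : ℕ} [Fact p.Prime] {π : ℂ_[p]}

theorem hasSubst_theta : PowerSeries.HasSubst
    (PowerSeries.C π * PowerSeries.X - PowerSeries.C π * PowerSeries.X ^ p : ℂ_[p]⟦X⟧) :=
  PowerSeries.HasSubst.of_constantCoeff_zero' (by simp [(Fact.out : p.Prime).ne_zero])

theorem coeff_zero_theta : PowerSeries.coeff 0 (theta π) = 1 := by
  have h : PowerSeries.exp ℂ_[p] = (PowerSeries.exp ℂ_[p] - PowerSeries.C 1) + PowerSeries.C 1 := by
    ring
  rw [theta, h, PowerSeries.subst_add hasSubst_theta, map_add]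
  have h1 : PowerSeries.coeff 0 ((PowerSeries.exp ℂ_[p] - PowerSeries.C 1).subst
    (PowerSeries.C π * PowerSeries.X - PowerSeries.C π * PowerSeries.X ^ p : ℂ_[p]⟦X⟧)) = 0 := by
    rw [PowerSeries.coeff_zero_eq_constantCoeff_apply]
    refine PowerSeries.constantCoeff_subst_eq_zero ?_ _ ?_
    · have : PowerSeries.constantCoeff (PowerSeries.C π * PowerSeries.X -
        PowerSeries.C π * PowerSeries.X ^ p : ℂ_[p]⟦X⟧) = 0 := by
        simp [(Fact.out : p.Prime).ne_zero]
      exact this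
    · simp
  rw [h1, zero_add]
  have h2 := PowerSeries.subst_C (a := (PowerSeries.C π * PowerSeries.X -
    PowerSeries.C π * PowerSeries.X ^ p : ℂ_[p]⟦X⟧)) (1 : ℂ_[p])
  rw [h2]
  exact PowerSeries.coeff_zero_C 1

/-- The relation `π^p = -pπ` turns `πX - pπX^p` into the first two terms of `∑ (πX)^(p^i)`; this is
what makes `θ` comparable with the Artin–Hasse series. -/
theorem eul_theta (hπ : π ^ (p - 1) = -(p : ℂ_[p])) : eul (theta π) =
    (PowerSeries.C π * PowerSeries.X + PowerSeries.C (π ^ p) * PowerSeries.X ^ p) * theta π := by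
  have h : eul (theta π) = PowerSeries.X * PowerSeries.derivative ℂ_[p] (theta π) := rfl
  rw [h, theta, PowerSeries.derivative_subst hasSubst_theta, PowerSeries.derivative_exp,
    mul_left_comm, mul_comm]
  congr 1
  change eul _ = _
  ext n
  rw [coeff_eul, map_sub, map_add, PowerSeries.coeff_C_mul, PowerSeries.coeff_C_mul,
    PowerSeries.coeff_C_mul, PowerSeries.coeff_X, PowerSeries.coeff_X_pow, pi_pow_prime hπ]
  have h1 := (Fact.out : p.Prime).ne_one
  by_cases hn : n = 1
  · subst hn; rw [if_pos rfl, if_neg h1.symm]; simp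
  · rw [if_neg hn]
    by_cases hn' : n = p
    · rw [if_pos hn', hn']; ring
    · rw [if_neg hn']; simp

/-- The tail `-∑_{i ≥ 2} (π X)^(p^i)`. -/
def tailLog (π : ℂ_[p]) : ℂ_[p]⟦X⟧ :=
  PowerSeries.C π * PowerSeries.X + PowerSeries.C (π ^ p) * PowerSeries.X ^ p -
    (frobSum p ℂ_[p]).subst (PowerSeries.C π * PowerSeries.X ^ 1 : ℂ_[p]⟦X⟧)

theorem coeff_tailLog (n : ℕ) : PowerSeries.coeff n (tailLog π) = 0 ∨
    (p ^ 2 ∣ n ∧ n ≠ 0 ∧ PowerSeries.coeff n (tailLog π) = -π ^ n) := by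
  have hp := (Fact.out : p.Prime)
  rw [tailLog, map_sub, map_add, PowerSeries.coeff_C_mul, PowerSeries.coeff_C_mul,
    PowerSeries.coeff_X, PowerSeries.coeff_X_pow, coeff_subst_monomial _ _ one_ne_zero,
    if_pos (one_dvd _), Nat.div_one, frobSum, PowerSeries.coeff_mk]
  by_cases h : ∃ i, n = p ^ i
  · rw [if_pos h]
    obtain ⟨i, rfl⟩ := h
    match i with
    | 0 => left; rw [pow_zero, if_pos rfl, if_neg hp.ne_one.symm]; simp
    | 1 => left; rw [pow_one, if_pos rfl, if_neg hp.ne_one]; simp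
    | i + 2 =>
      right
      refine ⟨pow_dvd_pow _ (by omega), (pow_pos hp.pos _).ne', ?_⟩
      rw [if_neg, if_neg]
      · simp
      · exact fun h => absurd (Nat.pow_right_injective hp.two_le (h.trans (pow_one p).symm)) (by omega)
      · exact fun h => absurd (Nat.pow_right_injective hp.two_le (h.trans (pow_zero p).symm)) (by omega)
  · left
    rw [if_neg h, if_neg, if_neg]
    · simp
    · exact fun h' => h ⟨1, by rw [h', pow_one]⟩
    · exact fun h' => h ⟨0, by rw [h', pow_zero]⟩

theorem coeff_zero_tailLog : PowerSeries.coeff 0 (tailLog π) = 0 := by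
  rcases coeff_tailLog (π := π) 0 with h | h
  · exact h
  · exact absurd rfl h.2.1

/-- The Artin–Hasse series at `πX` is `exp(πX - πX^p + ∑_{i≥2} (πX)^(p^i)/p^i)`, and the second
factor removes the terms with `i ≥ 2`. The first factor has coefficients of size at most `|π|^n`, so
that any loss is confined to a series in `X^(p^2)`. -/
theorem theta_eq (hπ : π ^ (p - 1) = -(p : ℂ_[p])) : theta π =
    (PowerSeries.map (algebraMap ℚ_[p] ℂ_[p]) (artinHasse p)).subst
      (PowerSeries.C π * PowerSeries.X ^ 1 : ℂ_[p]⟦X⟧) * odeSol (tailLog π) := by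
  have hp := (Fact.out : p.Prime)
  refine eq_of_eul_eq ?_ (eul_theta hπ) ?_ ?_
  · simp [hp.ne_zero]
  · have h1 : eul (PowerSeries.map (algebraMap ℚ_[p] ℂ_[p]) (artinHasse p)) =
        frobSum p ℂ_[p] * PowerSeries.map (algebraMap ℚ_[p] ℂ_[p]) (artinHasse p) := by
      rw [eul_map, artinHasse, eul_odeSol (coeff_zero_frobSum p ℚ_[p]), map_mul]
      congr 1
      ext n
      rw [PowerSeries.coeff_map, frobSum, frobSum, PowerSeries.coeff_mk, PowerSeries.coeff_mk]
      split_ifs <;> simp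
    rw [eul_mul_of_eq (eul_subst_monomial π one_ne_zero h1) (eul_odeSol coeff_zero_tailLog)]
    congr 1
    rw [tailLog]; push_cast; ring
  · rw [coeff_zero_theta, coeff_zero_mul', coeff_zero_odeSol, coeff_subst_monomial _ _ one_ne_zero]
    simp [-PowerSeries.coeff_zero_eq_constantCoeff, artinHasse, coeff_zero_odeSol]

theorem coeff_odeSol_tailLog_eq_zero {n : ℕ} (hn : ¬ p ^ 2 ∣ n) :
    PowerSeries.coeff n (odeSol (tailLog π)) = 0 := by
  induction n using Nat.strong_induction_on with
  | _ n ih =>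
  have h := congrArg (PowerSeries.coeff n) (eul_odeSol (coeff_zero_tailLog (π := π)))
  rw [coeff_eul, PowerSeries.coeff_mul, Finset.sum_eq_zero] at h
  · have hn0 : (n : ℂ_[p]) ≠ 0 := by
      rw [Nat.cast_ne_zero]; rintro rfl; exact hn (dvd_zero _)
    exact (mul_eq_zero.1 h).resolve_left hn0
  · intro x hx
    rw [Finset.HasAntidiagonal.mem_antidiagonal] at hx
    rcases coeff_tailLog (π := π) x.1 with h | ⟨h1, h2, -⟩
    · rw [h, zero_mul]
    · rw [ih x.2 (by omega), mul_zero]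
      exact fun h3 => hn (hx ▸ dvd_add h1 h3)

/-- Solving the recurrence at index `p^2 q` divides by `p^2 q`; these divisions accumulate to
`p^(2q) q!`, while each coefficient of `tailLog` brings the power of `π` equal to its degree. -/
theorem norm_coeff_odeSol_tailLog_mul_le (hπ : π ^ (p - 1) = -(p : ℂ_[p])) (q : ℕ) :
    ‖PowerSeries.coeff (p ^ 2 * q) (odeSol (tailLog π))‖ *
      ‖((p ^ (2 * q) * q.factorial : ℕ) : ℂ_[p])‖ ≤ ‖π‖ ^ (p ^ 2 * q) := by
  have hp := (Fact.out : p.Prime)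
  have hr0 := norm_pi_pos hπ
  induction q using Nat.strong_induction_on with
  | _ q ih =>
  rcases Nat.eq_zero_or_pos q with rfl | hq
  · simp [-PowerSeries.coeff_zero_eq_constantCoeff, coeff_zero_odeSol]
  obtain ⟨q, rfl⟩ : ∃ q', q = q' + 1 := ⟨q - 1, by omega⟩
  have h := congrArg (PowerSeries.coeff (p ^ 2 * (q + 1)))
    (eul_odeSol (coeff_zero_tailLog (π := π)))
  rw [coeff_eul] at h
  have e : ((p ^ (2 * (q + 1)) * (q + 1).factorial : ℕ) : ℂ_[p]) =
      ((p ^ 2 * (q + 1) : ℕ) : ℂ_[p]) * ((p ^ (2 * q) * q.factorial : ℕ) : ℂ_[p]) := by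
    rw [Nat.factorial_succ]; push_cast; ring
  rw [e, ← norm_mul, ← mul_assoc, mul_comm (PowerSeries.coeff _ _), h, norm_mul]
  have hpos : 0 < ‖((p ^ (2 * q) * q.factorial : ℕ) : ℂ_[p])‖ := by
    rw [norm_pos_iff, Nat.cast_ne_zero]
    exact mul_ne_zero (pow_ne_zero _ hp.ne_zero) (Nat.factorial_ne_zero _)
  rw [← le_div_iff₀ hpos]
  refine norm_coeff_mul_le (by positivity) fun a b hab => ?_
  rw [le_div_iff₀ hpos]
  rcases coeff_tailLog (π := π) a with ha | ⟨h1, h2, h3⟩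
  · rw [ha, norm_zero, zero_mul, zero_mul]; positivity
  obtain ⟨b, rfl⟩ : p ^ 2 ∣ b := (Nat.dvd_add_right h1).1 (hab ▸ dvd_mul_right _ _)
  have hb : b < q + 1 := by
    by_contra hb
    have := Nat.mul_le_mul_left (p ^ 2) (not_lt.1 hb)
    omega
  rw [h3, norm_neg, norm_pow, mul_assoc, ← hab, pow_add]
  refine mul_le_mul_of_nonneg_left ?_ (by positivity)
  refine le_trans (mul_le_mul_of_nonneg_left ?_ (norm_nonneg _)) (ih b hb)
  exact norm_natCast_le_of_dvd (mul_dvd_mul (pow_dvd_pow _ (by omega))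
    (Nat.factorial_dvd_factorial (by omega)))

/-- In units of the valuation of `π`, the denominator `p^(2q) q!` costs at most `2(p-1)q + q =
(2p-1)q`. Nothing is lost below index `p^2`. -/
theorem norm_coeff_odeSol_tailLog_le (hπ : π ^ (p - 1) = -(p : ℂ_[p])) (n : ℕ) :
    ‖PowerSeries.coeff n (odeSol (tailLog π))‖ ≤ ‖π‖ ^ (n - (2 * p - 1) * (n / p ^ 2)) := by
  have hp := (Fact.out : p.Prime)
  have hr0 := norm_pi_pos hπ
  by_cases hn : p ^ 2 ∣ n
  · obtain ⟨q, rfl⟩ := hn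
    rw [Nat.mul_div_cancel_left _ (pow_pos hp.pos 2)]
    have hle : ‖π‖ ^ ((2 * p - 1) * q) ≤ ‖((p ^ (2 * q) * q.factorial : ℕ) : ℂ_[p])‖ := by
      have e : (2 * p - 1) * q = (p - 1) * (2 * q) + q := by
        obtain ⟨k, hk⟩ : ∃ k, p = k + 1 := ⟨p - 1, by have := hp.pos; omega⟩
        rw [hk, show 2 * (k + 1) - 1 = 2 * k + 1 by omega, Nat.add_sub_cancel]; ring
      rw [e, pow_add, pow_mul, norm_pi_pow hπ, Nat.cast_mul, norm_mul, Nat.cast_pow, norm_pow,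
        norm_natCast_prime]
      exact mul_le_mul_of_nonneg_left (norm_pi_pow_le_factorial hπ q) (by positivity)
    have h2 : (2 * p - 1) * q ≤ p ^ 2 * q := by
      refine Nat.mul_le_mul_right _ ?_
      have := sq_nonneg ((p : ℤ) - 1)
      zify [show 1 ≤ 2 * p by have := hp.pos; omega]
      linarith
    have h3 := norm_coeff_odeSol_tailLog_mul_le hπ q
    have h4 : ‖π‖ ^ (p ^ 2 * q) = ‖π‖ ^ (p ^ 2 * q - (2 * p - 1) * q) * ‖π‖ ^ ((2 * p - 1) * q) := by
      rw [← pow_add, Nat.sub_add_cancel h2]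
    refine le_of_mul_le_mul_right ?_ (pow_pos hr0 ((2 * p - 1) * q))
    rw [← h4]
    exact (mul_le_mul_of_nonneg_left hle (norm_nonneg _)).trans h3
  · rw [coeff_odeSol_tailLog_eq_zero hn, norm_zero]; positivity

theorem norm_coeff_artinHasse_subst_le (hp3 : 3 ≤ p) (n : ℕ) :
    ‖PowerSeries.coeff n ((PowerSeries.map (algebraMap ℚ_[p] ℂ_[p]) (artinHasse p)).subst
      (PowerSeries.C π * PowerSeries.X ^ 1 : ℂ_[p]⟦X⟧))‖ ≤ ‖π‖ ^ n := by
  rw [coeff_subst_monomial _ _ one_ne_zero, if_pos (one_dvd _), Nat.div_one, norm_mul, norm_pow,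
    PowerSeries.coeff_map, norm_algebraMap']
  exact mul_le_of_le_one_left (by positivity) (norm_coeff_artinHasse_le p hp3 n)

theorem norm_coeff_theta_le (hp3 : 3 ≤ p) (hπ : π ^ (p - 1) = -(p : ℂ_[p])) {k : ℕ}
    (hk : k < p ^ 2) : ‖PowerSeries.coeff k (theta π)‖ ≤ ‖π‖ ^ k := by
  rw [theta_eq hπ]
  refine norm_coeff_mul_le (by positivity) fun a b hab => ?_
  rw [← hab, pow_add]
  refine mul_le_mul (norm_coeff_artinHasse_subst_le hp3 a) ?_ (norm_nonneg _) (by positivity)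
  have := norm_coeff_odeSol_tailLog_le hπ b
  rwa [Nat.div_eq_of_lt (by omega), mul_zero, Nat.sub_zero] at this

/-- For `p ≥ 4` one has `2(2p-1) ≤ p^2`, so the tail loses at most half of the exponent. The square
root `t` of `|π|` keeps exponents integral. -/
theorem norm_coeff_theta_le_of_sq (hp4 : 4 ≤ p) (hπ : π ^ (p - 1) = -(p : ℂ_[p])) {t : ℝ}
    (ht0 : 0 ≤ t) (ht : t ^ 2 = ‖π‖) (k : ℕ) : ‖PowerSeries.coeff k (theta π)‖ ≤ t ^ k := by
  have ht1 : t ≤ 1 := by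
    by_contra h
    have := one_lt_pow₀ (not_le.1 h) two_ne_zero
    rw [ht] at this
    exact absurd (norm_pi_lt_one hπ) (not_lt.2 this.le)
  rw [theta_eq hπ]
  refine norm_coeff_mul_le (by positivity) fun a b hab => ?_
  rw [← hab, pow_add]
  refine mul_le_mul ((norm_coeff_artinHasse_subst_le (by omega) a).trans ?_)
    ((norm_coeff_odeSol_tailLog_le hπ b).trans ?_) (norm_nonneg _) (by positivity)
  · rw [← ht, ← pow_mul]
    exact pow_le_pow_of_le_one ht0 ht1 (by omega)
  · rw [← ht, ← pow_mul]
    refine pow_le_pow_of_le_one ht0 ht1 ?_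
    have h1 : 2 * ((2 * p - 1) * (b / p ^ 2)) ≤ p ^ 2 * (b / p ^ 2) := by
      rw [← mul_assoc]
      refine Nat.mul_le_mul_right _ ?_
      have : 4 * p ≤ p * p := Nat.mul_le_mul_right _ hp4
      rw [pow_two]; omega
    have h2 : p ^ 2 * (b / p ^ 2) ≤ b := Nat.mul_div_le _ _
    omega

/-- The coefficients of `θ` of index less than `p` are those of `exp (π X)`. -/
theorem coeff_theta_of_lt (hπ : π ^ (p - 1) = -(p : ℂ_[p])) {k : ℕ} (hk : k < p) :
    PowerSeries.coeff k (theta π) = π ^ k / (k.factorial : ℂ_[p]) := by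
  induction k with
  | zero => rw [coeff_zero_theta]; simp
  | succ k ih =>
    have h := congrArg (PowerSeries.coeff (k + 1)) (eul_theta hπ)
    rw [coeff_eul, add_mul, map_add, mul_assoc, mul_assoc, PowerSeries.coeff_C_mul,
      PowerSeries.coeff_C_mul, PowerSeries.coeff_succ_X_mul, PowerSeries.coeff_X_pow_mul',
      if_neg (by omega), ih (by omega), mul_zero, add_zero] at h
    have h1 : ((k + 1 : ℕ) : ℂ_[p]) ≠ 0 := Nat.cast_ne_zero.2 k.succ_ne_zero
    have h2 : (k.factorial : ℂ_[p]) ≠ 0 := Nat.cast_ne_zero.2 k.factorial_ne_zero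
    rw [eq_div_iff (Nat.cast_ne_zero.2 (Nat.factorial_ne_zero _)), Nat.factorial_succ,
      Nat.cast_mul, ← mul_assoc, mul_comm (PowerSeries.coeff _ _), h, pow_succ]
    field_simp

end SplittingFunction

/-! ### Truncated exponentials and coefficientwise estimates -/

section CoefficientBounds

/-- The exponential series truncated after the term of degree `e`. -/
def truncExp {R : Type*} [Field R] (e : ℕ) (x : R⟦X⟧) : R⟦X⟧ :=
  ∑ j ∈ Finset.range (e + 1), PowerSeries.C ((j.factorial : R)⁻¹) * x ^ j

/-- By the binomial theorem the terms of total degree at most `e` in the product make up the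
truncated exponential of the sum; only terms of degree greater than `e` remain. -/
theorem truncExp_mul_sub {R : Type*} [Field R] [CharZero R] (e : ℕ) (x y : R⟦X⟧) :
    truncExp e x * truncExp e y - truncExp e (x + y) =
      ∑ ab ∈ (Finset.range (e + 1) ×ˢ Finset.range (e + 1)).filter (fun ab => ¬ ab.1 + ab.2 ≤ e),
        PowerSeries.C (((ab.1.factorial : R)⁻¹) * ((ab.2.factorial : R)⁻¹)) *
          (x ^ ab.1 * y ^ ab.2) := by
  have h1 : truncExp e x * truncExp e y =
      ∑ ab ∈ Finset.range (e + 1) ×ˢ Finset.range (e + 1),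
        PowerSeries.C (((ab.1.factorial : R)⁻¹) * ((ab.2.factorial : R)⁻¹)) *
          (x ^ ab.1 * y ^ ab.2) := by
    rw [truncExp, truncExp, Finset.sum_mul_sum, Finset.sum_product]
    refine Finset.sum_congr rfl fun a _ => Finset.sum_congr rfl fun b _ => ?_
    rw [map_mul]; ring
  have h2 : truncExp e (x + y) =
      ∑ ab ∈ (Finset.range (e + 1) ×ˢ Finset.range (e + 1)).filter (fun ab => ab.1 + ab.2 ≤ e),
        PowerSeries.C (((ab.1.factorial : R)⁻¹) * ((ab.2.factorial : R)⁻¹)) *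
          (x ^ ab.1 * y ^ ab.2) := by
    rw [← Finset.sum_fiberwise_of_maps_to (t := Finset.range (e + 1)) (g := fun ab : ℕ × ℕ => ab.1 + ab.2)
      (fun ab hab => Finset.mem_range.2 (Nat.lt_succ_of_le (Finset.mem_filter.1 hab).2))]
    refine Finset.sum_congr rfl fun j hj => ?_
    have hset : ((Finset.range (e + 1) ×ˢ Finset.range (e + 1)).filter
        (fun ab => ab.1 + ab.2 ≤ e)).filter (fun ab => ab.1 + ab.2 = j) =
        Finset.HasAntidiagonal.antidiagonal j := by
      ext ab
      rw [Finset.mem_range] at hj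
      simp only [Finset.mem_filter, Finset.mem_product, Finset.mem_range,
        Finset.HasAntidiagonal.mem_antidiagonal]
      omega
    rw [hset, (Commute.all x y).add_pow', Finset.mul_sum]
    refine Finset.sum_congr rfl fun ab hab => ?_
    rw [Finset.HasAntidiagonal.mem_antidiagonal] at hab
    subst hab
    rw [nsmul_eq_mul, ← map_natCast (PowerSeries.C (R := R)), ← mul_assoc, ← map_mul]
    congr 2
    have h := Nat.add_choose_mul_factorial_mul_factorial ab.1 ab.2
    have n1 : (ab.1.factorial : R) ≠ 0 := Nat.cast_ne_zero.2 (Nat.factorial_ne_zero _)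
    have n2 : (ab.2.factorial : R) ≠ 0 := Nat.cast_ne_zero.2 (Nat.factorial_ne_zero _)
    have n3 : ((ab.1 + ab.2).factorial : R) ≠ 0 := Nat.cast_ne_zero.2 (Nat.factorial_ne_zero _)
    rw [← mul_inv, inv_mul_eq_div, div_eq_iff n3, ← h, Nat.choose_symm_add]
    push_cast
    field_simp
  rw [h1, h2, sub_eq_iff_eq_add', Finset.sum_filter_add_sum_filter_not]

variable {R : Type*} [NormedField R] [IsUltrametricDist R]

theorem norm_coeff_prod_le {ι : Type*} (s : Finset ι) (f : ι → R⟦X⟧) {t : ℝ} (ht : 0 ≤ t) {N : ℕ}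
    (h : ∀ i ∈ s, ∀ n < N, ‖PowerSeries.coeff n (f i)‖ ≤ t ^ n) :
    ∀ n < N, ‖PowerSeries.coeff n (∏ i ∈ s, f i)‖ ≤ t ^ n := by
  classical
  induction s using Finset.induction_on with
  | empty =>
    intro n _
    rw [Finset.prod_empty, PowerSeries.coeff_one]
    split_ifs with h0
    · simp [h0]
    · rw [norm_zero]; positivity
  | insert a s ha ih =>
    intro n hn
    rw [Finset.prod_insert ha]
    refine norm_coeff_mul_le (by positivity) fun i j hij => ?_
    rw [← hij, pow_add]
    exact mul_le_mul (h a (Finset.mem_insert_self _ _) i (by omega))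
      (ih (fun i hi => h i (Finset.mem_insert_of_mem hi)) j (by omega)) (norm_nonneg _)
      (by positivity)

theorem norm_coeff_pow_le {x : R⟦X⟧} {B : ℝ} (hx : ∀ n, ‖PowerSeries.coeff n x‖ ≤ B) (a n : ℕ) :
    ‖PowerSeries.coeff n (x ^ a)‖ ≤ B ^ a := by
  have hB : 0 ≤ B := (norm_nonneg _).trans (hx 0)
  induction a generalizing n with
  | zero => rw [pow_zero, PowerSeries.coeff_one]; split_ifs <;> simp
  | succ a ih =>
    rw [pow_succ]
    refine norm_coeff_mul_le (by positivity) fun i j _ => ?_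
    rw [pow_succ]
    exact mul_le_mul (ih i) (hx j) (norm_nonneg _) (by positivity)

theorem norm_coeff_truncExp_le {e : ℕ} (he : ∀ j ≤ e, ‖((j.factorial : ℕ) : R)‖ = 1) {x : R⟦X⟧}
    {B : ℝ} (hB : B ≤ 1) (hx : ∀ n, ‖PowerSeries.coeff n x‖ ≤ B) (n : ℕ) :
    ‖PowerSeries.coeff n (truncExp e x)‖ ≤ 1 := by
  rw [truncExp, map_sum]
  refine IsUltrametricDist.norm_sum_le_of_forall_le_of_nonneg zero_le_one fun j hj => ?_
  rw [PowerSeries.coeff_C_mul, norm_mul, norm_inv, he j (by simpa [Nat.lt_succ_iff] using hj),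
    inv_one, one_mul]
  exact (norm_coeff_pow_le hx j n).trans (pow_le_one₀ ((norm_nonneg _).trans (hx 0)) hB)

/-- When the factorials are units, the defect of `truncExp_mul_sub` has size at most `B^(e+1)`.
Congruence to a truncated exponential thus passes to products, which is how one goes from `θ` to
`F`. -/
theorem norm_coeff_mul_sub_truncExp_le [CharZero R] {e : ℕ}
    (he : ∀ j ≤ e, ‖((j.factorial : ℕ) : R)‖ = 1) {x y f h : R⟦X⟧} {B : ℝ} (hB1 : B ≤ 1)
    (hx : ∀ n, ‖PowerSeries.coeff n x‖ ≤ B) (hy : ∀ n, ‖PowerSeries.coeff n y‖ ≤ B) {N : ℕ}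
    (hh : ∀ n < N, ‖PowerSeries.coeff n h‖ ≤ 1)
    (hfx : ∀ n < N, ‖PowerSeries.coeff n (f - truncExp e x)‖ ≤ B ^ (e + 1))
    (hhy : ∀ n < N, ‖PowerSeries.coeff n (h - truncExp e y)‖ ≤ B ^ (e + 1)) :
    ∀ n < N, ‖PowerSeries.coeff n (f * h - truncExp e (x + y))‖ ≤ B ^ (e + 1) := by
  intro n hn
  have hB : 0 ≤ B := (norm_nonneg _).trans (hx 0)
  have e1 : f * h - truncExp e (x + y) = (f - truncExp e x) * h + truncExp e x * (h - truncExp e y) +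
      (truncExp e x * truncExp e y - truncExp e (x + y)) := by ring
  rw [e1, map_add, map_add]
  refine (IsUltrametricDist.norm_add_le_max _ _).trans (max_le
    ((IsUltrametricDist.norm_add_le_max _ _).trans (max_le ?_ ?_)) ?_)
  · refine norm_coeff_mul_le (by positivity) fun i j hij => ?_
    exact (mul_le_of_le_one_right (norm_nonneg _) (hh j (by omega))).trans (hfx i (by omega))
  · refine norm_coeff_mul_le (by positivity) fun i j hij => ?_
    exact (mul_le_of_le_one_left (norm_nonneg _) (norm_coeff_truncExp_le he hB1 hx i)).trans
      (hhy j (by omega))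
  · rw [truncExp_mul_sub, map_sum]
    refine IsUltrametricDist.norm_sum_le_of_forall_le_of_nonneg (by positivity) fun ab hab => ?_
    rw [Finset.mem_filter, Finset.mem_product, Finset.mem_range, Finset.mem_range] at hab
    rw [PowerSeries.coeff_C_mul, norm_mul, norm_mul, norm_inv, norm_inv, he _ (by omega),
      he _ (by omega), inv_one, one_mul, one_mul]
    refine norm_coeff_mul_le (by positivity) fun i j _ => ?_
    refine (mul_le_mul (norm_coeff_pow_le hx _ i) (norm_coeff_pow_le hy _ j) (norm_nonneg _)
      (by positivity)).trans ?_
    rw [← pow_add]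
    exact pow_le_pow_of_le_one hB hB1 (by omega)

end CoefficientBounds

/-! ### Coefficients of the series `F` -/

section FrobeniusSeries

variable {p : ℕ} [Fact p.Prime] {π : ℂ_[p]}

/-- A polynomial of degree `d` without constant term, with integral coefficients and unit leading
coefficient. -/
structure Admissible (d : ℕ) (G : Polynomial ℂ_[p]) : Prop where
  natDegree_eq : G.natDegree = d
  coeff_zero : G.coeff 0 = 0
  norm_coeff_le : ∀ i, ‖G.coeff i‖ ≤ 1
  norm_coeff_natDegree : ‖G.coeff d‖ = 1

/-- The polynomial whose coefficients are the `p`-th powers of those of `G`. -/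
def frobPoly (G : Polynomial ℂ_[p]) : Polynomial ℂ_[p] :=
  ∑ i ∈ Finset.range (G.natDegree + 1), Polynomial.monomial i (G.coeff i ^ p)

theorem coeff_frobPoly (G : Polynomial ℂ_[p]) (i : ℕ) :
    (frobPoly G).coeff i = G.coeff i ^ p := by
  rw [frobPoly, Polynomial.finsetSum_coeff]
  simp only [Polynomial.coeff_monomial, Finset.sum_ite_eq', Finset.mem_range]
  split_ifs with h
  · rfl
  · rw [Polynomial.coeff_eq_zero_of_natDegree_lt (by omega),
      zero_pow (Fact.out : p.Prime).ne_zero]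

/-- Stability under the twist lets every estimate apply to `D^τ` and makes it possible to iterate
`β`, which changes the polynomial at each step. -/
theorem Admissible.frobPoly {d : ℕ} {G : Polynomial ℂ_[p]} (hG : Admissible d G) :
    Admissible d (frobPoly G) where
  natDegree_eq := by
    refine Polynomial.natDegree_eq_of_le_of_coeff_ne_zero ?_ ?_
    · rw [Polynomial.natDegree_le_iff_coeff_eq_zero]
      intro i hi
      rw [coeff_frobPoly, Polynomial.coeff_eq_zero_of_natDegree_lt (by rwa [hG.natDegree_eq]),
        zero_pow (Fact.out : p.Prime).ne_zero]
    · rw [coeff_frobPoly]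
      refine pow_ne_zero _ (norm_ne_zero_iff.1 ?_)
      rw [hG.norm_coeff_natDegree]; exact one_ne_zero
  coeff_zero := by
    rw [coeff_frobPoly, hG.coeff_zero, zero_pow (Fact.out : p.Prime).ne_zero]
  norm_coeff_le i := by
    rw [coeff_frobPoly, norm_pow]; exact pow_le_one₀ (norm_nonneg _) (hG.norm_coeff_le i)
  norm_coeff_natDegree := by
    rw [coeff_frobPoly, norm_pow, hG.norm_coeff_natDegree, one_pow]

theorem norm_coeff_theta_subst_le {t : ℝ} (ht0 : 0 ≤ t) (ht1 : t ≤ 1) {a : ℂ_[p]} (ha : ‖a‖ ≤ 1)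
    {i d N : ℕ} (hi : i ≠ 0) (hid : i ≤ d)
    (h : ∀ k < N, ‖PowerSeries.coeff k (theta π)‖ ≤ t ^ (d * k)) :
    ∀ n < N, ‖PowerSeries.coeff n ((theta π).subst
      (PowerSeries.C a * PowerSeries.X ^ i : ℂ_[p]⟦X⟧))‖ ≤ t ^ n := by
  intro n hn
  rw [coeff_subst_monomial _ _ hi]
  split_ifs with hd
  · obtain ⟨k, rfl⟩ := hd
    rw [Nat.mul_div_cancel_left _ (Nat.pos_of_ne_zero hi), norm_mul, norm_pow]
    refine (mul_le_of_le_one_right (norm_nonneg _) (pow_le_one₀ (norm_nonneg _) ha)).trans ?_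
    refine (h k (lt_of_le_of_lt (Nat.le_mul_of_pos_left _ (Nat.pos_of_ne_zero hi)) hn)).trans ?_
    exact pow_le_pow_of_le_one ht0 ht1 (Nat.mul_le_mul_right _ hid)
  · rw [norm_zero]; positivity

theorem norm_coeff_F_le_aux {t : ℝ} (ht0 : 0 ≤ t) (ht1 : t ≤ 1) {d N : ℕ} {G : Polynomial ℂ_[p]}
    (hG : Admissible d G) (h : ∀ k < N, ‖PowerSeries.coeff k (theta π)‖ ≤ t ^ (d * k)) :
    ∀ n < N, ‖PowerSeries.coeff n (F π G)‖ ≤ t ^ n := by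
  refine norm_coeff_prod_le _ _ ht0 fun i hi => ?_
  rw [Finset.mem_Icc, hG.natDegree_eq] at hi
  exact norm_coeff_theta_subst_le ht0 ht1 (hG.norm_coeff_le i) (by omega) hi.2 h

theorem le_one_of_pow_eq_norm_pi (hπ : π ^ (p - 1) = -(p : ℂ_[p])) {s : ℝ} {e : ℕ}
    (hs : s ^ e = ‖π‖) : s ≤ 1 := by
  by_contra h
  have := one_le_pow₀ (n := e) (not_le.1 h).le
  rw [hs] at this
  exact absurd (norm_pi_lt_one hπ) (not_lt.2 this)

/-- The radius `s = |π|^(1/2d)` makes all rates integral: a factor 2 for the half lost in `θ`, and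
`d` because `θ(a_i X^i)` with `i ≤ d` spreads the degrees at most `d` times. -/
theorem norm_coeff_F_le (hp4 : 4 ≤ p) (hπ : π ^ (p - 1) = -(p : ℂ_[p])) {s : ℝ} (hs0 : 0 ≤ s)
    {d : ℕ} (hs : s ^ (2 * d) = ‖π‖) {G : Polynomial ℂ_[p]} (hG : Admissible d G) (n : ℕ) :
    ‖PowerSeries.coeff n (F π G)‖ ≤ s ^ n := by
  refine norm_coeff_F_le_aux (N := n + 1) hs0 (le_one_of_pow_eq_norm_pi hπ hs) hG (fun k _ => ?_) n
    (Nat.lt_succ_self n)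
  rw [pow_mul]
  exact norm_coeff_theta_le_of_sq hp4 hπ (by positivity) (by rw [← pow_mul, mul_comm, hs]) k

theorem norm_coeff_F_le_of_lt (hp4 : 4 ≤ p) (hπ : π ^ (p - 1) = -(p : ℂ_[p])) {s : ℝ} (hs0 : 0 ≤ s)
    {d : ℕ} (hs : s ^ (2 * d) = ‖π‖) {G : Polynomial ℂ_[p]} (hG : Admissible d G) {n : ℕ}
    (hn : n < p ^ 2) : ‖PowerSeries.coeff n (F π G)‖ ≤ s ^ (2 * n) := by
  rw [pow_mul]
  refine norm_coeff_F_le_aux (N := p ^ 2) (by positivity)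
    (pow_le_one₀ hs0 (le_one_of_pow_eq_norm_pi hπ hs)) hG (fun k hk => ?_) n hn
  rw [← pow_mul, ← mul_assoc, pow_mul, hs]
  exact norm_coeff_theta_le (by omega) hπ hk

theorem coe_eq_sum_of_coeff_zero {G : Polynomial ℂ_[p]} (h0 : G.coeff 0 = 0) :
    (G : ℂ_[p]⟦X⟧) = ∑ i ∈ Finset.Icc 1 G.natDegree,
      PowerSeries.C (G.coeff i) * PowerSeries.X ^ i := by
  ext n
  rw [map_sum, Polynomial.coeff_coe]
  simp only [PowerSeries.coeff_C_mul_X_pow, Finset.sum_ite_eq, Finset.mem_Icc]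
  split_ifs with h
  · rfl
  · rcases Nat.eq_zero_or_pos n with rfl | hn
    · exact h0
    · exact Polynomial.coeff_eq_zero_of_natDegree_lt (by omega)

theorem norm_coeff_theta_subst_sub_truncExp_le (hp3 : 3 ≤ p) (hπ : π ^ (p - 1) = -(p : ℂ_[p]))
    {a : ℂ_[p]} (ha : ‖a‖ ≤ 1) {i e : ℕ} (hi : i ≠ 0) (he : e < p) :
    ∀ n < p ^ 2, ‖PowerSeries.coeff n ((theta π).subst
      (PowerSeries.C a * PowerSeries.X ^ i : ℂ_[p]⟦X⟧) -
        truncExp e (PowerSeries.C (π * a) * PowerSeries.X ^ i))‖ ≤ ‖π‖ ^ (e + 1) := by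
  intro n hn
  have hr := norm_pi_pos hπ
  rw [map_sub, coeff_subst_monomial _ _ hi, truncExp, map_sum]
  have key : ∀ j : ℕ, PowerSeries.coeff n (PowerSeries.C ((j.factorial : ℂ_[p])⁻¹) *
      (PowerSeries.C (π * a) * PowerSeries.X ^ i) ^ j) =
      if n = i * j then (j.factorial : ℂ_[p])⁻¹ * (π * a) ^ j else 0 := by
    intro j
    rw [mul_pow, ← pow_mul, ← map_pow, ← mul_assoc, ← map_mul, PowerSeries.coeff_C_mul_X_pow]
  simp only [key]
  split_ifs with hd
  · obtain ⟨k, rfl⟩ := hd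
    have hinj : ∀ j, (i * k = i * j) = (k = j) := fun j =>
      propext ⟨fun h => Nat.eq_of_mul_eq_mul_left (Nat.pos_of_ne_zero hi) h, fun h => h ▸ rfl⟩
    have hk : k < p ^ 2 := lt_of_le_of_lt (Nat.le_mul_of_pos_left _ (Nat.pos_of_ne_zero hi)) hn
    simp only [hinj, Finset.sum_ite_eq, Finset.mem_range]
    rw [Nat.mul_div_cancel_left _ (Nat.pos_of_ne_zero hi)]
    split_ifs with hke
    · rw [coeff_theta_of_lt hπ (by omega), mul_pow, show π ^ k / (k.factorial : ℂ_[p]) * a ^ k -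
        (k.factorial : ℂ_[p])⁻¹ * (π ^ k * a ^ k) = 0 by rw [div_eq_mul_inv]; ring, norm_zero]
      positivity
    · rw [sub_zero, norm_mul, norm_pow]
      refine (mul_le_of_le_one_right (norm_nonneg _) (pow_le_one₀ (norm_nonneg _) ha)).trans ?_
      exact (norm_coeff_theta_le hp3 hπ hk).trans
        (pow_le_pow_of_le_one hr.le (norm_pi_lt_one hπ).le (by omega))
  · rw [Finset.sum_eq_zero, sub_zero, norm_zero]
    · positivity
    · intro j _
      rw [if_neg]
      rintro rfl
      exact hd (dvd_mul_right _ _)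

theorem norm_coeff_F_sub_truncExp_le (hp4 : 4 ≤ p) (hπ : π ^ (p - 1) = -(p : ℂ_[p])) {d e : ℕ}
    {G : Polynomial ℂ_[p]} (hG : Admissible d G) (he : e < p) :
    ∀ n < p ^ 2, ‖PowerSeries.coeff n (F π G - truncExp e (PowerSeries.C π * (G : ℂ_[p]⟦X⟧)))‖ ≤
      ‖π‖ ^ (e + 1) := by
  have hr := norm_pi_pos hπ
  have hr1 := (norm_pi_lt_one hπ).le
  rw [coe_eq_sum_of_coeff_zero hG.coeff_zero, Finset.mul_sum, F]
  have hfac : ∀ j ≤ e, ‖((j.factorial : ℕ) : ℂ_[p])‖ = 1 := fun j hj =>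
    norm_factorial_eq_one (by omega)
  have hterm : ∀ i ∈ Finset.Icc 1 G.natDegree, ∀ n, ‖PowerSeries.coeff n
      (PowerSeries.C π * (PowerSeries.C (G.coeff i) * PowerSeries.X ^ i) : ℂ_[p]⟦X⟧)‖ ≤ ‖π‖ := by
    intro i _ n
    rw [PowerSeries.coeff_C_mul, PowerSeries.coeff_C_mul_X_pow, norm_mul]
    refine mul_le_of_le_one_right hr.le ?_
    split_ifs
    · exact hG.norm_coeff_le i
    · simp
  generalize hS : Finset.Icc 1 G.natDegree = S at hterm ⊢
  have hS' : ∀ i ∈ S, i ≠ 0 := by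
    intro i hi
    rw [← hS, Finset.mem_Icc] at hi
    omega
  clear hS
  induction S using Finset.induction_on with
  | empty =>
    intro n _
    have : truncExp e (0 : ℂ_[p]⟦X⟧) = 1 := by
      rw [truncExp, Finset.sum_range_succ', Finset.sum_eq_zero]
      · simp
      · intro j _; rw [zero_pow (by omega), mul_zero]
    rw [Finset.prod_empty, Finset.sum_empty, this, sub_self, map_zero, norm_zero]
    positivity
  | insert a S ha ih =>
    rw [Finset.prod_insert ha, Finset.sum_insert ha]
    refine norm_coeff_mul_sub_truncExp_le hfac hr1 (hterm a (Finset.mem_insert_self _ _)) ?_ ?_ ?_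
      (ih (fun i hi => hterm i (Finset.mem_insert_of_mem hi))
        fun i hi => hS' i (Finset.mem_insert_of_mem hi))
    · intro n
      rw [map_sum]
      exact IsUltrametricDist.norm_sum_le_of_forall_le_of_nonneg hr.le fun i hi =>
        hterm i (Finset.mem_insert_of_mem hi) n
    · intro n hn
      have := norm_coeff_prod_le S (fun i => (theta π).subst
        (PowerSeries.C (G.coeff i) * PowerSeries.X ^ i : ℂ_[p]⟦X⟧)) zero_le_one (N := p ^ 2)
        (fun i hi n hn => norm_coeff_theta_subst_le (d := i) zero_le_one le_rfl (hG.norm_coeff_le i)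
          (hS' i (Finset.mem_insert_of_mem hi)) le_rfl (fun k hk => by
            rw [one_pow]
            exact (norm_coeff_theta_le (by omega) hπ hk).trans (pow_le_one₀ hr.le hr1)) n hn) n hn
      rwa [one_pow] at this
    · intro n hn
      rw [← mul_assoc, ← map_mul]
      exact norm_coeff_theta_subst_sub_truncExp_le (by omega) hπ (hG.norm_coeff_le a)
        (hS' a (Finset.mem_insert_self _ _)) he n hn

/-- The leading term of the coefficients of `F`. -/
theorem norm_coeff_F_sub_le (hp4 : 4 ≤ p) (hπ : π ^ (p - 1) = -(p : ℂ_[p])) {d e : ℕ}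
    {G : Polynomial ℂ_[p]} (hG : Admissible d G) (he : e < p) {n : ℕ} (hn : n < p ^ 2)
    (hne : ∀ j < e, d * j < n) :
    ‖PowerSeries.coeff n (F π G) - π ^ e / (e.factorial : ℂ_[p]) * (G ^ e).coeff n‖ ≤
      ‖π‖ ^ (e + 1) := by
  have h := norm_coeff_F_sub_truncExp_le hp4 hπ hG he n hn
  rw [map_sub] at h
  convert h using 3
  -- For `j < e` the polynomial `G^j` has degree at most `d * j < n`, so only the last term of the
  -- truncation contributes.
  rw [truncExp, map_sum, Finset.sum_eq_single e]
  · rw [mul_pow, ← map_pow, ← mul_assoc, ← map_mul, PowerSeries.coeff_C_mul, ← Polynomial.coe_pow,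
      Polynomial.coeff_coe]
    rw [div_eq_mul_inv]; ring
  · intro j hj hje
    rw [mul_pow, ← map_pow, ← mul_assoc, ← map_mul, PowerSeries.coeff_C_mul, ← Polynomial.coe_pow,
      Polynomial.coeff_coe, Polynomial.coeff_eq_zero_of_natDegree_lt, mul_zero]
    rw [Finset.mem_range] at hj
    refine lt_of_le_of_lt Polynomial.natDegree_pow_le ?_
    rw [hG.natDegree_eq, mul_comm]
    exact hne j (by omega)
  · intro h; exact absurd (Finset.mem_range.2 (Nat.lt_succ_self e)) h

/-- Formally `F = exp(π G(X) - π G^τ(X^p))`, with `G^τ` the polynomial `frobPoly G`. -/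
theorem eul_F (hπ : π ^ (p - 1) = -(p : ℂ_[p])) (G : Polynomial ℂ_[p]) : eul (F π G) =
    (PowerSeries.C π * eul (G : ℂ_[p]⟦X⟧) - PowerSeries.C (p * π) *
      (eul (frobPoly G : ℂ_[p]⟦X⟧)).subst (PowerSeries.C 1 * PowerSeries.X ^ p : ℂ_[p]⟦X⟧)) *
      F π G := by
  have hp := (Fact.out : p.Prime)
  have hfactor : ∀ i ∈ Finset.Icc 1 G.natDegree, eul ((theta π).subst
      (PowerSeries.C (G.coeff i) * PowerSeries.X ^ i : ℂ_[p]⟦X⟧)) =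
      (PowerSeries.C (π * (i * G.coeff i)) * PowerSeries.X ^ i -
        PowerSeries.C (p * π * (i * G.coeff i ^ p)) * PowerSeries.X ^ (i * p)) *
      (theta π).subst (PowerSeries.C (G.coeff i) * PowerSeries.X ^ i : ℂ_[p]⟦X⟧) := by
    intro i hi
    rw [Finset.mem_Icc] at hi
    have hi0 : i ≠ 0 := by omega
    rw [eul_subst_monomial _ hi0 (eul_theta hπ), PowerSeries.subst_add (hasSubst_monomial _ hi0)]
    have := subst_monomial_monomial (G.coeff i) π hi0 1
    rw [pow_one, pow_one, mul_one] at this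
    rw [this, subst_monomial_monomial _ _ hi0, pi_pow_prime hπ, ← map_natCast (PowerSeries.C (R := ℂ_[p])) i]
    simp only [map_mul, map_neg]
    ring
  rw [F, eul_prod_of_eq _ _ _ hfactor]
  congr 1
  ext n
  rw [map_sum, map_sub, PowerSeries.coeff_C_mul, PowerSeries.coeff_C_mul, coeff_eul,
    coeff_subst_monomial _ _ hp.ne_zero, one_pow, mul_one]
  simp only [map_sub, PowerSeries.coeff_C_mul_X_pow, Finset.sum_sub_distrib, coeff_eul,
    Polynomial.coeff_coe, coeff_frobPoly, Finset.sum_ite_eq]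
  congr 1
  · split_ifs with h
    · rfl
    · rw [Finset.mem_Icc] at h
      rcases Nat.eq_zero_or_pos n with rfl | hn
      · simp
      · rw [Polynomial.coeff_eq_zero_of_natDegree_lt (by omega)]; simp
  · split_ifs with h
    · obtain ⟨k, rfl⟩ := h
      have hinj : ∀ j, (p * k = j * p) = (k = j) := fun j => propext
        ⟨fun h => Nat.eq_of_mul_eq_mul_left hp.pos (h.trans (mul_comm _ _)),
          fun h => h ▸ mul_comm _ _⟩
      simp only [hinj, Finset.sum_ite_eq, Nat.mul_div_cancel_left _ hp.pos]
      split_ifs with h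
      · rfl
      · rw [Finset.mem_Icc] at h
        rcases Nat.eq_zero_or_pos k with rfl | hn
        · simp
        · rw [Polynomial.coeff_eq_zero_of_natDegree_lt (by omega), zero_pow hp.ne_zero]; simp
    · rw [Finset.sum_eq_zero, mul_zero]
      intro j _
      rw [if_neg]
      rintro rfl
      exact h (dvd_mul_left _ _)

end FrobeniusSeries

/-! ### Reduction of power series modulo the image of `D` -/

section Reduction

variable {p : ℕ} [Fact p.Prime] {π : ℂ_[p]}

/-- The operator `X d/dX + π X G'` on power series. -/
def Dps (π : ℂ_[p]) (G : Polynomial ℂ_[p]) : ℂ_[p]⟦X⟧ →ₗ[ℂ_[p]] ℂ_[p]⟦X⟧ :=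
  (eul (R := ℂ_[p])).toLinearMap +
    LinearMap.mulLeft ℂ_[p] (PowerSeries.C π * eul (G : ℂ_[p]⟦X⟧))

theorem Dps_apply (G : Polynomial ℂ_[p]) (U : ℂ_[p]⟦X⟧) :
    Dps π G U = eul U + PowerSeries.C π * eul (G : ℂ_[p]⟦X⟧) * U := rfl

theorem coeff_Dps (G : Polynomial ℂ_[p]) (U : ℂ_[p]⟦X⟧) (n : ℕ) :
    PowerSeries.coeff n (Dps π G U) = n * PowerSeries.coeff n U +
      ∑ x ∈ Finset.HasAntidiagonal.antidiagonal n,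
        π * (x.1 * G.coeff x.1) * PowerSeries.coeff x.2 U := by
  rw [Dps_apply, map_add, coeff_eul, PowerSeries.coeff_mul]
  simp only [PowerSeries.coeff_C_mul, coeff_eul, Polynomial.coeff_coe]

theorem Admissible.ne_zero {d : ℕ} {G : Polynomial ℂ_[p]} (hG : Admissible d G) : d ≠ 0 := by
  rintro rfl
  have := hG.norm_coeff_natDegree
  rw [hG.coeff_zero, norm_zero] at this
  exact zero_ne_one this

theorem Admissible.norm_lead {d : ℕ} {G : Polynomial ℂ_[p]} (hG : Admissible d G) (hdp : d < p) :
    ‖π * (d * G.coeff d)‖ = ‖π‖ := by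
  rw [norm_mul, norm_mul, hG.norm_coeff_natDegree,
    norm_natCast_eq_one (Nat.pos_of_ne_zero hG.ne_zero) hdp, one_mul, mul_one]

/-- Isolating the top monomial allows one to solve for it. The coefficient of `X^N` is the integer
`N`, without the factor `π` that all the others carry. -/
theorem Dps_X_pow {d : ℕ} {G : Polynomial ℂ_[p]} (hG : Admissible d G) (N : ℕ) :
    Dps π G (PowerSeries.X ^ N) = (π * (d * G.coeff d)) • PowerSeries.X ^ (N + d) +
      ∑ i ∈ Finset.range d, (if i = 0 then (N : ℂ_[p]) else π * (i * G.coeff i)) •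
        PowerSeries.X ^ (N + i) := by
  have hd := Nat.pos_of_ne_zero hG.ne_zero
  have h1 : eul (PowerSeries.X ^ N : ℂ_[p]⟦X⟧) = (N : ℂ_[p]) • PowerSeries.X ^ N := by
    ext n
    rw [coeff_eul, PowerSeries.coeff_smul, PowerSeries.coeff_X_pow, smul_eq_mul]
    split_ifs with h
    · rw [h]
    · simp
  have h2 : PowerSeries.C π * eul (G : ℂ_[p]⟦X⟧) = ∑ i ∈ Finset.range (d + 1),
      (π * (i * G.coeff i)) • PowerSeries.X ^ i := by
    ext n
    rw [PowerSeries.coeff_C_mul, coeff_eul, map_sum, Polynomial.coeff_coe]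
    simp only [PowerSeries.coeff_smul, PowerSeries.coeff_X_pow, smul_eq_mul, mul_ite, mul_one,
      mul_zero, Finset.sum_ite_eq, Finset.mem_range]
    split_ifs with h
    · rfl
    · rw [Polynomial.coeff_eq_zero_of_natDegree_lt (by rw [hG.natDegree_eq]; omega)]; simp
  rw [Dps_apply, h1, h2, Finset.sum_range_succ, add_mul, Finset.sum_mul]
  obtain ⟨e, rfl⟩ : ∃ e, d = e + 1 := ⟨d - 1, by omega⟩
  rw [Finset.sum_range_succ', Finset.sum_range_succ' _ e]
  simp only [Nat.succ_ne_zero, if_false, if_true, Nat.cast_zero, zero_mul, mul_zero, zero_smul,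
    add_zero, smul_mul_assoc, ← pow_add]
  rw [add_comm (e + 1) N]
  simp only [add_comm _ N]
  abel

/-- Reduction of the monomials modulo the image of `D`. -/
theorem exists_reduction_X_pow {s : ℝ} (hs0 : 0 < s) (hs1 : s ≤ 1) {d : ℕ}
    (hs : s ^ (2 * d) = ‖π‖) (hdp : d < p) {G : Polynomial ℂ_[p]} (hG : Admissible d G)
    (S : Subfield ℂ_[p]) (hπS : π ∈ S) (hGS : ∀ i, G.coeff i ∈ S) (n : ℕ) :
    ∃ l v : ℂ_[p]⟦X⟧, PowerSeries.X ^ n = l + Dps π G v ∧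
      (∀ k, d ≤ k → PowerSeries.coeff k l = 0) ∧
      (∀ k, ‖PowerSeries.coeff k l‖ ≤ (s ^ (2 * n))⁻¹) ∧
      (∀ k, PowerSeries.coeff k l ∈ S) ∧
      (∀ k, n < k + d → PowerSeries.coeff k v = 0) ∧
      (∀ k, ‖PowerSeries.coeff k v‖ ≤ (s ^ (2 * n))⁻¹) ∧
      (n < d → l = PowerSeries.X ^ n) := by
  have hr : 0 < ‖π‖ := hs ▸ pow_pos hs0 _
  have hinv : ∀ {a b : ℕ}, a ≤ b → (s ^ a)⁻¹ ≤ (s ^ b)⁻¹ := fun {a b} h =>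
    inv_anti₀ (pow_pos hs0 _) (pow_le_pow_of_le_one hs0.le hs1 h)
  induction n using Nat.strong_induction_on with
  | _ n ih =>
  by_cases hn : n < d
  · refine ⟨PowerSeries.X ^ n, 0, by simp, ?_, ?_, ?_, by simp, ?_, fun _ => rfl⟩
    · intro k hk
      rw [PowerSeries.coeff_X_pow, if_neg (by omega)]
    · intro k
      refine le_trans ?_ (hinv (Nat.zero_le _))
      rw [PowerSeries.coeff_X_pow]
      split_ifs <;> simp
    · intro k
      rw [PowerSeries.coeff_X_pow]
      split_ifs
      · exact S.one_mem
      · exact S.zero_mem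
    · intro k; rw [map_zero, norm_zero]; positivity
  obtain ⟨N, rfl⟩ : ∃ N, n = N + d := ⟨n - d, by omega⟩
  choose! l v h1 h2 h3 h4 h5 h6 h7 using ih
  have hnorm := hG.norm_lead (π := π) hdp
  set κ := π * (d * G.coeff d) with hκ
  have hκ0 : κ ≠ 0 := norm_ne_zero_iff.1 (hnorm ▸ hr.ne')
  set γ : ℕ → ℂ_[p] := fun i => if i = 0 then (N : ℂ_[p]) else π * (i * G.coeff i) with hγ
  -- Only the term `i = 0` can lose a factor `|π|⁻¹ = s^(-2d)`, and it lowers the degree by exactly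
  -- `d`. The other terms lose nothing.
  have hbound : ∀ i < d, ∀ x : ℂ_[p], ‖x‖ ≤ (s ^ (2 * (N + i)))⁻¹ →
      ‖κ⁻¹ * (γ i * x)‖ ≤ (s ^ (2 * (N + d)))⁻¹ := by
    intro i hi x hx
    rw [norm_mul, norm_mul, norm_inv, hnorm]
    by_cases h0 : i = 0
    · subst h0
      have : ‖γ 0‖ ≤ 1 := by simp only [hγ, if_true]; exact norm_natCast_le_one N
      refine (mul_le_mul_of_nonneg_left (mul_le_of_le_one_left (norm_nonneg _) this)
        (by positivity)).trans ?_
      rw [mul_add, pow_add, hs, mul_inv, mul_comm]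
      exact mul_le_mul_of_nonneg_right (by simpa using hx) (by positivity)
    · have : ‖γ i‖ ≤ ‖π‖ := by
        simp only [hγ, if_neg h0]
        rw [norm_mul, norm_mul]
        exact mul_le_of_le_one_right hr.le (mul_le_one₀ (norm_natCast_le_one i) (norm_nonneg _)
          (hG.norm_coeff_le i))
      rw [← mul_assoc]
      refine (mul_le_of_le_one_left (norm_nonneg _) ?_).trans (hx.trans (hinv (by omega)))
      rw [inv_mul_le_iff₀ hr, mul_one]
      exact this
  have hκS : κ⁻¹ ∈ S := S.inv_mem (S.mul_mem hπS (S.mul_mem (natCast_mem S d) (hGS d)))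
  have hγS : ∀ i, γ i ∈ S := by
    intro i
    simp only [hγ]
    split_ifs
    · exact natCast_mem S N
    · exact S.mul_mem hπS (S.mul_mem (natCast_mem S i) (hGS i))
  have cl : ∀ (f : ℕ → ℂ_[p]⟦X⟧) k, PowerSeries.coeff k (κ⁻¹ • ∑ i ∈ Finset.range d, γ i • f i) =
      ∑ i ∈ Finset.range d, κ⁻¹ * (γ i * PowerSeries.coeff k (f i)) := by
    intro f k
    rw [PowerSeries.coeff_smul, map_sum, smul_eq_mul, Finset.mul_sum]
    simp only [PowerSeries.coeff_smul, smul_eq_mul]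
  refine ⟨-(κ⁻¹ • ∑ i ∈ Finset.range d, γ i • l (N + i)),
    κ⁻¹ • PowerSeries.X ^ N - κ⁻¹ • ∑ i ∈ Finset.range d, γ i • v (N + i),
    ?_, ?_, ?_, ?_, ?_, ?_, fun h => absurd h (by omega)⟩
  · have hD := Dps_X_pow (π := π) hG N
    rw [← hκ] at hD
    have hsum : ∑ i ∈ Finset.range d, γ i • PowerSeries.X ^ (N + i) =
        ∑ i ∈ Finset.range d, γ i • l (N + i) + Dps π G (∑ i ∈ Finset.range d, γ i • v (N + i)) := by
      rw [map_sum, ← Finset.sum_add_distrib]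
      refine Finset.sum_congr rfl fun i hi => ?_
      rw [map_smul, ← smul_add, ← h1 (N + i) (by have := Finset.mem_range.1 hi; omega)]
    rw [map_sub, map_smul, map_smul, hD, hsum]
    simp only [smul_add, smul_smul, inv_mul_cancel₀ hκ0, one_smul]
    abel
  · intro k hk
    rw [map_neg, cl, Finset.sum_eq_zero, neg_zero]
    intro i hi
    rw [h2 (N + i) (by have := Finset.mem_range.1 hi; omega) k hk]; simp
  · intro k
    rw [map_neg, norm_neg, cl]
    refine IsUltrametricDist.norm_sum_le_of_forall_le_of_nonneg (by positivity) fun i hi => ?_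
    rw [Finset.mem_range] at hi
    exact hbound i hi _ (h3 (N + i) (by omega) k)
  · intro k
    rw [map_neg, cl]
    refine S.neg_mem (S.sum_mem fun i hi => ?_)
    rw [Finset.mem_range] at hi
    exact S.mul_mem hκS (S.mul_mem (hγS i) (h4 (N + i) (by omega) k))
  · intro k hk
    rw [map_sub, cl, PowerSeries.coeff_smul, PowerSeries.coeff_X_pow, if_neg (by omega), smul_zero,
      Finset.sum_eq_zero, sub_zero]
    intro i hi
    rw [Finset.mem_range] at hi
    rw [h5 (N + i) (by omega) k (by omega)]; simp
  · intro k
    rw [map_sub, cl]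
    refine (norm_sub_le_max_norm _ _).trans (max_le ?_ ?_)
    · rw [PowerSeries.coeff_smul, PowerSeries.coeff_X_pow, smul_eq_mul, norm_mul, norm_inv, hnorm,
        ← hs]
      refine (mul_le_of_le_one_right (by positivity) ?_).trans (hinv (by omega))
      split_ifs <;> simp
    · refine IsUltrametricDist.norm_sum_le_of_forall_le_of_nonneg (by positivity) fun i hi => ?_
      rw [Finset.mem_range] at hi
      exact hbound i hi _ (h6 (N + i) (by omega) k)

/-- Reduction modulo the image of `D` of a sufficiently convergent series. -/
theorem exists_reduction {s : ℝ} (hs0 : 0 < s) (hs1 : s < 1) {d : ℕ}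
    (hs : s ^ (2 * d) = ‖π‖) (hdp : d < p) {G : Polynomial ℂ_[p]} (hG : Admissible d G)
    (S : Subfield ℂ_[p]) (hπS : π ∈ S) (hGS : ∀ i, G.coeff i ∈ S)
    (hS : IsClosed (S : Set ℂ_[p])) {W : ℂ_[p]⟦X⟧} {C : ℝ}
    (hW : ∀ n, ‖PowerSeries.coeff n W‖ ≤ C * s ^ (6 * n))
    (hWS : ∀ n, PowerSeries.coeff n W ∈ S) :
    ∃ c v : ℂ_[p]⟦X⟧, W = c + Dps π G v ∧
      (∀ k, d ≤ k → PowerSeries.coeff k c = 0) ∧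
      (∀ k, ‖PowerSeries.coeff k v‖ ≤ C * s ^ (4 * k)) ∧
      (∀ k, PowerSeries.coeff k c ∈ S) ∧
      ∀ i < d, ∀ B : ℝ, 0 ≤ B →
        (∀ n, d ≤ n → ‖PowerSeries.coeff n W‖ * (s ^ (2 * n))⁻¹ ≤ B) →
        ‖PowerSeries.coeff i c - PowerSeries.coeff i W‖ ≤ B := by
  choose l v h1 h2 h3 h4 h5 h6 h7 using exists_reduction_X_pow hs0 hs1.le hs hdp hG S hπS hGS
  have hC : 0 ≤ C := by simpa using (norm_nonneg _).trans (hW 0)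
  -- The rate `s^(6n)` of `W` absorbs the growth `s^(-2n)` of the reductions and leaves `s^(4n)`.
  have hterm : ∀ (x : ℂ_[p]) (n : ℕ), ‖x‖ ≤ (s ^ (2 * n))⁻¹ →
      ‖PowerSeries.coeff n W * x‖ ≤ C * s ^ (4 * n) := by
    intro x n hx
    rw [norm_mul]
    refine (mul_le_mul (hW n) hx (norm_nonneg _) (by positivity)).trans (le_of_eq ?_)
    rw [show 6 * n = 4 * n + 2 * n by ring, pow_add]
    field_simp
  have hsummable : ∀ x : ℕ → ℂ_[p], (∀ n, ‖x n‖ ≤ (s ^ (2 * n))⁻¹) →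
      Summable fun n => PowerSeries.coeff n W * x n := by
    intro x hx
    refine Summable.of_norm_bounded (g := fun n => C * (s ^ 4) ^ n) ?_ fun n => ?_
    · exact (summable_geometric_of_lt_one (by positivity)
        (pow_lt_one₀ hs0.le hs1 (by norm_num))).mul_left C
    · rw [← pow_mul]; exact hterm _ n (hx n)
  let c : ℂ_[p]⟦X⟧ := PowerSeries.mk fun k => ∑' n, PowerSeries.coeff n W * PowerSeries.coeff k (l n)
  let u : ℂ_[p]⟦X⟧ := PowerSeries.mk fun k => ∑' n, PowerSeries.coeff n W * PowerSeries.coeff k (v n)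
  have hc : ∀ k, HasSum (fun n => PowerSeries.coeff n W * PowerSeries.coeff k (l n))
      (PowerSeries.coeff k c) := by
    intro k
    rw [PowerSeries.coeff_mk]
    exact (hsummable _ fun n => h3 n k).hasSum
  have hu : ∀ k, HasSum (fun n => PowerSeries.coeff n W * PowerSeries.coeff k (v n))
      (PowerSeries.coeff k u) := by
    intro k
    rw [PowerSeries.coeff_mk]
    exact (hsummable _ fun n => h6 n k).hasSum
  have hδ : ∀ k, HasSum (fun n => PowerSeries.coeff n W * PowerSeries.coeff k (PowerSeries.X ^ n))
      (PowerSeries.coeff k W) := by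
    intro k
    have := hasSum_single (f := fun n => PowerSeries.coeff n W *
      PowerSeries.coeff k (PowerSeries.X ^ n : ℂ_[p]⟦X⟧)) k fun n hn => by
        rw [PowerSeries.coeff_X_pow, if_neg hn.symm, mul_zero]
    simpa [PowerSeries.coeff_X_pow] using this
  refine ⟨c, u, ?_, ?_, ?_, ?_, ?_⟩
  · ext k
    refine (hδ k).unique ?_
    have hD : HasSum (fun n => PowerSeries.coeff n W * PowerSeries.coeff k (Dps π G (v n)))
        (PowerSeries.coeff k (Dps π G u)) := by
      rw [coeff_Dps]
      have e : (fun n => PowerSeries.coeff n W * PowerSeries.coeff k (Dps π G (v n))) = fun n =>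
          k * (PowerSeries.coeff n W * PowerSeries.coeff k (v n)) +
          ∑ x ∈ Finset.HasAntidiagonal.antidiagonal k, π * (x.1 * G.coeff x.1) *
            (PowerSeries.coeff n W * PowerSeries.coeff x.2 (v n)) := by
        funext n
        rw [coeff_Dps, mul_add, Finset.mul_sum]
        congr 1
        · ring
        · refine Finset.sum_congr rfl fun x _ => ?_
          ring
      rw [e]
      exact ((hu k).mul_left _).add (hasSum_sum fun x _ => (hu x.2).mul_left _)
    have := (hc k).add hD
    rw [map_add]
    convert this using 2 with n
    rw [h1 n, map_add, mul_add]
  · intro k hk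
    rw [PowerSeries.coeff_mk]
    simp only [h2 _ k hk, mul_zero, tsum_zero]
  · intro k
    rw [PowerSeries.coeff_mk]
    refine IsUltrametricDist.norm_tsum_le_of_forall_le_of_nonneg (by positivity) fun n => ?_
    -- `X^n` contributes to index `k` of the primitive only when `n ≥ k + d`; this converts decay in
    -- `n` into decay in `k`.
    by_cases hn : n < k + d
    · rw [h5 n k hn, mul_zero, norm_zero]; positivity
    · refine (hterm _ n (h6 n k)).trans (mul_le_mul_of_nonneg_left ?_ hC)
      exact pow_le_pow_of_le_one hs0.le hs1.le (by omega)
  · intro k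
    rw [PowerSeries.coeff_mk]
    exact hS.mem_of_tendsto (hsummable _ fun n => h3 n k).hasSum
      (Filter.Eventually.of_forall fun t => S.sum_mem fun n _ => S.mul_mem (hWS n) (h4 n k))
  · intro i hi B hB h
    have hsub := (hc i).sub (hδ i)
    rw [← hsub.tsum_eq]
    refine IsUltrametricDist.norm_tsum_le_of_forall_le_of_nonneg hB fun n => ?_
    -- Monomials of degree less than `d` are their own reductions, so only `n ≥ d` contributes to
    -- the difference.
    by_cases hn : n < d
    · rw [h7 n hn, sub_self, norm_zero]; exact hB
    · rw [PowerSeries.coeff_X_pow, if_neg (by omega), mul_zero, sub_zero, norm_mul]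
      exact (mul_le_mul_of_nonneg_left (h3 n i) (norm_nonneg _)).trans (h n (by omega))

/-- `D` is injective, modulo polynomials of degree less than `d`, on strongly convergent series. -/
theorem eq_zero_of_coeff_Dps_eq_zero {s : ℝ} (hs0 : 0 < s) (hs1 : s < 1) {d : ℕ}
    (hs : s ^ (2 * d) = ‖π‖) (hdp : d < p) {G : Polynomial ℂ_[p]} (hG : Admissible d G)
    {u : ℂ_[p]⟦X⟧} {C : ℝ} (hu : ∀ k, ‖PowerSeries.coeff k u‖ ≤ C * s ^ (4 * k))
    (h : ∀ n, d ≤ n → PowerSeries.coeff n (Dps π G u) = 0) : u = 0 := by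
  have hd := Nat.pos_of_ne_zero hG.ne_zero
  have hr : 0 < ‖π‖ := hs ▸ pow_pos hs0 _
  have hnorm := hG.norm_lead (π := π) hdp
  -- The coefficient of index `k + d` of `D u` isolates `κ u_k` with `|κ| = |π| = s^(2d)`. The term
  -- in `u_{k+d}` brings `s^(4d)`, and those in `π u_{k+d-i}` with `i < d` bring at least `|π| s^4`;
  -- dividing by `κ` still gains `s^2`. Iterating gives `u = 0`.
  have improve : ∀ A : ℝ, (∀ k, ‖PowerSeries.coeff k u‖ ≤ A * s ^ (4 * k)) →
      ∀ k, ‖PowerSeries.coeff k u‖ ≤ (A * s ^ 2) * s ^ (4 * k) := by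
    intro A hA k
    have hA0 : 0 ≤ A := by simpa using (norm_nonneg _).trans (hA 0)
    have hk := h (k + d) (by omega)
    have hmem : (d, k) ∈ Finset.HasAntidiagonal.antidiagonal (k + d) := by
      rw [Finset.HasAntidiagonal.mem_antidiagonal]; omega
    rw [coeff_Dps, ← Finset.add_sum_erase _ _ hmem] at hk
    have hk' : π * (d * G.coeff d) * PowerSeries.coeff k u =
        -((k + d : ℕ) * PowerSeries.coeff (k + d) u) -
        ∑ x ∈ (Finset.HasAntidiagonal.antidiagonal (k + d)).erase (d, k),
          π * (x.1 * G.coeff x.1) * PowerSeries.coeff x.2 u := by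
      linear_combination hk
    have hle : ‖π * (d * G.coeff d) * PowerSeries.coeff k u‖ ≤
        ‖π‖ * ((A * s ^ 2) * s ^ (4 * k)) := by
      rw [hk']
      refine (norm_sub_le_max_norm _ _).trans (max_le ?_ ?_)
      · rw [norm_neg, norm_mul]
        refine (mul_le_of_le_one_left (norm_nonneg _) (norm_natCast_le_one _)).trans
          ((hA _).trans ?_)
        rw [← hs, show s ^ (2 * d) * (A * s ^ 2 * s ^ (4 * k)) = A * s ^ (2 * d + 2 + 4 * k) by ring]
        exact mul_le_mul_of_nonneg_left (pow_le_pow_of_le_one hs0.le hs1.le (by omega)) hA0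
      · refine IsUltrametricDist.norm_sum_le_of_forall_le_of_nonneg (by positivity) fun x hx => ?_
        rw [Finset.mem_erase, Finset.HasAntidiagonal.mem_antidiagonal] at hx
        have hne : x.1 ≠ d := by
          intro h1
          exact hx.1 (Prod.ext h1 (by simp only; omega))
        by_cases hlt : x.1 < d
        · rw [norm_mul, norm_mul, norm_mul, mul_assoc]
          refine mul_le_mul_of_nonneg_left ?_ hr.le
          refine (mul_le_of_le_one_left (norm_nonneg _) (mul_le_one₀ (norm_natCast_le_one _)
            (norm_nonneg _) (hG.norm_coeff_le _))).trans ((hA _).trans ?_)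
          rw [mul_assoc, ← pow_add]
          exact mul_le_mul_of_nonneg_left (pow_le_pow_of_le_one hs0.le hs1.le (by omega)) hA0
        · rw [Polynomial.coeff_eq_zero_of_natDegree_lt (by rw [hG.natDegree_eq]; omega)]
          simp only [mul_zero, zero_mul, norm_zero]
          positivity
    rw [norm_mul, hnorm] at hle
    exact le_of_mul_le_mul_left hle hr
  have iter : ∀ N k, ‖PowerSeries.coeff k u‖ ≤ (C * (s ^ 2) ^ N) * s ^ (4 * k) := by
    intro N
    induction N with
    | zero => simpa using hu
    | succ N ih =>
      intro k
      have := improve _ ih k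
      rwa [mul_assoc C, ← pow_succ] at this
  ext k
  rw [map_zero, ← norm_le_zero_iff]
  have hlim : Filter.Tendsto (fun N : ℕ => (C * (s ^ 2) ^ N) * s ^ (4 * k)) Filter.atTop
      (nhds ((C * 0) * s ^ (4 * k))) :=
    ((tendsto_pow_atTop_nhds_zero_of_lt_one (by positivity)
      (pow_lt_one₀ hs0.le hs1 two_ne_zero)).const_mul C).mul_const _
  rw [mul_zero, zero_mul] at hlim
  exact ge_of_tendsto' hlim fun N => iter N k

end Reduction

/-! ### Commutation of `β` with `D` -/

section Frobenius

variable {p : ℕ} [Fact p.Prime] {π : ℂ_[p]}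

/-- The operator `∑ u_n X^n ↦ ∑ u_{pn} X^n` on power series. -/
def psiPS (W : ℂ_[p]⟦X⟧) : ℂ_[p]⟦X⟧ := PowerSeries.mk fun n => PowerSeries.coeff (p * n) W

theorem coeff_psiPS (W : ℂ_[p]⟦X⟧) (n : ℕ) :
    PowerSeries.coeff n (psiPS W) = PowerSeries.coeff (p * n) W := PowerSeries.coeff_mk _ _

theorem psiPS_subst_mul (f W : ℂ_[p]⟦X⟧) :
    psiPS (f.subst (PowerSeries.C 1 * PowerSeries.X ^ p : ℂ_[p]⟦X⟧) * W) = f * psiPS W := by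
  have hp := (Fact.out : p.Prime)
  ext n
  rw [coeff_psiPS, PowerSeries.coeff_mul, PowerSeries.coeff_mul]
  symm
  refine Finset.sum_of_injOn (fun x => (p * x.1, p * x.2)) ?_ ?_ ?_ ?_
  · intro x _ y _ h
    rw [Prod.mk.injEq] at h
    exact Prod.ext (Nat.eq_of_mul_eq_mul_left hp.pos h.1) (Nat.eq_of_mul_eq_mul_left hp.pos h.2)
  · intro x hx
    rw [Finset.mem_coe, Finset.HasAntidiagonal.mem_antidiagonal] at hx ⊢
    simp only
    rw [← mul_add, hx]
  · intro x hx hx'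
    rw [coeff_subst_monomial _ _ hp.ne_zero, if_neg, zero_mul]
    rintro ⟨a, ha⟩
    rw [Finset.HasAntidiagonal.mem_antidiagonal] at hx
    obtain ⟨b, hb⟩ : p ∣ x.2 := (Nat.dvd_add_right ⟨a, ha⟩).1 (hx ▸ dvd_mul_right _ _)
    refine hx' ⟨(a, b), ?_, Prod.ext ha.symm hb.symm⟩
    rw [Finset.mem_coe, Finset.HasAntidiagonal.mem_antidiagonal]
    rw [ha, hb, ← mul_add] at hx
    exact Nat.eq_of_mul_eq_mul_left hp.pos hx
  · intro x _
    rw [coeff_subst_monomial _ _ hp.ne_zero, if_pos (dvd_mul_right _ _), one_pow, mul_one,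
      Nat.mul_div_cancel_left _ hp.pos, coeff_psiPS]

/-- The operator `ψ_p ∘ F` on power series. -/
def betaPS (π : ℂ_[p]) (G : Polynomial ℂ_[p]) (U : ℂ_[p]⟦X⟧) : ℂ_[p]⟦X⟧ := psiPS (F π G * U)

theorem coeff_betaPS_X_pow (G : Polynomial ℂ_[p]) (j n : ℕ) :
    PowerSeries.coeff n (betaPS π G (PowerSeries.X ^ j)) =
      if j ≤ p * n then PowerSeries.coeff (p * n - j) (F π G) else 0 := by
  rw [betaPS, coeff_psiPS, mul_comm (F π G), PowerSeries.coeff_X_pow_mul']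

/-- Formally, with `H = exp(πG)` and `H_τ = exp(πG^τ)`, the operators `D` and `D^τ` are the
conjugates of `X d/dX` by `H` and `H_τ`, and `β = H_τ⁻¹ ∘ ψ_p ∘ H`. The factor `p` comes from `ψ_p ∘
X d/dX = p X d/dX ∘ ψ_p`. -/
theorem betaPS_Dps (hπ : π ^ (p - 1) = -(p : ℂ_[p])) (G : Polynomial ℂ_[p]) (U : ℂ_[p]⟦X⟧) :
    betaPS π G (Dps π G U) = (p : ℂ_[p]) • Dps π (frobPoly G) (betaPS π G U) := by
  have key : F π G * Dps π G U = eul (F π G * U) +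
      (PowerSeries.C (p * π) * eul (frobPoly G : ℂ_[p]⟦X⟧)).subst
        (PowerSeries.C 1 * PowerSeries.X ^ p : ℂ_[p]⟦X⟧) * (F π G * U) := by
    have hsub := hasSubst_monomial (1 : ℂ_[p]) (Fact.out : p.Prime).ne_zero
    have hC : (PowerSeries.C (p * π) : ℂ_[p]⟦X⟧).subst
        (PowerSeries.C 1 * PowerSeries.X ^ p : ℂ_[p]⟦X⟧) = PowerSeries.C (p * π) :=
      PowerSeries.subst_C (p * π)
    rw [PowerSeries.subst_mul hsub, hC, eul_mul, eul_F hπ, Dps_apply]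
    ring
  have e : ∀ A B : ℂ_[p]⟦X⟧, psiPS (A + B) = psiPS A + psiPS B := by
    intro A B; ext n; simp [coeff_psiPS]
  rw [betaPS, key, e, psiPS_subst_mul, Dps_apply, smul_add]
  congr 1
  · ext n
    rw [coeff_psiPS, coeff_eul, PowerSeries.coeff_smul, coeff_eul, betaPS, coeff_psiPS, smul_eq_mul]
    push_cast; ring
  · rw [map_mul, PowerSeries.smul_eq_C_mul, betaPS]; ring

end Frobenius

/-! ### Power series inside Laurent series -/

section Laurent

variable {p : ℕ} [Fact p.Prime] {π : ℂ_[p]}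

/-- A power series seen as a Laurent series. -/
def toLaurent : ℂ_[p]⟦X⟧ →ₗ[ℂ_[p]] (ℤ → ℂ_[p]) where
  toFun U n := if 0 ≤ n then PowerSeries.coeff n.toNat U else 0
  map_add' U V := by
    funext n; simp only [Pi.add_apply, map_add]; split_ifs <;> simp
  map_smul' c U := by
    funext n; simp only [Pi.smul_apply, PowerSeries.coeff_smul, RingHom.id_apply]
    split_ifs <;> simp

theorem toLaurent_natCast (U : ℂ_[p]⟦X⟧) (n : ℕ) :
    toLaurent U (n : ℤ) = PowerSeries.coeff n U := by
  change (if (0 : ℤ) ≤ n then PowerSeries.coeff (n : ℤ).toNat U else 0) = _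
  rw [if_pos (Int.natCast_nonneg n), Int.toNat_natCast]

theorem toLaurent_of_neg (U : ℂ_[p]⟦X⟧) {n : ℤ} (hn : n < 0) : toLaurent U n = 0 :=
  if_neg (not_le.2 hn)

theorem toLaurent_injective : Function.Injective (toLaurent (p := p)) := by
  intro U V h
  ext n
  rw [← toLaurent_natCast, h, toLaurent_natCast]

theorem toLaurent_X_pow (j : ℕ) : toLaurent (PowerSeries.X ^ j : ℂ_[p]⟦X⟧) = mono (j : ℤ) := by
  funext n
  rcases lt_or_ge n 0 with hn | hn
  · rw [toLaurent_of_neg _ hn, mono, Pi.single_eq_of_ne (by omega)]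
  · lift n to ℕ using hn
    rw [toLaurent_natCast, PowerSeries.coeff_X_pow, mono, Pi.single_apply]
    simp only [Nat.cast_inj]

theorem sum_antidiagonal_eq_sum_range {G : Polynomial ℂ_[p]} (U : ℂ_[p]⟦X⟧) (n : ℕ) :
    ∑ x ∈ Finset.HasAntidiagonal.antidiagonal n,
        π * (x.1 * G.coeff x.1) * PowerSeries.coeff x.2 U =
      π * ∑ i ∈ Finset.range (G.natDegree + 1),
        (i : ℂ_[p]) * G.coeff i * toLaurent U ((n : ℤ) - i) := by
  rw [Finset.Nat.sum_antidiagonal_eq_sum_range_succ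
    (fun a b => π * (a * G.coeff a) * PowerSeries.coeff b U), Finset.mul_sum]
  have h1 : ∀ i ∈ Finset.range (n + 1), π * (i * G.coeff i) * PowerSeries.coeff (n - i) U =
      π * ((i : ℂ_[p]) * G.coeff i * toLaurent U ((n : ℤ) - i)) := by
    intro i hi
    rw [Finset.mem_range] at hi
    rw [← Nat.cast_sub (by omega), toLaurent_natCast]; ring
  rw [Finset.sum_congr rfl h1]
  -- Both sums extend to a common range: beyond `n` the Laurent coefficient has negative index, and
  -- beyond its degree `G` vanishes.
  have big : ∀ N, n + 1 ≤ N → G.natDegree + 1 ≤ N →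
      ∑ i ∈ Finset.range (n + 1), π * ((i : ℂ_[p]) * G.coeff i * toLaurent U ((n : ℤ) - i)) =
      ∑ i ∈ Finset.range (G.natDegree + 1),
        π * ((i : ℂ_[p]) * G.coeff i * toLaurent U ((n : ℤ) - i)) := by
    intro N hN1 hN2
    trans ∑ i ∈ Finset.range N, π * ((i : ℂ_[p]) * G.coeff i * toLaurent U ((n : ℤ) - i))
    · refine Finset.sum_subset (Finset.range_mono hN1) fun i _ hi => ?_
      rw [Finset.mem_range] at hi
      rw [toLaurent_of_neg _ (by omega)]; simp
    · symm
      refine Finset.sum_subset (Finset.range_mono hN2) fun i _ hi => ?_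
      rw [Finset.mem_range] at hi
      rw [Polynomial.coeff_eq_zero_of_natDegree_lt (by omega)]; simp
  exact big (n + 1 + (G.natDegree + 1)) (by omega) (by omega)

theorem D_toLaurent (G : Polynomial ℂ_[p]) (U : ℂ_[p]⟦X⟧) :
    D π G (toLaurent U) = toLaurent (Dps π G U) := by
  funext n
  rcases lt_or_ge n 0 with hn | hn
  · rw [toLaurent_of_neg _ hn, D, toLaurent_of_neg _ hn, Finset.sum_eq_zero]
    · simp
    · intro i _
      rw [toLaurent_of_neg _ (by omega), mul_zero]
  · lift n to ℕ using hn
    rw [toLaurent_natCast, coeff_Dps, sum_antidiagonal_eq_sum_range, D, toLaurent_natCast]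
    simp

theorem mulSeries_toLaurent (f U : ℂ_[p]⟦X⟧) :
    mulSeries f (toLaurent U) = toLaurent (f * U) := by
  funext n
  rcases lt_or_ge n 0 with hn | hn
  · rw [toLaurent_of_neg _ hn, mulSeries]
    have : ∀ k : ℕ, PowerSeries.coeff k f * toLaurent U (n - k) = 0 := fun k => by
      rw [toLaurent_of_neg _ (by omega), mul_zero]
    simp only [this, tsum_zero]
  · lift n to ℕ using hn
    rw [toLaurent_natCast, mulSeries, tsum_eq_sum (s := Finset.range (n + 1)), PowerSeries.coeff_mul,
      Finset.Nat.sum_antidiagonal_eq_sum_range_succ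
        (fun a b => PowerSeries.coeff a f * PowerSeries.coeff b U)]
    · refine Finset.sum_congr rfl fun k hk => ?_
      rw [Finset.mem_range] at hk
      rw [← Nat.cast_sub (by omega), toLaurent_natCast]
    · intro k hk
      rw [Finset.mem_range] at hk
      rw [toLaurent_of_neg _ (by omega), mul_zero]

theorem psi_toLaurent (U : ℂ_[p]⟦X⟧) : psi (toLaurent U) = toLaurent (psiPS U) := by
  have hp := (Fact.out : p.Prime).pos
  funext n
  rcases lt_or_ge n 0 with hn | hn
  · rw [toLaurent_of_neg _ hn, psi, toLaurent_of_neg]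
    exact mul_neg_of_pos_of_neg (by exact_mod_cast hp) hn
  · lift n to ℕ using hn
    rw [toLaurent_natCast, psi, ← Nat.cast_mul, toLaurent_natCast, coeff_psiPS]

theorem beta_toLaurent (G : Polynomial ℂ_[p]) (U : ℂ_[p]⟦X⟧) :
    beta π G (toLaurent U) = toLaurent (betaPS π G U) := by
  rw [beta, mulSeries_toLaurent, psi_toLaurent, betaPS]

theorem overconvergent_toLaurent {U : ℂ_[p]⟦X⟧} {C t : ℝ} (ht0 : 0 < t) (ht1 : t < 1)
    (h : ∀ k, ‖PowerSeries.coeff k U‖ ≤ C * t ^ k) : Overconvergent (toLaurent U) := by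
  refine ⟨t⁻¹, one_lt_inv_iff₀.2 ⟨ht0, ht1⟩, C, fun n => ?_⟩
  have hC : 0 ≤ C := by simpa using (norm_nonneg _).trans (h 0)
  rcases lt_or_ge n 0 with hn | hn
  · rw [toLaurent_of_neg _ hn, norm_zero, zero_mul]; exact hC
  · lift n to ℕ using hn
    rw [toLaurent_natCast, Int.natAbs_natCast, inv_pow, ← div_eq_mul_inv,
      div_le_iff₀ (pow_pos ht0 n)]
    exact h n

end Laurent

/-! ### Vanishing of the negative part of solutions -/

section NegativePart

variable {p : ℕ} [Fact p.Prime] {π : ℂ_[p]}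

/-- The series `exp (π G)` has integral coefficients. -/
theorem exists_exp (hπ : π ^ (p - 1) = -(p : ℂ_[p])) {d : ℕ} {G : Polynomial ℂ_[p]}
    (hG : Admissible d G) : ∃ E : ℂ_[p]⟦X⟧, PowerSeries.coeff 0 E = 1 ∧
      (∀ k, ‖PowerSeries.coeff k E‖ ≤ 1) ∧
      eul E = PowerSeries.C π * eul (G : ℂ_[p]⟦X⟧) * E := by
  let e : ℂ_[p]⟦X⟧ := PowerSeries.mk fun k => π ^ k / (k.factorial : ℂ_[p])
  have he : eul e = (PowerSeries.C π * PowerSeries.X ^ 1) * e := by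
    ext n
    rw [coeff_eul, pow_one, mul_assoc, PowerSeries.coeff_C_mul]
    cases n with
    | zero => simp
    | succ n =>
      rw [PowerSeries.coeff_succ_X_mul, PowerSeries.coeff_mk, PowerSeries.coeff_mk,
        Nat.factorial_succ]
      have : ((n : ℂ_[p]) + 1) ≠ 0 := by exact_mod_cast n.succ_ne_zero
      have h' : (n.factorial : ℂ_[p]) ≠ 0 := by exact_mod_cast n.factorial_ne_zero
      push_cast
      field_simp
      ring
  have hpos : ∀ i ∈ Finset.Icc 1 G.natDegree, i ≠ 0 := fun i hi => by
    rw [Finset.mem_Icc] at hi; omega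
  refine ⟨∏ i ∈ Finset.Icc 1 G.natDegree,
    e.subst (PowerSeries.C (G.coeff i) * PowerSeries.X ^ i : ℂ_[p]⟦X⟧), ?_, ?_, ?_⟩
  · have hc : ∀ i ∈ Finset.Icc 1 G.natDegree, PowerSeries.constantCoeff
        (e.subst (PowerSeries.C (G.coeff i) * PowerSeries.X ^ i : ℂ_[p]⟦X⟧) : ℂ_[p]⟦X⟧) = 1 := by
      intro i hi
      rw [← PowerSeries.coeff_zero_eq_constantCoeff_apply, coeff_subst_monomial _ _ (hpos i hi)]
      simp [-PowerSeries.coeff_zero_eq_constantCoeff, e]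
    rw [PowerSeries.coeff_zero_eq_constantCoeff_apply, map_prod]
    exact Finset.prod_eq_one hc
  · intro k
    have := norm_coeff_prod_le (Finset.Icc 1 G.natDegree) (fun i => (e.subst
      (PowerSeries.C (G.coeff i) * PowerSeries.X ^ i : ℂ_[p]⟦X⟧) : ℂ_[p]⟦X⟧)) zero_le_one
      (N := k + 1) (fun i hi n _ => ?_) k (Nat.lt_succ_self k)
    · rwa [one_pow] at this
    · rw [one_pow, coeff_subst_monomial _ _ (hpos i hi)]
      split_ifs
      · rw [PowerSeries.coeff_mk, norm_mul, norm_pow, norm_div, norm_pow]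
        refine mul_le_one₀ ?_ (by positivity) (pow_le_one₀ (norm_nonneg _) (hG.norm_coeff_le i))
        exact div_le_one_of_le₀ (norm_pi_pow_le_factorial hπ _) (norm_nonneg _)
      · simp
  · rw [eul_prod_of_eq _ _ _ fun i hi => eul_subst_monomial _ (hpos i hi) he]
    congr 1
    rw [coe_eq_sum_of_coeff_zero hG.coeff_zero, map_sum, Finset.mul_sum]
    refine Finset.sum_congr rfl fun i hi => ?_
    rw [subst_monomial_monomial _ _ (hpos i hi), mul_one, pow_one]
    ext n
    rw [← map_natCast (PowerSeries.C (R := ℂ_[p])), PowerSeries.coeff_C_mul,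
      PowerSeries.coeff_C_mul_X_pow, PowerSeries.coeff_C_mul, coeff_eul,
      PowerSeries.coeff_C_mul_X_pow]
    split_ifs with h
    · rw [h]; ring
    · simp

theorem hasSum_shift {f : ℕ → ℂ_[p]} {a : ℂ_[p]} (i : ℕ) (h : HasSum f a) :
    HasSum (fun k => if i ≤ k then f (k - i) else 0) a := by
  rw [← (add_left_injective i).hasSum_iff]
  · have e : (fun k => if i ≤ k then f (k - i) else 0) ∘ (fun x => x + i) = f := by
      funext j
      simp
    rwa [e]
  · intro k hk
    rw [if_neg]
    intro hik
    exact hk ⟨k - i, Nat.sub_add_cancel hik⟩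

/-- If `E` and `w` satisfy adjoint recurrences, their pairing vanishes. -/
theorem tsum_pairing_eq_zero {E w b : ℕ → ℂ_[p]} {N : ℕ}
    (hsum : ∀ n, Summable fun k => E k * w (n + k))
    (hE : ∀ k : ℕ, (k : ℂ_[p]) * E k =
      ∑ i ∈ Finset.range N, if i ≤ k then b i * E (k - i) else 0)
    (hw : ∀ n : ℕ, 1 ≤ n → (n : ℂ_[p]) * w n = ∑ i ∈ Finset.range N, b i * w (n + i))
    {n : ℕ} (hn : 1 ≤ n) : ∑' k, E k * w (n + k) = 0 := by
  have s1 := (hsum n).hasSum.mul_left (n : ℂ_[p])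
  have s2 : ∀ i, HasSum (fun k => b i * (E k * w (n + i + k)))
      (b i * ∑' k, E k * w (n + i + k)) := fun i => (hsum (n + i)).hasSum.mul_left _
  have s4 : HasSum _ _ := (hasSum_sum (s := Finset.range N) fun i _ => s2 i).sub
    (hasSum_sum (s := Finset.range N) fun i _ => hasSum_shift i (s2 i))
  rw [sub_self] at s4
  -- Write `n = (n + k) - k`. The recurrences of `w` and `E` turn the two parts into sums that agree
  -- after shifting `k` by `i`.
  have e : (fun k => (n : ℂ_[p]) * (E k * w (n + k))) = fun k =>
      (∑ i ∈ Finset.range N, b i * (E k * w (n + i + k))) -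
      ∑ i ∈ Finset.range N, (if i ≤ k then b i * (E (k - i) * w (n + i + (k - i))) else 0) := by
    funext k
    have h1 : ∑ i ∈ Finset.range N, b i * (E k * w (n + i + k)) =
        E k * (((n + k : ℕ) : ℂ_[p]) * w (n + k)) := by
      rw [hw (n + k) (by omega), Finset.mul_sum]
      refine Finset.sum_congr rfl fun i _ => ?_
      rw [show n + i + k = n + k + i by omega]; ring
    have h2 : ∑ i ∈ Finset.range N, (if i ≤ k then b i * (E (k - i) * w (n + i + (k - i))) else 0) =
        ((k : ℂ_[p]) * E k) * w (n + k) := by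
      rw [hE, Finset.sum_mul]
      refine Finset.sum_congr rfl fun i _ => ?_
      split_ifs with hi
      · rw [show n + i + (k - i) = n + k by omega]; ring
      · rw [zero_mul]
    rw [h1, h2]; push_cast; ring
  rw [e] at s1
  exact (mul_eq_zero.1 (s1.unique s4)).resolve_left (Nat.cast_ne_zero.2 (by omega))

/-- Here `w n` is meant as the coefficient of `X^(-n)` in `u`, where `D u` has no negative part.
Multiplication by `E = exp(πG)` turns `D` into `X d/dX`, so the negative coefficients `∑ E_k
w_{n+k}` of `E u` vanish. As `E` is integral with constant term 1, each `w n` is bounded by the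
later ones, which tend to 0. -/
theorem eq_zero_of_recurrence (hπ : π ^ (p - 1) = -(p : ℂ_[p])) {d : ℕ} {G : Polynomial ℂ_[p]}
    (hG : Admissible d G) {w : ℕ → ℂ_[p]} {C ρ : ℝ} (hρ0 : 0 ≤ ρ) (hρ1 : ρ < 1)
    (hw : ∀ n, ‖w n‖ ≤ C * ρ ^ n)
    (hrec : ∀ n : ℕ, 1 ≤ n → (n : ℂ_[p]) * w n =
      π * ∑ i ∈ Finset.range (d + 1), (i : ℂ_[p]) * G.coeff i * w (n + i)) :
    ∀ n : ℕ, 1 ≤ n → w n = 0 := by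
  obtain ⟨E, hE0, hE1, hE⟩ := exists_exp hπ hG
  have hC : 0 ≤ C := by simpa using (norm_nonneg _).trans (hw 0)
  have hgeo : Summable fun n : ℕ => C * ρ ^ n :=
    (summable_geometric_of_lt_one hρ0 hρ1).mul_left C
  have hsum : ∀ (x : ℕ → ℂ_[p]) (n : ℕ), (∀ k, ‖x k‖ ≤ 1) → Summable fun k => x k * w (n + k) := by
    intro x n hx
    refine Summable.of_norm_bounded hgeo fun k => ?_
    rw [norm_mul]
    refine (mul_le_of_le_one_left (norm_nonneg _) (hx k)).trans ((hw _).trans ?_)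
    exact mul_le_mul_of_nonneg_left (pow_le_pow_of_le_one hρ0 hρ1.le (by omega)) hC
  have hEk : ∀ k : ℕ, (k : ℂ_[p]) * PowerSeries.coeff k E = ∑ i ∈ Finset.range (d + 1),
      if i ≤ k then π * (i * G.coeff i) * PowerSeries.coeff (k - i) E else 0 := by
    intro k
    have h := congrArg (PowerSeries.coeff k) hE
    rw [coeff_eul, PowerSeries.coeff_mul] at h
    simp only [PowerSeries.coeff_C_mul, coeff_eul, Polynomial.coeff_coe] at h
    rw [h, sum_antidiagonal_eq_sum_range, hG.natDegree_eq, Finset.mul_sum]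
    refine Finset.sum_congr rfl fun i _ => ?_
    split_ifs with hi
    · rw [← Nat.cast_sub hi, toLaurent_natCast]; ring
    · rw [toLaurent_of_neg _ (by omega)]; simp
  have hS : ∀ n : ℕ, 1 ≤ n → ∑' k, PowerSeries.coeff k E * w (n + k) = 0 := fun n hn =>
    tsum_pairing_eq_zero (E := fun k => PowerSeries.coeff k E) (fun n => hsum _ n hE1) hEk
      (fun n hn => by
        rw [hrec n hn, Finset.mul_sum]
        exact Finset.sum_congr rfl fun i _ => by ring) hn
  -- `t` counts the uses of `w_n = -∑_{k≥1} E_k w_{n+k}`; each gains one power of `ρ`.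
  have hstep : ∀ t m n, 1 ≤ n → m ≤ n + t → ‖w n‖ ≤ C * ρ ^ m := by
    intro t
    induction t with
    | zero =>
      intro m n _ hm
      exact (hw n).trans (mul_le_mul_of_nonneg_left (pow_le_pow_of_le_one hρ0 hρ1.le hm) hC)
    | succ t ih =>
      intro m n hn hm
      have h := hS n hn
      rw [(hsum _ n hE1).tsum_eq_zero_add, hE0, one_mul, add_zero] at h
      rw [eq_neg_of_add_eq_zero_left h, norm_neg]
      refine IsUltrametricDist.norm_tsum_le_of_forall_le_of_nonneg (by positivity) fun k => ?_
      rw [norm_mul]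
      exact (mul_le_of_le_one_left (norm_nonneg _) (hE1 _)).trans (ih m _ (by omega) (by omega))
  intro n hn
  rw [← norm_le_zero_iff]
  have hlim : Filter.Tendsto (fun m : ℕ => C * ρ ^ m) Filter.atTop (nhds (C * 0)) :=
    (tendsto_pow_atTop_nhds_zero_of_lt_one hρ0 hρ1).const_mul C
  rw [mul_zero] at hlim
  exact ge_of_tendsto' hlim fun m => hstep m m n hn (by omega)

/-- An overconvergent solution of `D u = c`, with `c` a power series, is a power series. -/
theorem exists_toLaurent_of_D_eq (hπ : π ^ (p - 1) = -(p : ℂ_[p])) {d : ℕ} {G : Polynomial ℂ_[p]}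
    (hG : Admissible d G) {u : ℤ → ℂ_[p]} (hu : Overconvergent u) {c : ℂ_[p]⟦X⟧}
    (h : D π G u = toLaurent c) : ∃ U : ℂ_[p]⟦X⟧, u = toLaurent U ∧ Dps π G U = c ∧
      ∃ t C : ℝ, 0 < t ∧ t < 1 ∧ ∀ k, ‖PowerSeries.coeff k U‖ ≤ C * t ^ k := by
  obtain ⟨r, hr, C, hC⟩ := hu
  have hr0 : 0 < r := zero_lt_one.trans hr
  have hbound : ∀ n : ℤ, ‖u n‖ ≤ C * r⁻¹ ^ n.natAbs := by
    intro n
    rw [inv_pow, ← div_eq_mul_inv, le_div_iff₀ (pow_pos hr0 _)]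
    exact hC n
  have hneg := eq_zero_of_recurrence hπ hG (w := fun k => u (-(k : ℤ))) (inv_nonneg.2 hr0.le)
    (inv_lt_one_of_one_lt₀ hr) (fun n => by simpa using hbound (-(n : ℤ))) (fun n hn => by
      have h1 := congrFun h (-(n : ℤ))
      rw [toLaurent_of_neg _ (by omega), D, hG.natDegree_eq] at h1
      push_cast at h1
      have e : ∀ i : ℕ, -(n : ℤ) - i = -((n + i : ℕ) : ℤ) := fun i => by push_cast; ring
      simp only [e] at h1
      linear_combination -h1)
  have hU : u = toLaurent (PowerSeries.mk fun k : ℕ => u k) := by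
    funext n
    rcases lt_or_ge n 0 with hn | hn
    · rw [toLaurent_of_neg _ hn]
      have := hneg n.natAbs (by omega)
      rwa [show -((n.natAbs : ℕ) : ℤ) = n by omega] at this
    · lift n to ℕ using hn
      rw [toLaurent_natCast, PowerSeries.coeff_mk]
  refine ⟨_, hU, ?_, r⁻¹, C, inv_pos.2 hr0, inv_lt_one_of_one_lt₀ hr, fun k => ?_⟩
  · rw [hU, D_toLaurent] at h
    exact toLaurent_injective h
  · rw [PowerSeries.coeff_mk]
    simpa using hbound k

end NegativePart

/-! ### Combinatorics of the exponents and of the minimal weight -/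

section PermutationWeights

variable {p d : ℕ}

theorem mod_pos_of_lt (hpp : p.Prime) (hp : 3 * d ≤ p) {i : ℕ} (hi0 : 0 < i) (hid : i < d) :
    0 < p * i % d := by
  rw [Nat.pos_iff_ne_zero]
  intro h
  have hdvd : d ∣ p * i := Nat.dvd_of_mod_eq_zero h
  have hcop : Nat.Coprime d p :=
    ((Nat.Prime.coprime_iff_not_dvd hpp).2 fun h => by
      have := Nat.le_of_dvd (by omega) h
      omega).symm
  have := Nat.le_of_dvd hi0 (hcop.dvd_of_dvd_mul_left hdvd)
  omega

theorem mod_injOn (hpp : p.Prime) (hp : 3 * d ≤ p) {i j : ℕ} (hid : i < d) (hjd : j < d)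
    (h : p * i % d = p * j % d) : i = j := by
  have hcop : Nat.Coprime d p :=
    ((Nat.Prime.coprime_iff_not_dvd hpp).2 fun h => by
      have := Nat.le_of_dvd (by omega) h
      omega).symm
  have h1 : i ≡ j [MOD d] := Nat.ModEq.cancel_left_of_coprime hcop h
  exact Nat.ModEq.eq_of_lt_of_lt h1 hid hjd

theorem jres_eq {i : ℕ} (h : 0 < p * i % d) : jres p d i = p * i % d := by
  refine le_antisymm (Nat.sInf_le ⟨h, Nat.mod_modEq _ _⟩) ?_
  refine le_csInf ⟨_, h, Nat.mod_modEq _ _⟩ ?_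
  rintro j ⟨_, hj⟩
  have h1 : j % d = p * i % d := hj
  rw [← h1]
  exact Nat.mod_le _ _

theorem ceil_div_eq {i : ℕ} (h : 0 < p * i % d) (hd : 0 < d) :
    ⌈((p : ℚ) * i) / d⌉₊ = p * i / d + 1 := by
  have hdq : (0 : ℚ) < d := by exact_mod_cast hd
  have e : ((p : ℚ) * i) = d * ((p * i / d : ℕ) : ℚ) + ((p * i % d : ℕ) : ℚ) := by
    exact_mod_cast (Nat.div_add_mod (p * i) d).symm
  have h1 : (0 : ℚ) < ((p * i % d : ℕ) : ℚ) := by exact_mod_cast h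
  have h2 : ((p * i % d : ℕ) : ℚ) < d := by exact_mod_cast Nat.mod_lt _ hd
  rw [Nat.ceil_eq_iff (show p * i / d + 1 ≠ 0 from Nat.succ_ne_zero _), e, Nat.add_sub_cancel, lt_div_iff₀ hdq, div_le_iff₀ hdq]
  push_cast
  constructor <;> nlinarith

/-- Write `p i = d q + r` with `0 ≤ r < d`: the quotient `(p i - j)/d` lies in `(q-1, q]` when `r ≤
j` and in `(q, q+1]` otherwise. The bound `d ≤ p i` makes `q ≥ 1`. -/
theorem expo_eq {i j : ℕ} (hj0 : 0 < j) (hjd : j < d) (hdi : d ≤ p * i) :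
    expo p d i j = if p * i % d ≤ j then p * i / d else p * i / d + 1 := by
  have hd : 0 < d := by omega
  have hdq : (0 : ℚ) < d := by exact_mod_cast hd
  have e : ((p : ℚ) * i) = d * ((p * i / d : ℕ) : ℚ) + ((p * i % d : ℕ) : ℚ) := by
    exact_mod_cast (Nat.div_add_mod (p * i) d).symm
  have h1 : (0 : ℚ) ≤ ((p * i % d : ℕ) : ℚ) := by positivity
  have h2 : ((p * i % d : ℕ) : ℚ) < d := by exact_mod_cast Nat.mod_lt _ hd
  have h3 : (j : ℚ) < d := by exact_mod_cast hjd
  have h0 : (0 : ℚ) < j := by exact_mod_cast hj0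
  have hq : 1 ≤ p * i / d := (Nat.one_le_div_iff hd).2 hdi
  rw [expo]
  split_ifs with h
  · have h4 : ((p * i % d : ℕ) : ℚ) ≤ j := by exact_mod_cast h
    rw [Nat.ceil_eq_iff (by omega), e, lt_div_iff₀ hdq, div_le_iff₀ hdq, Nat.cast_sub hq]
    push_cast at h2 h4 ⊢
    constructor <;> nlinarith
  · have h4 : (j : ℚ) < ((p * i % d : ℕ) : ℚ) := by exact_mod_cast not_le.1 h
    rw [Nat.ceil_eq_iff (by omega), e, lt_div_iff₀ hdq, div_le_iff₀ hdq, Nat.add_sub_cancel]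
    push_cast at h2 h4 ⊢
    constructor <;> nlinarith

theorem le_prime_mul (hp : 3 * d ≤ p) {i : ℕ} (hi0 : 0 < i) : d ≤ p * i :=
  (by omega : d ≤ p).trans (Nat.le_mul_of_pos_right _ hi0)

theorem expo_add_eq (hp : 3 * d ≤ p) {i j : ℕ} (hi0 : 0 < i) (hj0 : 0 < j) (hjd : j < d) :
    expo p d i j + (if p * i % d ≤ j then 1 else 0) = p * i / d + 1 := by
  rw [expo_eq hj0 hjd (le_prime_mul hp hi0)]
  split_ifs <;> rfl

theorem sum_expo_add_card (hp : 3 * d ≤ p) {n : ℕ} (f h : Fin n → Fin (d - 1)) :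
    ∑ k, expo p d (f k + 1) (h k + 1) +
      (Finset.univ.filter fun k => p * (f k + 1) % d ≤ (h k : ℕ) + 1).card =
      ∑ k, (p * (f k + 1) / d + 1) := by
  rw [Finset.card_filter, ← Finset.sum_add_distrib]
  refine Finset.sum_congr rfl fun k _ => ?_
  exact expo_add_eq hp (Nat.succ_pos _) (Nat.succ_pos _) (by have := (h k).2; omega)

/-- Minimising the weight therefore means maximising the number of `k` with `p k mod d ≤ σ(k)`. -/
theorem weight_add_card (hp : 3 * d ≤ p) {n : ℕ} (hn : n ≤ d - 1) (σ : Equiv.Perm (Fin n)) :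
    weight p d n σ + (Finset.univ.filter fun k : Fin n => p * (k + 1) % d ≤ (σ k : ℕ) + 1).card =
      ∑ k : Fin n, (p * (k + 1) / d + 1) :=
  sum_expo_add_card hp (Fin.castLE hn) fun k => Fin.castLE hn (σ k)

/-- As `p` is prime to `d`, the map `k ↦ p k mod d` is injective on `{1, …, d-1}`, so its part with
values at most `n` extends to a permutation. The result is a permutation of minimal weight. -/
theorem exists_perm_eq_mod (hpp : p.Prime) (hp : 3 * d ≤ p) {n : ℕ} (hn : n ≤ d - 1) :
    ∃ σ : Equiv.Perm (Fin n), ∀ k : Fin n, p * (k + 1) % d ≤ n →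
      (σ k : ℕ) + 1 = p * (k + 1) % d := by
  classical
  have hpos : ∀ k : Fin n, 0 < p * (k + 1) % d := fun k =>
    mod_pos_of_lt hpp hp (Nat.succ_pos _) (by have := k.2; omega)
  let f : Fin n → Fin n := fun k =>
    if h : p * (k + 1) % d - 1 < n then ⟨p * (k + 1) % d - 1, h⟩ else k
  have hf : ∀ k : Fin n, p * (k + 1) % d ≤ n → (f k : ℕ) = p * (k + 1) % d - 1 := by
    intro k hk
    have hlt : p * (k + 1) % d - 1 < n := by have := hpos k; omega
    simp only [f, dif_pos hlt]
  obtain ⟨g, hg⟩ := Finset.exists_equiv_extend_of_card_eq (α := Fin n) (β := Fin n)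
    (t := Finset.univ) (by simp) (s := Finset.univ.filter fun k : Fin n => p * (k + 1) % d ≤ n)
    (f := f) (Finset.subset_univ _) (by
      intro a ha b hb hab
      rw [Finset.mem_coe, Finset.mem_filter] at ha hb
      have h1 := hf a ha.2
      rw [hab, hf b hb.2] at h1
      have ha' := hpos a
      have hb' := hpos b
      have := mod_injOn hpp hp (i := a + 1) (j := b + 1) (by have := a.2; omega)
        (by have := b.2; omega) (by omega)
      exact Fin.ext (by omega))
  refine ⟨g.trans (Equiv.subtypeUnivEquiv fun x => Finset.mem_univ x), fun k hk => ?_⟩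
  have h1 := hg k (Finset.mem_filter.2 ⟨Finset.mem_univ _, hk⟩)
  have h2 := hf k hk
  have h3 := hpos k
  change ((g k : Fin n) : ℕ) + 1 = _
  rw [h1]
  omega

theorem filter_subset_filter_le {n : ℕ} (σ : Equiv.Perm (Fin n)) :
    (Finset.univ.filter fun k : Fin n => p * (k + 1) % d ≤ (σ k : ℕ) + 1) ⊆
      Finset.univ.filter fun k : Fin n => p * (k + 1) % d ≤ n :=
  Finset.monotone_filter_right _ fun k _ hk => hk.trans (σ k).2

theorem Y_add_card (hpp : p.Prime) (hp : 3 * d ≤ p) {n : ℕ} (hn : n ≤ d - 1) :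
    Y p d n + (Finset.univ.filter fun k : Fin n => p * (k + 1) % d ≤ n).card =
      ∑ k : Fin n, (p * (k + 1) / d + 1) := by
  refine le_antisymm ?_ ?_
  · obtain ⟨σ, hσ⟩ := exists_perm_eq_mod hpp hp hn
    rw [← weight_add_card hp hn σ]
    refine add_le_add (Finset.inf'_le _ (Finset.mem_univ σ)) (Finset.card_le_card ?_)
    exact Finset.monotone_filter_right _ fun k _ hk => (hσ k hk).ge
  · obtain ⟨σ, -, hσ⟩ := Finset.exists_mem_eq_inf' (Finset.univ_nonempty) (weight p d n)
    rw [Y, hσ, ← weight_add_card hp hn σ]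
    exact Nat.add_le_add_left (Finset.card_le_card (filter_subset_filter_le σ)) _

theorem mem_extremal_iff (hpp : p.Prime) (hp : 3 * d ≤ p) {n : ℕ} (hn : n ≤ d - 1)
    (σ : Equiv.Perm (Fin n)) : σ ∈ extremal p d n ↔
      ∀ k : Fin n, p * (k + 1) % d ≤ n → p * (k + 1) % d ≤ (σ k : ℕ) + 1 := by
  rw [extremal, Finset.mem_filter]
  have h1 := weight_add_card hp hn σ
  have h2 := Y_add_card hpp hp hn
  have hsub := filter_subset_filter_le (p := p) (d := d) σ
  constructor
  · rintro ⟨-, h⟩ k hk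
    have hcard : (Finset.univ.filter fun k : Fin n => p * (k + 1) % d ≤ n).card ≤
      (Finset.univ.filter fun k : Fin n => p * (k + 1) % d ≤ (σ k : ℕ) + 1).card := by omega
    have heq := Finset.eq_of_subset_of_card_le hsub hcard
    have hmem : k ∈ Finset.univ.filter fun k : Fin n => p * (k + 1) % d ≤ n :=
      Finset.mem_filter.2 ⟨Finset.mem_univ _, hk⟩
    rw [← heq] at hmem
    exact (Finset.mem_filter.1 hmem).2
  · intro h
    refine ⟨Finset.mem_univ _, ?_⟩
    have heq : (Finset.univ.filter fun k : Fin n => p * (k + 1) % d ≤ (σ k : ℕ) + 1) =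
        Finset.univ.filter fun k : Fin n => p * (k + 1) % d ≤ n :=
      Finset.Subset.antisymm hsub (Finset.monotone_filter_right _ fun k _ hk => h k hk)
    rw [heq] at h1
    omega

theorem prod_Icc_one_eq_prod_fin (n : ℕ) (f : ℕ → ℕ) :
    ∏ i ∈ Finset.Icc 1 n, f i = ∏ k : Fin n, f (k + 1) := by
  rw [← Finset.prod_range (fun k => f (k + 1)), Finset.range_eq_Ico, Finset.prod_Ico_add' f 0 n 1]
  rfl

/-- On extremal permutations the exponent at `k` does not depend on `σ`: it is `⌊pk/d⌋` if `p k mod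
d ≤ n`, and `⌊pk/d⌋ + 1` otherwise because `σ(k) ≤ n`. The factorials thus form a common
denominator. -/
theorem prod_factorial_eq_denom (hpp : p.Prime) (hp : 3 * d ≤ p) {n : ℕ} (hn : n ≤ d - 1)
    {σ : Equiv.Perm (Fin n)} (hσ : σ ∈ extremal p d n) :
    ∏ k : Fin n, (expo p d (k + 1) (σ k + 1)).factorial = denom p d n := by
  have hden : denom p d n = ∏ i ∈ Finset.Icc 1 n, if jres p d i ≤ n then
      (⌈((p : ℚ) * i) / d⌉₊ - 1).factorial else (⌈((p : ℚ) * i) / d⌉₊).factorial := by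
    rw [Finset.prod_ite, denom, mul_comm, B, Finset.filter_not]
  rw [hden, prod_Icc_one_eq_prod_fin n fun i => if jres p d i ≤ n then
      (⌈((p : ℚ) * i) / d⌉₊ - 1).factorial else (⌈((p : ℚ) * i) / d⌉₊).factorial]
  refine Finset.prod_congr rfl fun k _ => ?_
  have hk := k.2
  have hk' := (σ k).2
  have hpos := mod_pos_of_lt hpp hp (i := k + 1) (Nat.succ_pos k) (by omega)
  rw [jres_eq hpos, ceil_div_eq hpos (by omega), Nat.add_sub_cancel,
    expo_eq (i := k + 1) (Nat.succ_pos _) (by omega) (le_prime_mul hp (Nat.succ_pos _))]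
  by_cases h : p * (k + 1) % d ≤ n
  · rw [if_pos h, if_pos ((mem_extremal_iff hpp hp hn σ).1 hσ k h)]
  · rw [if_neg h, if_neg (by omega)]

/-- An exchange argument: since `p ≥ 3d`, the summand grows by at least 3 at each step, and the
values of `f` that are at least `n` are as many as the values below `n` that `f` misses. -/
theorem sum_div_add_le_sum (hp : 3 * d ≤ p) (hd : 0 < d) {n : ℕ} {f : Fin n → Fin (d - 1)}
    (hf : Function.Injective f) :
    ∑ k : Fin n, (p * (k + 1) / d + 1) + 3 * (Finset.univ.filter fun k => n ≤ (f k : ℕ)).card ≤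
      ∑ k, (p * (f k + 1) / d + 1) := by
  classical
  let c : ℕ → ℕ := fun i => p * (i + 1) / d + 1
  have hstep : ∀ a b, a < b → c a + 3 ≤ c b := by
    intro a b hab
    have h1 : p * (a + 1) + d * 3 ≤ p * (b + 1) := by
      have : p * (a + 1 + 1) ≤ p * (b + 1) := Nat.mul_le_mul_left _ (by omega)
      rw [mul_add p (a + 1), mul_one] at this
      omega
    have h2 := Nat.div_le_div_right (c := d) h1
    rw [Nat.add_mul_div_left _ _ hd] at h2
    simp only [c]
    omega
  have hmono : ∀ a b, a ≤ b → c a ≤ c b := by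
    intro a b hab
    rcases hab.lt_or_eq with h | rfl
    · have := hstep a b h; omega
    · rfl
  let S : Finset ℕ := Finset.univ.image fun k => (f k : ℕ)
  have hinj : Function.Injective fun k => (f k : ℕ) := fun a b h => hf (Fin.ext h)
  have hScard : S.card = n := by rw [Finset.card_image_of_injective _ hinj]; simp
  have hsumS : ∑ k, c (f k) = ∑ i ∈ S, c i := (Finset.sum_image hinj.injOn).symm
  have hsumR : ∑ k : Fin n, c k = ∑ i ∈ Finset.range n, c i := (Finset.sum_range c).symm
  have hΔ : (Finset.univ.filter fun k => n ≤ (f k : ℕ)).card = (S \ Finset.range n).card := by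
    rw [← Finset.card_image_of_injective _ hinj]
    congr 1
    ext i
    simp only [Finset.mem_image, Finset.mem_filter, Finset.mem_univ, true_and, Finset.mem_sdiff,
      Finset.mem_range, not_lt, S]
    constructor
    · rintro ⟨k, hk, rfl⟩; exact ⟨⟨k, rfl⟩, hk⟩
    · rintro ⟨⟨k, rfl⟩, hk⟩; exact ⟨k, hk, rfl⟩
  have hcard : (Finset.range n \ S).card = (S \ Finset.range n).card :=
    Finset.card_sdiff_comm (by rw [hScard, Finset.card_range])
  change ∑ k : Fin n, c k + _ ≤ ∑ k, c (f k)
  rw [hsumS, hsumR, hΔ, ← Finset.sum_inter_add_sum_sdiff (Finset.range n) S,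
    ← Finset.sum_inter_add_sum_sdiff S (Finset.range n), Finset.inter_comm S]
  have h1 : ∑ i ∈ Finset.range n \ S, c i ≤ (S \ Finset.range n).card * c (n - 1) := by
    rw [← hcard, ← smul_eq_mul]
    refine Finset.sum_le_card_nsmul _ _ _ fun i hi => hmono _ _ ?_
    rw [Finset.mem_sdiff, Finset.mem_range] at hi
    omega
  have h2 : (S \ Finset.range n).card * (c (n - 1) + 3) ≤ ∑ i ∈ S \ Finset.range n, c i := by
    rcases Nat.eq_zero_or_pos n with rfl | hn
    · rw [Finset.card_eq_zero] at hScard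
      simp [hScard]
    rw [← smul_eq_mul]
    refine Finset.card_nsmul_le_sum _ _ _ fun i hi => hstep _ _ ?_
    rw [Finset.mem_sdiff, Finset.mem_range] at hi
    omega
  rw [mul_add] at h2
  omega

/-- The weight of a pair of injections exceeds the minimal weight `Y`, according to how many values
lie outside of `{1, …, n}`. -/
theorem Y_add_le_sum_expo (hpp : p.Prime) (hp : 3 * d ≤ p) (hd : 0 < d) {n : ℕ} (hn : n ≤ d - 1)
    {f h : Fin n → Fin (d - 1)} (hf : Function.Injective f) :
    Y p d n + 2 * (Finset.univ.filter fun k => n ≤ (f k : ℕ)).card ≤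
      ∑ k, expo p d (f k + 1) (h k + 1) + (Finset.univ.filter fun k => n ≤ (h k : ℕ)).card := by
  classical
  have h1 := sum_expo_add_card hp f h
  have h2 := Y_add_card hpp hp hn
  have h3 := sum_div_add_le_sum hp hd hf
  -- If `f k` and `h k` are both below `n`, the pair is already counted in the optimum; otherwise it
  -- is charged to the excess of `f` or of `h`. Of the gain of 3 per excess value of `f`, 2 remain.
  have h4 : (Finset.univ.filter fun k => p * (f k + 1) % d ≤ (h k : ℕ) + 1).card ≤
      (Finset.univ.filter fun k : Fin n => p * (k + 1) % d ≤ n).card +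
      (Finset.univ.filter fun k => n ≤ (f k : ℕ)).card +
      (Finset.univ.filter fun k => n ≤ (h k : ℕ)).card := by
    have hsub : (Finset.univ.filter fun k => p * (f k + 1) % d ≤ (h k : ℕ) + 1) ⊆
        (Finset.univ.filter fun k => (f k : ℕ) < n ∧ p * (f k + 1) % d ≤ n) ∪
        (Finset.univ.filter fun k => n ≤ (f k : ℕ)) ∪
        (Finset.univ.filter fun k => n ≤ (h k : ℕ)) := by
      intro k hk
      simp only [Finset.mem_union, Finset.mem_filter, Finset.mem_univ, true_and] at hk ⊢
      omega
    refine (Finset.card_le_card hsub).trans ((Finset.card_union_le _ _).trans ?_)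
    refine Nat.add_le_add_right ((Finset.card_union_le _ _).trans (Nat.add_le_add_right ?_ _)) _
    refine Finset.card_le_card_of_injOn
      (fun k => if hk : (f k : ℕ) < n then ⟨f k, hk⟩ else k) ?_ ?_
    · intro k hk
      simp only [Finset.coe_filter, Finset.mem_univ, true_and, Set.mem_ofPred_eq] at hk ⊢
      rw [dif_pos hk.1]
      exact hk.2
    · intro a ha b hb hab
      simp only [Finset.coe_filter, Finset.mem_univ, true_and, Set.mem_ofPred_eq] at ha hb
      simp only [dif_pos ha.1, dif_pos hb.1, Fin.mk.injEq] at hab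
      exact hf (Fin.ext hab)
  omega

/-- For `n = d - 1` every remainder is at most `n`, so extremality means `τ ≤ σ` pointwise. The
values of two permutations have the same sum, which forces equality. -/
theorem extremal_top_eq (hpp : p.Prime) (hp : 3 * d ≤ p) (hd : 0 < d)
    {σ τ : Equiv.Perm (Fin (d - 1))} (hσ : σ ∈ extremal p d (d - 1))
    (hτ : ∀ k : Fin (d - 1), (τ k : ℕ) + 1 = p * (k + 1) % d) : σ = τ := by
  have hle : ∀ k : Fin (d - 1), (τ k : ℕ) ≤ σ k := by
    intro k
    have hlt := Nat.mod_lt (p * (k + 1)) hd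
    have := (mem_extremal_iff hpp hp le_rfl σ).1 hσ k (by omega)
    have := hτ k
    omega
  have hsum : ∑ k, ((τ k : Fin (d - 1)) : ℕ) = ∑ k, ((σ k : Fin (d - 1)) : ℕ) := by
    rw [Equiv.sum_comp τ fun k => (k : ℕ), Equiv.sum_comp σ fun k => (k : ℕ)]
  rw [Finset.sum_eq_sum_iff_of_le fun k _ => hle k] at hsum
  ext k
  exact (hsum k (Finset.mem_univ k)).symm

theorem exists_extremal_top (hpp : p.Prime) (hp : 3 * d ≤ p) (hd : 0 < d) :
    ∃ τ : Equiv.Perm (Fin (d - 1)), extremal p d (d - 1) = {τ} ∧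
      ∀ k : Fin (d - 1), (τ k : ℕ) + 1 = p * (k + 1) % d := by
  obtain ⟨τ, hτ⟩ := exists_perm_eq_mod hpp hp (le_refl (d - 1))
  have hτ' : ∀ k : Fin (d - 1), (τ k : ℕ) + 1 = p * (k + 1) % d := fun k =>
    hτ k (by have := Nat.mod_lt (p * (k + 1)) hd; omega)
  refine ⟨τ, Finset.eq_singleton_iff_unique_mem.2 ⟨?_, fun σ hσ =>
    extremal_top_eq hpp hp hd hσ hτ'⟩, hτ'⟩
  exact (mem_extremal_iff hpp hp le_rfl τ).2 fun k _ => (hτ' k).ge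

end PermutationWeights

/-! ### Ultrametric estimates for minors of products -/

section Minors

/-- Multilinearity of the determinant in the rows. This is a Cauchy–Binet expansion indexed by all
maps `h`, the non-injective ones contributing zero. -/
theorem det_submatrix_mul {R ι : Type*} [CommRing R] [Fintype ι] [DecidableEq ι] {n : ℕ}
    {κ κ' : Type*} (A : Matrix κ ι R) (B : Matrix ι κ' R) (f : Fin n → κ) (g : Fin n → κ') :
    ((A * B).submatrix f g).det =
      ∑ h : Fin n → ι, (∏ i, A (f i) (h i)) * (B.submatrix h g).det := by
  have e : (A * B).submatrix f g = fun i => ∑ j, A (f i) j • (B.submatrix id g) j := by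
    funext i k
    simp [Matrix.mul_apply]
  rw [e]
  change (Matrix.detRowAlternating (R := R) (n := Fin n)).toMultilinearMap _ = _
  rw [MultilinearMap.map_sum]
  refine Finset.sum_congr rfl fun h _ => ?_
  rw [MultilinearMap.map_smul_univ, smul_eq_mul]
  rfl

/-- The product `G_{k-1} ⋯ G_1 G_0`. -/
def seqProd {R : Type*} [CommRing R] {N : ℕ} (G : ℕ → Matrix (Fin N) (Fin N) R) :
    ℕ → Matrix (Fin N) (Fin N) R
  | 0 => 1
  | k + 1 => G k * seqProd G k

/-- The number of values of `f` that are at least `n`. -/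
def excess {N n : ℕ} (f : Fin n → Fin N) : ℕ := (Finset.univ.filter fun k => n ≤ (f k : ℕ)).card

theorem excess_comp_perm {N n : ℕ} (f : Fin n → Fin N) (σ : Equiv.Perm (Fin n)) :
    excess (f ∘ σ) = excess f := by
  refine Finset.card_bij (fun k _ => σ k) ?_ ?_ ?_
  · intro k hk
    simpa using hk
  · intro a _ b _ h; exact σ.injective h
  · intro k hk
    exact ⟨σ.symm k, by simpa using hk, by simp⟩

theorem excess_castLE {N n : ℕ} (hn : n ≤ N) : excess (Fin.castLE hn) = 0 := by
  rw [excess, Finset.card_eq_zero, Finset.filter_eq_empty_iff]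
  intro k _
  have := k.2
  simp only [Fin.val_castLE]
  omega

variable {R : Type*} [NormedField R] {N n : ℕ} {r : ℝ} {e : Fin N → Fin N → ℕ} {w : ℕ}

theorem norm_sign_mul {ι : Type*} [Fintype ι] [DecidableEq ι] (σ : Equiv.Perm ι) (x : R) :
    ‖((Equiv.Perm.sign σ : ℤ) : R) * x‖ = ‖x‖ := by
  rcases Int.units_eq_one_or (Equiv.Perm.sign σ) with h | h <;> simp [h]

theorem norm_prod_le_pow {A : Matrix (Fin N) (Fin N) R}
    (hA : ∀ i j, ‖A i j‖ ≤ r ^ e i j) (f h : Fin n → Fin N) :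
    ‖∏ i, A (f i) (h i)‖ ≤ r ^ ∑ i, e (f i) (h i) := by
  rw [norm_prod, ← Finset.prod_pow_eq_pow_sum]
  exact Finset.prod_le_prod (fun _ _ => norm_nonneg _) fun i _ => hA _ _

variable [IsUltrametricDist R]

/-- In `hw` a row index outside the first `n` gains 2 and a column index outside loses 1. In a
product the columns of one factor are the rows of the next, so each intermediate excursion nets a
gain of 1. -/
theorem norm_det_submatrix_le {A : Matrix (Fin N) (Fin N) R} (hr : 0 < r) (hr1 : r ≤ 1)
    (hA : ∀ i j, ‖A i j‖ ≤ r ^ e i j)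
    (hw : ∀ f h : Fin n → Fin N, Function.Injective f →
      w + 2 * excess f ≤ ∑ k, e (f k) (h k) + excess h)
    (f g : Fin n → Fin N) (hf : Function.Injective f) :
    ‖(A.submatrix f g).det‖ * r ^ excess g ≤ r ^ (w + 2 * excess f) := by
  rw [← le_div_iff₀ (pow_pos hr _), Matrix.det_apply']
  refine IsUltrametricDist.norm_sum_le_of_forall_le_of_nonneg (by positivity) fun σ _ => ?_
  rw [norm_sign_mul, le_div_iff₀ (pow_pos hr _)]
  have h1 := norm_prod_le_pow hA (f ∘ σ) g
  have h2 := hw (f ∘ σ) g (hf.comp σ.injective)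
  rw [excess_comp_perm] at h2
  refine (mul_le_mul_of_nonneg_right h1 (by positivity)).trans ?_
  rw [← pow_add]
  exact pow_le_pow_of_le_one hr.le hr1 h2

theorem norm_det_submatrix_seqProd_le {G : ℕ → Matrix (Fin N) (Fin N) R} (hr : 0 < r) (hr1 : r ≤ 1)
    (hG : ∀ k i j, ‖G k i j‖ ≤ r ^ e i j)
    (hw : ∀ f h : Fin n → Fin N, Function.Injective f →
      w + 2 * excess f ≤ ∑ k, e (f k) (h k) + excess h) (k : ℕ)
    (f g : Fin n → Fin N) (hf : Function.Injective f) :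
    ‖((seqProd G (k + 1)).submatrix f g).det‖ * r ^ excess g ≤
      r ^ ((k + 1) * w + 2 * excess f) := by
  induction k generalizing f with
  | zero =>
    rw [seqProd, seqProd, mul_one, zero_add, one_mul]
    exact norm_det_submatrix_le hr hr1 (hG 0) hw f g hf
  | succ k ih =>
    rw [seqProd, det_submatrix_mul, ← le_div_iff₀ (pow_pos hr _)]
    refine IsUltrametricDist.norm_sum_le_of_forall_le_of_nonneg (by positivity) fun h _ => ?_
    rw [le_div_iff₀ (pow_pos hr _)]
    by_cases hh : Function.Injective h
    · rw [norm_mul, mul_assoc]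
      refine (mul_le_mul (norm_prod_le_pow (hG _) f h) (ih h hh) (by positivity)
        (by positivity)).trans ?_
      rw [← pow_add]
      refine pow_le_pow_of_le_one hr.le hr1 ?_
      have := hw f h hf
      rw [add_mul (k + 1) 1 w]
      omega
    · rw [Function.not_injective_iff] at hh
      obtain ⟨a, b, hab, hne⟩ := hh
      rw [Matrix.det_zero_of_row_eq hne (by funext j; simp [hab]), mul_zero, norm_zero, zero_mul]
      positivity

/-- In the expansion of a minor of a product, the maps `h` with values in the first `n` indices give
the product of the leading minors; any other injective `h` has positive excess and gains a power of
`r`. -/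
theorem norm_det_submatrix_castLE_sub_le {G : ℕ → Matrix (Fin N) (Fin N) R} (hr : 0 < r)
    (hr1 : r ≤ 1) (hG : ∀ k i j, ‖G k i j‖ ≤ r ^ e i j)
    (hw : ∀ f h : Fin n → Fin N, Function.Injective f →
      w + 2 * excess f ≤ ∑ k, e (f k) (h k) + excess h) (hn : n ≤ N) (k : ℕ) :
    ‖((seqProd G k).submatrix (Fin.castLE hn) (Fin.castLE hn)).det -
      ∏ j ∈ Finset.range k, ((G j).submatrix (Fin.castLE hn) (Fin.castLE hn)).det‖ ≤
      r ^ (k * w + 1) := by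
  classical
  have hinj : Function.Injective (Fin.castLE hn) := Fin.castLE_injective hn
  have hzero := excess_castLE hn
  induction k with
  | zero =>
    rw [seqProd, Matrix.submatrix_one _ hinj, Matrix.det_one, Finset.prod_range_zero, sub_self,
      norm_zero]
    positivity
  | succ k ih =>
    set ι : Fin n → Fin N := Fin.castLE hn with hι
    set P := seqProd G k with hP
    have hdiff : ‖((G k * P).submatrix ι ι).det -
        ((G k).submatrix ι ι).det * (P.submatrix ι ι).det‖ ≤ r ^ ((k + 1) * w + 1) := by
      have h1 := det_submatrix_mul (G k) P ι ι
      have h2 := det_submatrix_mul ((G k).submatrix ι ι) (P.submatrix ι ι) id id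
      have hinj' : Function.Injective fun h : Fin n → Fin n => ι ∘ h := fun a b h => by
        funext i; exact hinj (congrFun h i)
      have h3 : ((G k).submatrix ι ι).det * (P.submatrix ι ι).det =
          ∑ h ∈ Finset.univ.image fun h : Fin n → Fin n => ι ∘ h,
            (∏ i, G k (ι i) (h i)) * (P.submatrix h ι).det := by
        rw [Finset.sum_image hinj'.injOn, ← Matrix.det_mul]
        exact h2
      rw [h1, h3, ← Finset.sum_sdiff_eq_sub (Finset.subset_univ _)]
      refine IsUltrametricDist.norm_sum_le_of_forall_le_of_nonneg (by positivity) fun h hh => ?_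
      have hex : ∃ i, n ≤ (h i : ℕ) := by
        by_contra hcon
        push Not at hcon
        refine (Finset.mem_sdiff.1 hh).2 (Finset.mem_image.2
          ⟨fun i => ⟨h i, hcon i⟩, Finset.mem_univ _, ?_⟩)
        funext i
        exact Fin.ext rfl
      obtain ⟨i, hi⟩ := hex
      have hpos : 1 ≤ excess h :=
        Finset.card_pos.2 ⟨i, Finset.mem_filter.2 ⟨Finset.mem_univ _, hi⟩⟩
      by_cases hhi : Function.Injective h
      -- The estimate for products needs at least one factor. Without any, `P = 1` and the row `h i
      -- ≥ n` vanishes on the first `n` columns.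
      · cases k with
        | zero =>
          have : ∀ j, (P.submatrix h ι) i j = 0 := by
            intro j
            rw [hP, seqProd, Matrix.submatrix_apply, Matrix.one_apply_ne]
            intro hij
            have h4 : (h i : ℕ) = j := by rw [hij]; rfl
            have := j.2
            omega
          rw [Matrix.det_eq_zero_of_row_eq_zero i this, mul_zero, norm_zero]
          positivity
        | succ k =>
          have h5 := norm_det_submatrix_seqProd_le hr hr1 hG hw k h ι hhi
          rw [hzero, pow_zero, mul_one] at h5
          rw [norm_mul]
          refine (mul_le_mul (norm_prod_le_pow (hG _) ι h) h5 (by positivity)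
            (by positivity)).trans ?_
          rw [← pow_add]
          refine pow_le_pow_of_le_one hr.le hr1 ?_
          have := hw ι h hinj
          rw [add_mul (k + 1) 1 w]
          omega
      · rw [Function.not_injective_iff] at hhi
        obtain ⟨a, b, hab, hne⟩ := hhi
        rw [Matrix.det_zero_of_row_eq hne (by funext j; simp [hab]), mul_zero, norm_zero]
        positivity
    have hGdet : ‖((G k).submatrix ι ι).det‖ ≤ r ^ w := by
      have := norm_det_submatrix_le hr hr1 (hG k) hw ι ι hinj
      rwa [hzero, pow_zero, mul_one, mul_zero, add_zero] at this
    rw [seqProd, Finset.prod_range_succ, ← hP]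
    rw [show ((G k * P).submatrix ι ι).det -
      (∏ j ∈ Finset.range k, ((G j).submatrix ι ι).det) * ((G k).submatrix ι ι).det =
      (((G k * P).submatrix ι ι).det - ((G k).submatrix ι ι).det * (P.submatrix ι ι).det) +
      ((G k).submatrix ι ι).det * ((P.submatrix ι ι).det -
        ∏ j ∈ Finset.range k, ((G j).submatrix ι ι).det) by ring]
    refine (IsUltrametricDist.norm_add_le_max _ _).trans (max_le hdiff ?_)
    rw [norm_mul, show (k + 1) * w + 1 = w + (k * w + 1) by ring, pow_add]
    exact mul_le_mul hGdet ih (norm_nonneg _) (by positivity)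

/-- A principal minor on another subset has the same positive excess in rows and columns, for a net
gain of at least 1. The condition `1 ≤ m` matters: all principal minors of the empty product are 1.
-/
theorem norm_minorSum_sub_le {G : ℕ → Matrix (Fin N) (Fin N) R} (hr : 0 < r)
    (hr1 : r ≤ 1) (hG : ∀ k i j, ‖G k i j‖ ≤ r ^ e i j)
    (hw : ∀ f h : Fin n → Fin N, Function.Injective f →
      w + 2 * excess f ≤ ∑ k, e (f k) (h k) + excess h) (hn : n ≤ N) {m : ℕ} (hm : 1 ≤ m) :
    ‖minorSum (seqProd G m) n -
      ∏ j ∈ Finset.range m, ((G j).submatrix (Fin.castLE hn) (Fin.castLE hn)).det‖ ≤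
      r ^ (m * w + 1) := by
  classical
  have hinj : Function.Injective (Fin.castLE hn) := Fin.castLE_injective hn
  set P := seqProd G m with hP
  set ι : Fin n → Fin N := Fin.castLE hn with hι
  let S₀ : Finset (Fin N) := Finset.univ.image ι
  have hS₀ : S₀ ∈ (Finset.univ : Finset (Fin N)).powersetCard n := by
    rw [Finset.mem_powersetCard]
    exact ⟨Finset.subset_univ _, by rw [Finset.card_image_of_injective _ hinj]; simp⟩
  have hdet₀ : (P.submatrix (Subtype.val : S₀ → Fin N) Subtype.val).det =
      (P.submatrix ι ι).det := by
    let ε : Fin n ≃ S₀ := Equiv.ofBijective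
      (fun i => ⟨ι i, Finset.mem_image_of_mem _ (Finset.mem_univ i)⟩)
      ⟨fun a b h => hinj (Subtype.ext_iff.1 h), fun ⟨x, hx⟩ => by
        obtain ⟨i, -, rfl⟩ := Finset.mem_image.1 hx
        exact ⟨i, rfl⟩⟩
    rw [← Matrix.det_submatrix_equiv_self ε]
    rfl
  have hdet := norm_det_submatrix_castLE_sub_le hr hr1 hG hw hn m
  rw [minorSum, ← Finset.add_sum_erase _ _ hS₀, hdet₀, add_sub_right_comm]
  refine (IsUltrametricDist.norm_add_le_max _ _).trans (max_le hdet ?_)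
  refine IsUltrametricDist.norm_sum_le_of_forall_le_of_nonneg (by positivity) fun S hS => ?_
  rw [Finset.mem_erase, Finset.mem_powersetCard] at hS
  let ε : Fin n ≃ S := (S.equivFinOfCardEq hS.2.2).symm
  let f : Fin n → Fin N := fun i => (ε i : Fin N)
  have hf : Function.Injective f := fun a b h => ε.injective (Subtype.ext h)
  have hpos : 1 ≤ excess f := by
    by_contra hcon
    have h0 : excess f = 0 := by omega
    rw [excess, Finset.card_eq_zero, Finset.filter_eq_empty_iff] at h0
    refine hS.1 (Finset.eq_of_subset_of_card_le ?_ ?_)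
    · intro x hx
      have h1 := h0 (Finset.mem_univ (ε.symm ⟨x, hx⟩))
      have h2 : f (ε.symm ⟨x, hx⟩) = x := by simp [f]
      rw [h2, not_le] at h1
      exact Finset.mem_image.2 ⟨⟨x, h1⟩, Finset.mem_univ _, Fin.ext rfl⟩
    · rw [hS.2.2, (Finset.mem_powersetCard.1 hS₀).2]
  rw [← Matrix.det_submatrix_equiv_self ε, Matrix.submatrix_submatrix]
  change ‖(P.submatrix f f).det‖ ≤ _
  obtain ⟨k, rfl⟩ : ∃ k, m = k + 1 := ⟨m - 1, by omega⟩
  have h3 := norm_det_submatrix_seqProd_le hr hr1 hG hw k f f hf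
  rw [two_mul, ← add_assoc, pow_add] at h3
  refine (le_of_mul_le_mul_right h3 (pow_pos hr _)).trans ?_
  exact pow_le_pow_of_le_one hr.le hr1 (by omega)

theorem charpolyRev_coeff_eq {R : Type*} [CommRing R] {N : ℕ} (A : Matrix (Fin N) (Fin N) R)
    (n : ℕ) : A.charpolyRev.coeff n = (-1) ^ n * minorSum A n := by
  have h : A.charpolyRev =
      Matrix.det (1 + (Polynomial.X : Polynomial R) • (-A).map Polynomial.C) := by
    simp only [Matrix.charpolyRev, sub_eq_add_neg]
    congr 2
    rw [Matrix.map_neg Polynomial.C (map_neg Polynomial.C) A, smul_neg]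
  rw [h, Matrix.coeff_det_one_add_X_smul_eq_sum_minors, minorSum, Finset.mul_sum]
  refine Finset.sum_congr rfl fun S hS => ?_
  rw [Matrix.submatrix_neg, Pi.neg_apply, Pi.neg_apply, Matrix.det_neg, Fintype.card_coe,
    (Finset.mem_powersetCard.mp hS).2]

end Minors

/-! ### Field of definition of the coefficients of `F` -/

section CoefficientField

variable {p : ℕ} [Fact p.Prime] {π : ℂ_[p]}

theorem coeff_mul_mem {S : Subfield ℂ_[p]} {f g : ℂ_[p]⟦X⟧} (hf : ∀ n, PowerSeries.coeff n f ∈ S)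
    (hg : ∀ n, PowerSeries.coeff n g ∈ S) (n : ℕ) : PowerSeries.coeff n (f * g) ∈ S := by
  rw [PowerSeries.coeff_mul]
  exact S.sum_mem fun x _ => S.mul_mem (hf _) (hg _)

/-- The differential equation of `θ` is a recurrence with coefficients in `ℚ(π)`. -/
theorem coeff_theta_mem (hπ : π ^ (p - 1) = -(p : ℂ_[p])) {S : Subfield ℂ_[p]} (hπS : π ∈ S)
    (n : ℕ) : PowerSeries.coeff n (theta π) ∈ S := by
  induction n using Nat.strong_induction_on with
  | _ n ih =>
  rcases Nat.eq_zero_or_pos n with rfl | hn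
  · rw [coeff_zero_theta]; exact S.one_mem
  have h := congrArg (PowerSeries.coeff n) (eul_theta hπ)
  rw [coeff_eul, add_mul, map_add, mul_assoc, mul_assoc, PowerSeries.coeff_C_mul,
    PowerSeries.coeff_C_mul, ← pow_one (PowerSeries.X : ℂ_[p]⟦X⟧), ← pow_mul,
    PowerSeries.coeff_X_pow_mul', PowerSeries.coeff_X_pow_mul'] at h
  have hn0 : (n : ℂ_[p]) ≠ 0 := Nat.cast_ne_zero.2 hn.ne'
  rw [show PowerSeries.coeff n (theta π) = (n : ℂ_[p])⁻¹ * (n * PowerSeries.coeff n (theta π)) by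
    rw [inv_mul_cancel_left₀ hn0], h]
  have hp := (Fact.out : p.Prime).pos
  refine S.mul_mem (S.inv_mem (natCast_mem S n)) (S.add_mem (S.mul_mem hπS ?_)
    (S.mul_mem (S.pow_mem hπS _) ?_))
  · split_ifs
    · exact ih _ (by omega)
    · exact S.zero_mem
  · split_ifs
    · exact ih _ (by omega)
    · exact S.zero_mem

theorem coeff_F_mem (hπ : π ^ (p - 1) = -(p : ℂ_[p])) {S : Subfield ℂ_[p]} (hπS : π ∈ S)
    {G : Polynomial ℂ_[p]} (hG : ∀ i, G.coeff i ∈ S) (n : ℕ) :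
    PowerSeries.coeff n (F π G) ∈ S := by
  classical
  rw [F]
  have hmem : ∀ i ∈ Finset.Icc 1 G.natDegree, i ≠ 0 := fun i hi => by
    rw [Finset.mem_Icc] at hi; omega
  generalize Finset.Icc 1 G.natDegree = T at hmem
  induction T using Finset.induction_on generalizing n with
  | empty =>
    rw [Finset.prod_empty, PowerSeries.coeff_one]
    split_ifs
    · exact S.one_mem
    · exact S.zero_mem
  | insert a T ha ih =>
    rw [Finset.prod_insert ha]
    refine coeff_mul_mem (fun n => ?_)
      (fun n => ih n fun i hi => hmem i (Finset.mem_insert_of_mem hi)) n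
    rw [coeff_subst_monomial _ _ (hmem a (Finset.mem_insert_self _ _))]
    split_ifs
    · exact S.mul_mem (coeff_theta_mem hπ hπS _) (S.pow_mem (hG a) _)
    · exact S.zero_mem

end CoefficientField

/-! ### Leading terms of the matrix of `β` and of its minors -/

section FrobeniusMatrix

theorem expo_bounds {p d i j : ℕ} (hp : 3 * d ≤ p) (hi0 : 0 < i) (hj0 : 0 < j) (hjd : j < d) :
    p * i ≤ d * expo p d i j + j ∧ d * expo p d i j + j < p * i + d := by
  have h1 := Nat.div_add_mod (p * i) d
  have h2 := Nat.mod_lt (p * i) (show 0 < d by omega)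
  rw [expo_eq hj0 hjd (le_prime_mul hp hi0)]
  split_ifs with h
  · omega
  · rw [mul_add, mul_one]
    omega

/-- This makes every factorial `(expo p d i j)!` a `p`-adic unit. -/
theorem expo_lt {p d i j : ℕ} (hp : 3 * d ≤ p) (hi0 : 0 < i) (hid : i < d) (hj0 : 0 < j)
    (hjd : j < d) : expo p d i j < p := by
  have h := (expo_bounds hp hi0 hj0 hjd).2
  by_contra hcon
  have h1 := Nat.mul_le_mul_left d (not_lt.1 hcon)
  have h2 : p * (i + 1) ≤ p * d := Nat.mul_le_mul_left p hid
  rw [mul_comm d p] at h1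
  rw [mul_add, mul_one] at h2
  omega

variable {p : ℕ} [Fact p.Prime] {π : ℂ_[p]} {d : ℕ}

/-- The rate `s^n` of `F` becomes `s^(pn)` under `ψ_p`, and `p ≥ 6`; the constant pays for the shift
by `j < d`. The rate 6 is the one that `exists_reduction` asks for. -/
theorem norm_coeff_betaPS_X_pow_le (hp6 : 6 ≤ p) (hπ : π ^ (p - 1) = -(p : ℂ_[p])) {s : ℝ}
    (hs0 : 0 < s) (hs : s ^ (2 * d) = ‖π‖) {G : Polynomial ℂ_[p]} (hG : Admissible d G) {j : ℕ}
    (hj : j < d) (n : ℕ) :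
    ‖PowerSeries.coeff n (betaPS π G (PowerSeries.X ^ j))‖ ≤ (s ^ d)⁻¹ * s ^ (6 * n) := by
  rw [coeff_betaPS_X_pow, inv_mul_eq_div, le_div_iff₀ (pow_pos hs0 d)]
  split_ifs with h
  · refine (mul_le_mul_of_nonneg_right (norm_coeff_F_le (by omega) hπ hs0.le hs hG _)
      (by positivity)).trans ?_
    rw [← pow_add]
    refine pow_le_pow_of_le_one hs0.le (le_one_of_pow_eq_norm_pi hπ hs) ?_
    have := Nat.mul_le_mul_right n hp6
    omega
  · rw [norm_zero, zero_mul]; positivity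

/-- The monomials of degree `n ≥ d` do not affect the leading terms. For `n ≤ p` the index `p n - j`
is below `p^2` and the sharp bound on `F` suffices thanks to `p ≥ 3d`; for `n > p` the weak bound is
enough. -/
theorem norm_coeff_betaPS_X_pow_tail_le (hp : 3 * d ≤ p) (hp6 : 6 ≤ p)
    (hπ : π ^ (p - 1) = -(p : ℂ_[p])) {s : ℝ}
    (hs0 : 0 < s) (hs : s ^ (2 * d) = ‖π‖) {G : Polynomial ℂ_[p]} (hG : Admissible d G) {i j : ℕ}
    (hi0 : 0 < i) (hid : i < d) (hj0 : 0 < j) (hjd : j < d) {n : ℕ} (hn : d ≤ n) :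
    ‖PowerSeries.coeff n (betaPS π G (PowerSeries.X ^ j))‖ * (s ^ (2 * n))⁻¹ ≤
      ‖π‖ ^ (expo p d i j + 1) := by
  have hs1 := le_one_of_pow_eq_norm_pi hπ hs
  have he := (expo_bounds hp hi0 hj0 hjd).2
  generalize expo p d i j = e at *
  have h2 : p * (i + 1) ≤ p * d := Nat.mul_le_mul_left p hid
  have h3 : p * d ≤ p * n := Nat.mul_le_mul_left p hn
  rw [mul_add, mul_one] at h2
  rw [← div_eq_mul_inv, div_le_iff₀ (pow_pos hs0 _), ← hs, ← pow_mul, ← pow_add,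
    coeff_betaPS_X_pow, if_pos (by omega)]
  have e1 : 2 * d * (e + 1) = 2 * (d * e) + 2 * d := by ring
  rcases Nat.lt_or_ge p n with hpn | hpn
  · refine (norm_coeff_F_le (by omega) hπ hs0.le hs hG _).trans
      (pow_le_pow_of_le_one hs0.le hs1 ?_)
    obtain ⟨k, rfl⟩ : ∃ k, n = p + 1 + k := ⟨n - (p + 1), by omega⟩
    have h4 : 3 * (p * d) ≤ p * p := by
      have := Nat.mul_le_mul_left p hp
      rwa [mul_left_comm] at this
    have h5 : p * (p + 1 + k) = p * p + p + p * k := by ring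
    have h6 : 6 * k ≤ p * k := Nat.mul_le_mul_right k hp6
    have h7 : 6 * p ≤ p * p := Nat.mul_le_mul_right p hp6
    omega
  · have hlt : p * n - j < p ^ 2 := by
      have := Nat.mul_le_mul_left p hpn
      rw [pow_two]
      omega
    refine (norm_coeff_F_le_of_lt (by omega) hπ hs0.le hs hG hlt).trans
      (pow_le_pow_of_le_one hs0.le hs1 ?_)
    obtain ⟨k, rfl⟩ : ∃ k, n = d + k := ⟨n - d, by omega⟩
    have h5 : p * (d + k) = p * d + p * k := by ring
    have h6 : 6 * k ≤ p * k := Nat.mul_le_mul_right k hp6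
    omega

/-- Existence of the matrix of `β` modulo the image of `D`, with its leading terms. -/
theorem exists_frobenius_matrix (hd : 2 ≤ d) (hp : 3 * d ≤ p)
    (hπ : π ^ (p - 1) = -(p : ℂ_[p])) {s : ℝ}
    (hs0 : 0 < s) (hs1 : s < 1) (hs : s ^ (2 * d) = ‖π‖) {G : Polynomial ℂ_[p]}
    (hG : Admissible d G) (S : Subfield ℂ_[p]) (hπS : π ∈ S) (hGS : ∀ i, G.coeff i ∈ S)
    (hS : IsClosed (S : Set ℂ_[p])) {j : ℕ} (hjd : j < d) :
    ∃ c v : ℂ_[p]⟦X⟧,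
      betaPS π G (PowerSeries.X ^ j) = c + Dps π (frobPoly G) v ∧
      (∀ k, d ≤ k → PowerSeries.coeff k c = 0) ∧
      (∀ k, ‖PowerSeries.coeff k v‖ ≤ (s ^ d)⁻¹ * s ^ (4 * k)) ∧
      (∀ k, PowerSeries.coeff k c ∈ S) ∧
      (0 < j → ∀ i, 0 < i → i < d →
        ‖PowerSeries.coeff i c - π ^ expo p d i j / ((expo p d i j).factorial : ℂ_[p]) *
          (G ^ expo p d i j).coeff (p * i - j)‖ ≤ ‖π‖ ^ (expo p d i j + 1)) := by
  have hσS : ∀ i, (frobPoly G).coeff i ∈ S := fun i => by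
    rw [coeff_frobPoly]; exact S.pow_mem (hGS i) _
  obtain ⟨c, v, h1, h2, h3, h4, h5⟩ := exists_reduction hs0 hs1 hs (by omega) hG.frobPoly S hπS hσS hS
    (W := betaPS π G (PowerSeries.X ^ j))
    (norm_coeff_betaPS_X_pow_le (by omega) hπ hs0 hs hG hjd) (fun n => by
      rw [coeff_betaPS_X_pow]
      split_ifs
      · exact coeff_F_mem hπ hπS hGS _
      · exact S.zero_mem)
  refine ⟨c, v, h1, h2, h3, h4, fun hj0 i hi0 hid => ?_⟩
  -- `h6` compares the entry with `F_{pi-j}`, and `h7` compares `F_{pi-j}` with its leading term.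
  have h6 := h5 i hid _ (by positivity) fun n hn =>
    norm_coeff_betaPS_X_pow_tail_le hp (by omega) hπ hs0 hs hG hi0 hid hj0 hjd hn
  have he := (expo_bounds hp hi0 hj0 hjd).2
  have hpi : p ≤ p * i := Nat.le_mul_of_pos_right _ hi0
  have hpd : p * i ≤ p * d := Nat.mul_le_mul_left p hid.le
  have hpp : p * d ≤ p * p := Nat.mul_le_mul_left p (by omega)
  have h7 := norm_coeff_F_sub_le (by omega) hπ hG (expo_lt hp hi0 hid hj0 hjd)
    (n := p * i - j) (by rw [pow_two]; omega) (fun k hk => by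
      have := Nat.mul_le_mul_left d (Nat.succ_le_of_lt hk)
      rw [Nat.succ_eq_add_one, mul_add, mul_one] at this
      omega)
  rw [coeff_betaPS_X_pow, if_pos (by omega)] at h6
  rw [← sub_add_sub_cancel]
  exact (IsUltrametricDist.norm_add_le_max _ _).trans (max_le h6 h7)

theorem norm_prod_sub_prod_le {R ι : Type*} [NormedField R] [IsUltrametricDist R] (T : Finset ι)
    {x y : ι → R} {e : ι → ℕ} {r : ℝ} (hr0 : 0 < r) (hr1 : r ≤ 1)
    (hy : ∀ i ∈ T, ‖y i‖ ≤ r ^ e i) (h : ∀ i ∈ T, ‖x i - y i‖ ≤ r ^ (e i + 1)) :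
    ‖∏ i ∈ T, x i - ∏ i ∈ T, y i‖ ≤ r ^ (∑ i ∈ T, e i + 1) := by
  classical
  induction T using Finset.induction_on with
  | empty => simp [hr0.le]
  | insert a T ha ih =>
    rw [Finset.prod_insert ha, Finset.prod_insert ha, Finset.sum_insert ha]
    have h1 := ih (fun i hi => hy i (Finset.mem_insert_of_mem hi))
      fun i hi => h i (Finset.mem_insert_of_mem hi)
    have h2 := h a (Finset.mem_insert_self _ _)
    have h3 := hy a (Finset.mem_insert_self _ _)
    have h4 : ‖x a‖ ≤ r ^ e a := by
      rw [← sub_add_cancel (x a) (y a)]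
      exact (IsUltrametricDist.norm_add_le_max _ _).trans
        (max_le (h2.trans (pow_le_pow_of_le_one hr0.le hr1 (by omega))) h3)
    have h5 : ‖∏ i ∈ T, y i‖ ≤ r ^ ∑ i ∈ T, e i := by
      rw [norm_prod, ← Finset.prod_pow_eq_pow_sum]
      exact Finset.prod_le_prod (fun _ _ => norm_nonneg _) fun i hi =>
        hy i (Finset.mem_insert_of_mem hi)
    rw [show x a * ∏ i ∈ T, x i - y a * ∏ i ∈ T, y i =
      x a * (∏ i ∈ T, x i - ∏ i ∈ T, y i) + (x a - y a) * ∏ i ∈ T, y i by ring]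
    refine (IsUltrametricDist.norm_add_le_max _ _).trans (max_le ?_ ?_)
    · rw [norm_mul, add_assoc, pow_add]
      exact mul_le_mul h4 h1 (norm_nonneg _) (by positivity)
    · rw [norm_mul, show e a + ∑ i ∈ T, e i + 1 = (e a + 1) + ∑ i ∈ T, e i by ring, pow_add]
      exact mul_le_mul h2 h5 (norm_nonneg _) (by positivity)

theorem norm_coeff_polynomial_pow_le {G : Polynomial ℂ_[p]} (hG : Admissible d G) (e n : ℕ) :
    ‖(G ^ e).coeff n‖ ≤ 1 := by
  have := norm_coeff_pow_le (x := (G : ℂ_[p]⟦X⟧)) (B := 1)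
    (fun n => by rw [Polynomial.coeff_coe]; exact hG.norm_coeff_le n) e n
  rwa [one_pow, ← Polynomial.coe_pow, Polynomial.coeff_coe] at this

theorem norm_leading_le (hπ : π ^ (p - 1) = -(p : ℂ_[p])) {G : Polynomial ℂ_[p]}
    (hG : Admissible d G) {e : ℕ} (he : e < p) (n : ℕ) :
    ‖π ^ e / (e.factorial : ℂ_[p]) * (G ^ e).coeff n‖ ≤ ‖π‖ ^ e := by
  have hr := norm_pi_pos hπ
  rw [norm_mul, norm_div, norm_factorial_eq_one he, div_one, norm_pow]
  exact mul_le_of_le_one_right (by positivity) (norm_coeff_polynomial_pow_le hG _ _)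

/-- The leading term of the principal minors of the matrix of `β`. -/
theorem norm_det_submatrix_sub_le (hp : 3 * d ≤ p)
    (hπ : π ^ (p - 1) = -(p : ℂ_[p])) {G : Polynomial ℂ_[p]} (hG : Admissible d G)
    {A : Matrix (Fin (d - 1)) (Fin (d - 1)) ℂ_[p]}
    (hA : ∀ i j, ‖A i j - π ^ expo p d (i + 1) (j + 1) /
      ((expo p d (i + 1) (j + 1)).factorial : ℂ_[p]) *
        (G ^ expo p d (i + 1) (j + 1)).coeff (p * (i + 1) - (j + 1))‖ ≤
      ‖π‖ ^ (expo p d (i + 1) (j + 1) + 1)) {n : ℕ} (hn : n ≤ d - 1) :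
    ‖(A.submatrix (Fin.castLE hn) (Fin.castLE hn)).det -
      hasseP p d n G / (denom p d n : ℂ_[p]) * π ^ Y p d n‖ ≤ ‖π‖ ^ (Y p d n + 1) := by
  have hpp : p.Prime := Fact.out
  have hr := norm_pi_pos hπ
  have hr1 := (norm_pi_lt_one hπ).le
  let b : Fin n → Fin n → ℂ_[p] := fun i j => π ^ expo p d (i + 1) (j + 1) /
      ((expo p d (i + 1) (j + 1)).factorial : ℂ_[p]) *
        (G ^ expo p d (i + 1) (j + 1)).coeff (p * (i + 1) - (j + 1))
  have hlt : ∀ i : Fin n, (i : ℕ) + 1 < d := fun i => by have := i.2; omega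
  have hb : ∀ i j, ‖b i j‖ ≤ ‖π‖ ^ expo p d (i + 1) (j + 1) := fun i j =>
    norm_leading_le hπ hG (expo_lt hp (Nat.succ_pos _) (hlt i) (Nat.succ_pos _) (hlt j)) _
  have hwY : ∀ σ : Equiv.Perm (Fin n), Y p d n ≤ weight p d n σ := fun σ =>
    Finset.inf'_le _ (Finset.mem_univ σ)
  have hsplit : hasseP p d n G / (denom p d n : ℂ_[p]) * π ^ Y p d n =
      ∑ σ ∈ extremal p d n, ((Equiv.Perm.sign σ : ℤ) : ℂ_[p]) * ∏ k, b k (σ k) := by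
    rw [hasseP, Finset.sum_div, Finset.sum_mul]
    refine Finset.sum_congr rfl fun σ hσ => ?_
    have hw : weight p d n σ = Y p d n := (Finset.mem_filter.1 hσ).2
    simp only [b]
    rw [Finset.prod_mul_distrib, Finset.prod_div_distrib, Finset.prod_pow_eq_pow_sum,
      ← prod_factorial_eq_denom hpp hp hn hσ, ← hw, weight]
    push_cast
    ring
  -- The Leibniz formula `Matrix.det_apply'` permutes the rows whereas `hasseP` permutes the
  -- columns, hence the transpose.
  rw [hsplit, ← Matrix.det_transpose, Matrix.det_apply', ← Finset.univ_inter (extremal p d n),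
    ← Finset.sum_ite_mem, ← Finset.sum_sub_distrib]
  refine IsUltrametricDist.norm_sum_le_of_forall_le_of_nonneg (by positivity) fun σ _ => ?_
  have hdiff : ‖∏ k, A (Fin.castLE hn k) (Fin.castLE hn (σ k)) - ∏ k, b k (σ k)‖ ≤
      ‖π‖ ^ (weight p d n σ + 1) :=
    norm_prod_sub_prod_le Finset.univ hr hr1 (fun k _ => hb k (σ k))
      fun k _ => hA (Fin.castLE hn k) (Fin.castLE hn (σ k))
  have hdiff' : ‖∏ k, A (Fin.castLE hn k) (Fin.castLE hn (σ k)) - ∏ k, b k (σ k)‖ ≤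
      ‖π‖ ^ (Y p d n + 1) :=
    hdiff.trans (pow_le_pow_of_le_one hr.le hr1 (by have := hwY σ; omega))
  change ‖((Equiv.Perm.sign σ : ℤ) : ℂ_[p]) *
    ∏ k, A (Fin.castLE hn k) (Fin.castLE hn (σ k)) - _‖ ≤ _
  split_ifs with hσ
  · rw [← mul_sub, norm_sign_mul]
    exact hdiff'
  · rw [sub_zero, norm_sign_mul, ← sub_add_cancel (∏ k, A _ _) (∏ k, b k (σ k))]
    refine (IsUltrametricDist.norm_add_le_max _ _).trans (max_le hdiff' ?_)
    have hne : weight p d n σ ≠ Y p d n := fun h =>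
      hσ (Finset.mem_filter.2 ⟨Finset.mem_univ _, h⟩)
    have hprod : ‖∏ k, b k (σ k)‖ ≤ ‖π‖ ^ weight p d n σ := by
      rw [norm_prod, weight, ← Finset.prod_pow_eq_pow_sum]
      exact Finset.prod_le_prod (fun _ _ => norm_nonneg _) fun k _ => hb k (σ k)
    exact hprod.trans (pow_le_pow_of_le_one hr.le hr1 (by have := hwY σ; omega))

theorem norm_denom_eq_one (hp : 3 * d ≤ p) {n : ℕ} (hn : n ≤ d - 1) :
    ‖(denom p d n : ℂ_[p])‖ = 1 := by
  have hpp : p.Prime := Fact.out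
  obtain ⟨σ, hσ⟩ := exists_perm_eq_mod hpp hp hn
  have hmem : σ ∈ extremal p d n :=
    (mem_extremal_iff hpp hp hn σ).2 fun k hk => (hσ k hk).ge
  rw [← prod_factorial_eq_denom hpp hp hn hmem, Nat.cast_prod, norm_prod]
  refine Finset.prod_eq_one fun k _ => norm_factorial_eq_one ?_
  exact expo_lt hp (Nat.succ_pos _) (by have := k.2; omega) (Nat.succ_pos _)
    (by have := (σ k).2; omega)

/-- There is a single extremal permutation, and for it `p k - τ(k)` is `d` times the exponent. Each
factor is then a power of the leading coefficient, a unit. -/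
theorem norm_hasseP_top (hd : 2 ≤ d) (hp : 3 * d ≤ p) {G : Polynomial ℂ_[p]}
    (hG : Admissible d G) : ‖hasseP p d (d - 1) G‖ = 1 := by
  have hpp : p.Prime := Fact.out
  obtain ⟨τ, hτ, hτ'⟩ := exists_extremal_top hpp hp (by omega : 0 < d)
  rw [hasseP, hτ, Finset.sum_singleton, norm_sign_mul, norm_prod]
  refine Finset.prod_eq_one fun k _ => ?_
  have hk := k.2
  have hk' := (τ k).2
  rw [expo_eq (i := k + 1) (j := (τ k : ℕ) + 1) (Nat.succ_pos _) (by omega) (le_prime_mul hp (Nat.succ_pos _)), hτ',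
    if_pos le_rfl, show p * ((k : ℕ) + 1) - p * (k + 1) % d = p * (k + 1) / d * G.natDegree by
      rw [hG.natDegree_eq, mul_comm _ d]
      have := Nat.div_add_mod (p * ((k : ℕ) + 1)) d
      omega, Polynomial.coeff_pow_mul_natDegree, Polynomial.leadingCoeff, hG.natDegree_eq,
    norm_pow, hG.norm_coeff_natDegree, one_pow]

/-- The main term of the determinant has absolute value exactly `|π|^Y`, larger than the error. This
invertibility of `Γ` drives the uniqueness proof. -/
theorem det_ne_zero_of_leading (hd : 2 ≤ d) (hp : 3 * d ≤ p)
    (hπ : π ^ (p - 1) = -(p : ℂ_[p])) {G : Polynomial ℂ_[p]} (hG : Admissible d G)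
    {A : Matrix (Fin (d - 1)) (Fin (d - 1)) ℂ_[p]}
    (hA : ∀ i j, ‖A i j - π ^ expo p d (i + 1) (j + 1) /
      ((expo p d (i + 1) (j + 1)).factorial : ℂ_[p]) *
        (G ^ expo p d (i + 1) (j + 1)).coeff (p * (i + 1) - (j + 1))‖ ≤
      ‖π‖ ^ (expo p d (i + 1) (j + 1) + 1)) : A.det ≠ 0 := by
  intro h0
  have hr := norm_pi_pos hπ
  have h := norm_det_submatrix_sub_le hp hπ hG hA (le_refl (d - 1))
  have hid : A.submatrix (Fin.castLE (le_refl (d - 1))) (Fin.castLE (le_refl (d - 1))) = A := rfl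
  rw [hid, h0, zero_sub, norm_neg, norm_mul, norm_div, norm_hasseP_top hd hp hG,
    norm_denom_eq_one hp le_rfl, div_one, one_mul, norm_pow, pow_succ] at h
  have := mul_lt_of_lt_one_right (pow_pos hr (Y p d (d - 1))) (norm_pi_lt_one hπ)
  exact absurd h (not_le.2 this)

end FrobeniusMatrix

/-! ### Independence of the monomials of degree less than `d` modulo the image of `D` -/

section Uniqueness

variable {p : ℕ} [Fact p.Prime] {π : ℂ_[p]} {d : ℕ}

theorem betaPS_sum_smul {ι : Type*} (T : Finset ι) (G : Polynomial ℂ_[p]) (a : ι → ℂ_[p])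
    (U : ι → ℂ_[p]⟦X⟧) : betaPS π G (∑ i ∈ T, a i • U i) = ∑ i ∈ T, a i • betaPS π G (U i) := by
  ext n
  simp only [betaPS, coeff_psiPS, Finset.mul_sum, map_sum, mul_smul_comm, PowerSeries.coeff_smul]

theorem norm_coeff_betaPS_le (hp6 : 6 ≤ p) (hπ : π ^ (p - 1) = -(p : ℂ_[p])) {s : ℝ}
    (hs0 : 0 < s) (hs : s ^ (2 * d) = ‖π‖) {G : Polynomial ℂ_[p]} (hG : Admissible d G)
    {u : ℂ_[p]⟦X⟧} {C t : ℝ} (hst : s ≤ t) (hu : ∀ k, ‖PowerSeries.coeff k u‖ ≤ C * t ^ k)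
    (n : ℕ) : ‖PowerSeries.coeff n (betaPS π G u)‖ ≤ C * t ^ (p * n) := by
  have hC : 0 ≤ C := by simpa using (norm_nonneg _).trans (hu 0)
  have ht : 0 < t := hs0.trans_le hst
  rw [betaPS, coeff_psiPS, PowerSeries.coeff_mul]
  refine IsUltrametricDist.norm_sum_le_of_forall_le_of_nonneg (by positivity) fun x hx => ?_
  rw [Finset.HasAntidiagonal.mem_antidiagonal] at hx
  rw [norm_mul, ← hx, pow_add, mul_left_comm]
  exact mul_le_mul ((norm_coeff_F_le (by omega) hπ hs0.le hs hG _).trans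
    (pow_le_pow_left₀ hs0.le hst _)) (hu _) (norm_nonneg _) (by positivity)

/-- No nonzero polynomial of degree less than `d` lies in the image of the power series of a given
rate of decay under `Dps`. -/
theorem Dps_eq_zero_of_coeff_eq_zero (hd : 2 ≤ d) (hp : 3 * d ≤ p)
    (hπ : π ^ (p - 1) = -(p : ℂ_[p])) {s : ℝ} (hs0 : 0 < s) (hs1 : s < 1)
    (hs : s ^ (2 * d) = ‖π‖) (k : ℕ) {G : Polynomial ℂ_[p]} (hG : Admissible d G)
    {u : ℂ_[p]⟦X⟧} {C t : ℝ} (ht0 : 0 < t) (ht1 : t ≤ 1) (ht : t ^ 2 ^ k ≤ s ^ 4)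
    (hu : ∀ n, ‖PowerSeries.coeff n u‖ ≤ C * t ^ n)
    (h : ∀ n, d ≤ n → PowerSeries.coeff n (Dps π G u) = 0) : Dps π G u = 0 := by
  induction k generalizing G u C t with
  | zero =>
    rw [pow_zero, pow_one] at ht
    have hC : 0 ≤ C := by simpa using (norm_nonneg _).trans (hu 0)
    rw [eq_zero_of_coeff_Dps_eq_zero hs0 hs1 hs (by omega) hG (C := C) (fun n => ?_) h, map_zero]
    rw [pow_mul]
    exact (hu n).trans (mul_le_mul_of_nonneg_left (pow_le_pow_left₀ ht0.le ht n) hC)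
  | succ k ih =>
    have hC : 0 ≤ C := by simpa using (norm_nonneg _).trans (hu 0)
    -- Apply `β` to `D u`. By `betaPS_Dps`, `∑ a_j c_j` is again in the image of the twisted
    -- operator, with a primitive made of `p β(u)` and the `v_j`, of better decay. The induction
    -- hypothesis gives `∑ a_j c_j = 0`, hence `Γ a = 0` and `a = 0`.
    choose c v hcv hc hv _ hlead using fun j : Fin (d - 1) =>
      exists_frobenius_matrix hd hp hπ hs0 hs1 hs hG ⊤ (Subfield.mem_top _)
        (fun _ => Subfield.mem_top _) isClosed_univ (show (j : ℕ) + 1 < d by omega)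
    set a : Fin (d - 1) → ℂ_[p] := fun j => PowerSeries.coeff ((j : ℕ) + 1) (Dps π G u) with ha
    -- `D u` never has a constant term, so only `X, …, X^{d-1}` occur, and `Γ` replaces the full
    -- matrix.
    have h0 : PowerSeries.coeff 0 (Dps π G u) = 0 := by
      rw [coeff_Dps, Nat.cast_zero, zero_mul, zero_add]
      refine Finset.sum_eq_zero fun x hx => ?_
      rw [Finset.HasAntidiagonal.mem_antidiagonal] at hx
      rw [show x.1 = 0 by omega, Nat.cast_zero, zero_mul, mul_zero, zero_mul]
    have hsum : Dps π G u = ∑ j, a j • (PowerSeries.X ^ ((j : ℕ) + 1) : ℂ_[p]⟦X⟧) := by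
      ext n
      simp only [map_sum, PowerSeries.coeff_smul, PowerSeries.coeff_X_pow, smul_eq_mul, mul_ite,
        mul_one, mul_zero]
      rcases Nat.eq_zero_or_pos n with rfl | hn
      · rw [h0, Finset.sum_eq_zero]
        intro j _
        exact if_neg (by omega)
      rcases Nat.lt_or_ge n d with hnd | hnd
      · rw [Finset.sum_eq_single (⟨n - 1, by omega⟩ : Fin (d - 1))]
        · rw [if_pos (by simp only; omega), ha]
          simp only
          rw [Nat.sub_add_cancel hn]
        · intro j _ hj
          refine if_neg fun hn' => hj (Fin.ext ?_)
          simp only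
          omega
        · exact fun hj => absurd (Finset.mem_univ _) hj
      · rw [h n hnd, Finset.sum_eq_zero]
        intro j _
        exact if_neg (by have := j.2; omega)
    have hlin := betaPS_Dps hπ G u
    rw [hsum, betaPS_sum_smul] at hlin
    simp only [hcv, smul_add, Finset.sum_add_distrib] at hlin
    have hker : Dps π (frobPoly G) ((p : ℂ_[p]) • betaPS π G u - ∑ j, a j • v j) =
        ∑ j, a j • c j := by
      rw [map_sub, map_sum, map_smul, ← hlin]
      simp only [map_smul]
      rw [add_sub_cancel_right]
    have hzero : ∑ j, a j • c j = 0 := by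
      rw [← hker]
      -- `β(u)` has rate `max(t, s)^p`, which `t'` dominates, and the `v_j` have rate `s^4`.
      -- Squaring at each step brings the rate down to `s^4` in `k` steps.
      set t' := max (t ^ 2) (s ^ 4) with ht'
      have ht'0 : 0 < t' := (pow_pos hs0 4).trans_le (le_max_right _ _)
      refine ih hG.frobPoly (t := t') (C := max C ((s ^ d)⁻¹ * ∑ j, ‖a j‖)) ht'0
        (max_le (pow_le_one₀ ht0.le ht1) (pow_le_one₀ hs0.le hs1.le)) ?_ (fun n => ?_)
        fun n hn => ?_
      · rcases max_choice (t ^ 2) (s ^ 4) with hm | hm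
        · rw [ht', hm, ← pow_mul, ← pow_succ']
          exact ht
        · rw [ht', hm]
          exact pow_le_of_le_one (by positivity) (pow_le_one₀ hs0.le hs1.le) (by positivity)
      · rw [map_sub, map_sum]
        have hmax : max t s ^ p ≤ t' := by
          rcases max_choice t s with hm | hm
          · rw [hm]
            exact (pow_le_pow_of_le_one ht0.le ht1 (by omega)).trans (le_max_left _ _)
          · rw [hm]
            exact (pow_le_pow_of_le_one hs0.le hs1.le (by omega)).trans (le_max_right _ _)
        refine (norm_sub_le_max_norm _ _).trans (max_le ?_ ?_)
        · rw [PowerSeries.coeff_smul, smul_eq_mul, norm_mul]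
          refine (mul_le_of_le_one_left (norm_nonneg _) (norm_natCast_le_one p)).trans ?_
          refine (norm_coeff_betaPS_le (by omega) hπ hs0 hs hG (le_max_right t s)
            (fun k => (hu k).trans (mul_le_mul_of_nonneg_left
              (pow_le_pow_left₀ ht0.le (le_max_left t s) k) hC)) n).trans ?_
          rw [pow_mul]
          exact mul_le_mul (le_max_left _ _) (pow_le_pow_left₀ (by positivity) hmax n)
            (by positivity) (hC.trans (le_max_left _ _))
        · refine (norm_sum_le _ _).trans ?_
          refine le_trans ?_ (mul_le_mul_of_nonneg_right (le_max_right C _)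
            (pow_nonneg ht'0.le n))
          rw [Finset.mul_sum, Finset.sum_mul]
          refine Finset.sum_le_sum fun j _ => ?_
          rw [PowerSeries.coeff_smul, smul_eq_mul, norm_mul, mul_comm ((s ^ d)⁻¹), mul_assoc]
          refine mul_le_mul_of_nonneg_left ((hv j n).trans ?_) (norm_nonneg _)
          rw [pow_mul]
          exact mul_le_mul_of_nonneg_left
            (pow_le_pow_left₀ (by positivity) (le_max_right _ _) n) (by positivity)
      · rw [hker, map_sum]
        exact Finset.sum_eq_zero fun j _ => by rw [PowerSeries.coeff_smul, hc j n hn, smul_zero]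
    let A : Matrix (Fin (d - 1)) (Fin (d - 1)) ℂ_[p] :=
      Matrix.of fun i j => PowerSeries.coeff ((i : ℕ) + 1) (c j)
    have hA : A.det ≠ 0 := det_ne_zero_of_leading hd hp hπ hG fun i j =>
      hlead j (Nat.succ_pos _) (i + 1) (Nat.succ_pos _) (by have := i.2; omega)
    have hAa : A.mulVec a = 0 := by
      funext i
      have := congrArg (PowerSeries.coeff ((i : ℕ) + 1)) hzero
      rw [map_sum, map_zero] at this
      rw [Pi.zero_apply, ← this]
      change ∑ j, PowerSeries.coeff ((i : ℕ) + 1) (c j) * a j = _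
      refine Finset.sum_congr rfl fun j _ => ?_
      rw [PowerSeries.coeff_smul, smul_eq_mul, mul_comm]
    have ha0 := Matrix.eq_zero_of_mulVec_eq_zero hA hAa
    rw [hsum]
    exact Finset.sum_eq_zero fun j _ => by rw [ha0, Pi.zero_apply, zero_smul]

theorem exists_pow_eq_norm_pi (hπ : π ^ (p - 1) = -(p : ℂ_[p])) (hd : d ≠ 0) :
    ∃ s : ℝ, 0 < s ∧ s < 1 ∧ s ^ (2 * d) = ‖π‖ := by
  have h2d : 2 * d ≠ 0 := by omega
  refine ⟨‖π‖ ^ ((2 * d : ℕ) : ℝ)⁻¹, Real.rpow_pos_of_pos (norm_pi_pos hπ) _,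
    Real.rpow_lt_one (norm_nonneg _) (norm_pi_lt_one hπ) (by positivity),
    Real.rpow_inv_natCast_pow (norm_nonneg _) h2d⟩

/-- Modulo the image of `D` on overconvergent series, the monomials `1, X, …, X^{d-1}` are linearly
independent. -/
theorem eq_zero_of_D_eq_toLaurent (hd : 2 ≤ d) (hp : 3 * d ≤ p)
    (hπ : π ^ (p - 1) = -(p : ℂ_[p])) {G : Polynomial ℂ_[p]} (hG : Admissible d G)
    {u : ℤ → ℂ_[p]} (hu : Overconvergent u) {c : ℂ_[p]⟦X⟧}
    (hc : ∀ n, d ≤ n → PowerSeries.coeff n c = 0) (h : D π G u = toLaurent c) : c = 0 := by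
  obtain ⟨s, hs0, hs1, hs⟩ := exists_pow_eq_norm_pi (π := π) hπ (show d ≠ 0 by omega)
  obtain ⟨U, -, rfl, t, C, ht0, ht1, hU⟩ := exists_toLaurent_of_D_eq hπ hG hu h
  obtain ⟨k, hk⟩ := exists_pow_lt_of_lt_one (pow_pos hs0 4) ht1
  refine Dps_eq_zero_of_coeff_eq_zero hd hp hπ hs0 hs1 hs k hG ht0 ht1.le ?_ hU hc
  exact (pow_le_pow_of_le_one ht0.le ht1.le Nat.lt_two_pow_self.le).trans hk.le

end Uniqueness

/-! ### Residue field and Teichmüller elements -/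

section ResidueField

theorem exists_residue_hom.{u} (F : Type u) [NormedField F] [IsUltrametricDist F] :
    ∃ (R : Subring F) (k : Type u) (_ : Field k) (res : R →+* k),
      (∀ x, x ∈ R ↔ ‖x‖ ≤ 1) ∧ ∀ x : R, res x = 0 ↔ ‖(x : F)‖ < 1 := by
  let v := NormedField.valuation (K := F)
  let A := v.valuationSubring
  refine ⟨A.toSubring, IsLocalRing.ResidueField A, inferInstance, IsLocalRing.residue A,
    fun x => ?_, fun x => ?_⟩
  · exact Iff.rfl
  · refine (IsLocalRing.residue_eq_zero_iff (R := A) x).trans ?_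
    rw [IsLocalRing.mem_maximalIdeal, mem_nonunits_iff]
    refine (not_congr ((Valuation.integer.integers v).isUnit_iff_valuation_eq_one
      (x := x))).trans ?_
    exact (lt_iff_le_and_ne.trans (and_iff_right x.2)).symm

variable {p : ℕ} [Fact p.Prime]

theorem norm_eq_zero_or_one_of_pow_eq {F : Type*} [NormedField F] {x : F} {q : ℕ} (hq : 1 < q)
    (hx : x ^ q = x) : ‖x‖ = 0 ∨ ‖x‖ = 1 := by
  rw [norm_eq_zero]
  refine or_iff_not_imp_left.2 fun h0 => ?_
  have h1 : x ^ (q - 1) = 1 := by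
    refine mul_right_cancel₀ h0 ?_
    rw [← pow_succ, Nat.sub_add_cancel hq.le, hx, one_mul]
  have h2 := congrArg norm h1
  rw [norm_pow, norm_one] at h2
  exact (pow_eq_one_iff_of_nonneg (norm_nonneg _) (by omega)).1 h2

/-- Over the residue field of `ℂ_p`, the zeros of `X ^ p ^ m - X` that satisfy every integral
congruence satisfied by a given one are its iterated `p`-th powers. -/
theorem exists_eq_pow_of_norm_aeval {m : ℕ} (hm : 0 < m) {ζ η : ℂ_[p]} (hζ : ζ ^ p ^ m = ζ)
    (hη : η ^ p ^ m = η)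
    (h : ∀ P : Polynomial ℤ, ‖Polynomial.aeval ζ P‖ < 1 → ‖Polynomial.aeval η P‖ < 1) :
    ∃ k < m, η = ζ ^ p ^ k := by
  have hpp : p.Prime := Fact.out
  have hq : 1 < p ^ m := Nat.one_lt_pow hm.ne' hpp.one_lt
  obtain ⟨R, κ, _, res, hR, hres⟩ := exists_residue_hom ℂ_[p]
  have hint : ∀ {x : ℂ_[p]}, x ^ p ^ m = x → x ∈ R := fun {x} hx => by
    rw [hR]
    rcases norm_eq_zero_or_one_of_pow_eq hq hx with h | h <;> rw [h]
    exact zero_le_one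
  let z : R := ⟨ζ, hint hζ⟩
  let y : R := ⟨η, hint hη⟩
  have hz : z ^ p ^ m = z := Subtype.ext hζ
  have hy : y ^ p ^ m = y := Subtype.ext hη
  have hp0 : (p : κ) = 0 := by
    rw [← map_natCast res, hres, Subring.coe_natCast, norm_natCast_prime]
    exact inv_lt_one_of_one_lt₀ (by exact_mod_cast hpp.one_lt)
  have : CharP κ p := by
    rw [CharP.charP_iff_prime_eq_zero hpp]
    exact hp0
  let a := res z
  have ha : a ^ p ^ m = a := by rw [← map_pow, hz]
  -- Since `a^(p^m) = a`, Frobenius permutes the factors cyclically. Hence `f` has coefficients in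
  -- the prime field and lifts to `ℤ[X]`.
  let f : Polynomial κ := ∏ k ∈ Finset.range m, (Polynomial.X - Polynomial.C (a ^ p ^ k))
  have hf : f.map (frobenius κ p) = f := by
    simp only [f, Polynomial.map_prod, Polynomial.map_sub, Polynomial.map_X, Polynomial.map_C,
      frobenius_def, ← pow_mul, ← pow_succ]
    have h1 := Finset.prod_range_succ
      (fun k => Polynomial.X - Polynomial.C (a ^ p ^ k) : ℕ → Polynomial κ) m
    rw [Finset.prod_range_succ', ha, pow_zero, pow_one] at h1
    exact mul_right_cancel₀ (Polynomial.X_sub_C_ne_zero a) h1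
  obtain ⟨P, hP⟩ : f ∈ Polynomial.lifts (Int.castRingHom κ) := by
    rw [Polynomial.lifts_iff_coeff_lifts]
    intro n
    have h1 : f.coeff n ^ p = f.coeff n := by
      conv_rhs => rw [← hf]
      rw [Polynomial.coeff_map, frobenius_def]
    rw [← Subfield.mem_bot_iff_pow_eq_self κ p, ← ZMod.fieldRange_castHom_eq_bot p] at h1
    obtain ⟨w, hw⟩ := h1
    obtain ⟨w, rfl⟩ := ZMod.intCast_surjective w
    exact ⟨w, by rw [← hw]; simp⟩
  have hP' : P.map (Int.castRingHom κ) = f := hP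
  have hev : ∀ w : R, res (Polynomial.aeval w P) = f.eval (res w) := fun w => by
    rw [← hP', Polynomial.eval_map, Polynomial.aeval_def, Polynomial.hom_eval₂]
    congr 1
    exact RingHom.ext_int _ _
  have hcoe : ∀ w : R, ((Polynomial.aeval w P : R) : ℂ_[p]) = Polynomial.aeval (w : ℂ_[p]) P :=
    fun w => by
      rw [Polynomial.aeval_def, Polynomial.aeval_def]
      refine (Polynomial.hom_eval₂ P _ R.subtype w).trans ?_
      congr 1
      exact RingHom.ext_int _ _
  have h1 : f.eval a = 0 := by
    rw [Polynomial.eval_prod]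
    refine Finset.prod_eq_zero (Finset.mem_range.2 hm) ?_
    simp
  rw [← hev z, hres, hcoe] at h1
  have h2 := h P h1
  rw [← hcoe y, ← hres, hev, Polynomial.eval_prod, Finset.prod_eq_zero_iff] at h2
  obtain ⟨k, hk, h3⟩ := h2
  rw [Polynomial.eval_sub, Polynomial.eval_X, Polynomial.eval_C, sub_eq_zero] at h3
  refine ⟨k, Finset.mem_range.1 hk, ?_⟩
  -- Teichmüller elements with equal residues coincide. With `q = p^m`, if `y ≠ z'` then the
  -- cofactor of `y - z'` in `y^q - z'^q = y - z'` is 1, whereas its residue is a multiple of `q`,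
  -- that is 0.
  have h4 := (Commute.all y (z ^ p ^ k)).geom_sum₂_mul (p ^ m)
  rw [hy, ← pow_mul, mul_comm (p ^ k), pow_mul, hz] at h4
  have h5 : res (∑ i ∈ Finset.range (p ^ m), y ^ i * (z ^ p ^ k) ^ (p ^ m - 1 - i)) = 0 := by
    rw [map_sum, Finset.sum_congr rfl (g := fun _ => (a ^ p ^ k) ^ (p ^ m - 1))]
    · rw [Finset.sum_const, Finset.card_range, nsmul_eq_mul, Nat.cast_pow, hp0,
        zero_pow hm.ne', zero_mul]
    · intro i hi
      rw [map_mul, map_pow, map_pow, map_pow, h3, ← pow_add]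
      congr 1
      have := Finset.mem_range.1 hi
      omega
  by_contra hne
  have h6 : y - z ^ p ^ k ≠ 0 := fun h => hne (congrArg Subtype.val (sub_eq_zero.1 h))
  have h7 : ∑ i ∈ Finset.range (p ^ m), y ^ i * (z ^ p ^ k) ^ (p ^ m - 1 - i) = 1 :=
    mul_right_cancel₀ h6 (by rw [one_mul]; exact h4)
  rw [h7, map_one] at h5
  exact one_ne_zero h5

end ResidueField

/-! ### The fields `K_m` and `K_m(π)`, and the norm of `K_m` -/

section Extensions

variable {p : ℕ} [Fact p.Prime]

theorem norm_algebraMap_padic (x : ℚ_[p]) : ‖algebraMap ℚ_[p] ℂ_[p] x‖ = ‖x‖ :=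
  PadicComplex.norm_extends' p x

/-- Embeddings of algebraic extensions of `ℚ_p` are isometric. -/
theorem norm_algHom_eq {E : IntermediateField ℚ_[p] ℂ_[p]} [Algebra.IsAlgebraic ℚ_[p] E]
    (φ : E →ₐ[ℚ_[p]] ℂ_[p]) (x : E) : ‖φ x‖ = ‖(x : ℂ_[p])‖ := by
  -- The absolute value of `ℚ_p` extends uniquely to an algebraic extension; the inclusion and `φ`
  -- both pull back that extension.
  have key : ∀ ψ : E →ₐ[ℚ_[p]] ℂ_[p], ‖ψ x‖ = spectralNorm ℚ_[p] E x := fun ψ =>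
    spectralNorm_unique_field_norm_ext
      (f := (NormedField.toAbsoluteValue ℂ_[p]).comp (f := ψ.toRingHom) ψ.injective)
      (fun y => by
        change ‖ψ (algebraMap _ _ y)‖ = _
        rw [AlgHom.commutes, norm_algebraMap_padic]) x
  rw [key φ, ← key E.val]
  rfl

theorem teich_finite {m : ℕ} (hm : 0 < m) : (teich p m).Finite := by
  have hq : 1 < p ^ m := Nat.one_lt_pow hm.ne' (Fact.out : p.Prime).one_lt
  refine (Polynomial.finite_setOfPred_isRoot
    (FiniteField.X_pow_card_sub_X_ne_zero ℂ_[p] hq)).subset fun x hx => ?_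
  have hx' : x ^ p ^ m = x := hx
  simp [hx']

theorem isIntegral_of_mem_teich {m : ℕ} (hm : 0 < m) {x : ℂ_[p]} (hx : x ∈ teich p m) :
    IsIntegral ℚ_[p] x := by
  have hq : 1 < p ^ m := Nat.one_lt_pow hm.ne' (Fact.out : p.Prime).one_lt
  have hx' : x ^ p ^ m = x := hx
  refine ⟨Polynomial.X ^ p ^ m - Polynomial.X,
    Polynomial.monic_X_pow_sub (by rw [Polynomial.degree_X]; exact_mod_cast hq), ?_⟩
  simp [hx']

theorem finiteDimensional_K {m : ℕ} (hm : 0 < m) : FiniteDimensional ℚ_[p] (K p m) := by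
  have := (teich_finite (p := p) hm).to_subtype
  exact IntermediateField.finiteDimensional_adjoin fun x hx => isIntegral_of_mem_teich hm hx

theorem finiteDimensional_L {m : ℕ} (hm : 0 < m) {π : ℂ_[p]} (hπ : π ^ (p - 1) = -(p : ℂ_[p])) :
    FiniteDimensional ℚ_[p] (L p m π) := by
  have := ((teich_finite (p := p) hm).insert π).to_subtype
  refine IntermediateField.finiteDimensional_adjoin fun x hx => ?_
  rcases hx with rfl | hx
  · refine IsIntegral.of_pow (n := p - 1) (by have := (Fact.out : p.Prime).two_le; omega) ?_
    rw [hπ]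
    exact (isIntegral_natCast p).neg
  · exact isIntegral_of_mem_teich hm hx

/-- A finite-dimensional space over the complete field `ℚ_p` is closed. The entries of `M` are sums
of infinite series, and this keeps them in `K_m(π)`. -/
theorem isClosed_L {m : ℕ} (hm : 0 < m) {π : ℂ_[p]} (hπ : π ^ (p - 1) = -(p : ℂ_[p])) :
    IsClosed ((L p m π).toSubfield : Set ℂ_[p]) := by
  have : FiniteDimensional ℚ_[p] (L p m π).toSubalgebra.toSubmodule := finiteDimensional_L hm hπ
  exact Submodule.closed_of_finiteDimensional (L p m π).toSubalgebra.toSubmodule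

theorem exists_primitiveRoot {n : ℕ} (hn : n ≠ 0) : ∃ ζ : ℂ_[p], IsPrimitiveRoot ζ n := by
  have : NeZero n := ⟨hn⟩
  obtain ⟨ζ, hζ⟩ := HasEnoughRootsOfUnity.exists_primitiveRoot (PadicAlgCl p) n
  exact ⟨_, hζ.map_of_injective (algebraMap (PadicAlgCl p) ℂ_[p]).injective⟩

theorem isGalois_K {m : ℕ} (hm : 0 < m) : IsGalois ℚ_[p] (K p m) := by
  have hq : 1 < p ^ m := Nat.one_lt_pow hm.ne' (Fact.out : p.Prime).one_lt
  let f : Polynomial ℚ_[p] := Polynomial.X ^ p ^ m - Polynomial.X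
  have hf0 : f ≠ 0 := FiniteField.X_pow_card_sub_X_ne_zero _ hq
  have hroot : f.rootSet ℂ_[p] = teich p m := by
    ext x
    rw [Polynomial.mem_rootSet]
    simp only [f, map_sub, map_pow, Polynomial.aeval_X, sub_eq_zero]
    exact ⟨fun h => h.2, fun h => ⟨hf0, h⟩⟩
  have hsplit : (f.map (algebraMap ℚ_[p] ℂ_[p])).Splits := by
    rw [IsScalarTower.algebraMap_eq ℚ_[p] (PadicAlgCl p) ℂ_[p], ← Polynomial.map_map]
    exact (IsAlgClosed.splits _).map _
  have : f.IsSplittingField ℚ_[p] (K p m) := by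
    have := IntermediateField.adjoin_rootSet_isSplittingField hsplit
    rwa [hroot] at this
  have : Normal ℚ_[p] (K p m) := Normal.of_isSplittingField f
  exact ⟨⟩

theorem IsFrobenius.iterate_apply {m : ℕ} {π : ℂ_[p]} {τ : L p m π ≃ₐ[ℚ_[p]] L p m π}
    (hτ : IsFrobenius τ) (k : ℕ) {x : L p m π} (hx : (x : ℂ_[p]) ∈ teich p m) :
    τ^[k] x = x ^ p ^ k := by
  induction k with
  | zero => simp
  | succ k ih => rw [Function.iterate_succ_apply', ih, map_pow, hτ.2 x hx, ← pow_mul, ← pow_succ']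

/-- The embedding of `K_m(π)` in `ℂ_p` obtained from the `k`-th iterate of an automorphism. -/
def embIterate {m : ℕ} {π : ℂ_[p]} (τ : L p m π ≃ₐ[ℚ_[p]] L p m π) (k : ℕ) :
    L p m π →ₐ[ℚ_[p]] ℂ_[p] :=
  (L p m π).val.comp ((τ ^ k : L p m π ≃ₐ[ℚ_[p]] L p m π) : L p m π →ₐ[ℚ_[p]] L p m π)

theorem embIterate_apply {m : ℕ} {π : ℂ_[p]} (τ : L p m π ≃ₐ[ℚ_[p]] L p m π) (k : ℕ)
    (x : L p m π) : embIterate τ k x = (τ^[k] x : L p m π) := by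
  change (((τ ^ k : L p m π ≃ₐ[ℚ_[p]] L p m π) _ : L p m π) : ℂ_[p]) = _
  rw [AlgEquiv.coe_pow]

/-- The norm of `K_m` over `ℚ_p` is the product over the iterates of Frobenius. -/
theorem IsFrobenius.norm_eq_prod {m : ℕ} (hm : 0 < m) {π : ℂ_[p]}
    {τ : L p m π ≃ₐ[ℚ_[p]] L p m π} (hτ : IsFrobenius τ) (x : K p m) :
    algebraMap ℚ_[p] ℂ_[p] (Algebra.norm ℚ_[p] x) =
      ∏ k ∈ Finset.range m, embIterate τ k (IntermediateField.inclusion (K_le_L m π) x) := by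
  have hpp : p.Prime := Fact.out
  have hq : 1 < p ^ m := Nat.one_lt_pow hm.ne' hpp.one_lt
  have := finiteDimensional_K (p := p) hm
  have := isGalois_K (p := p) hm
  obtain ⟨ζ, hζ⟩ := exists_primitiveRoot (p := p) (show p ^ m - 1 ≠ 0 by omega)
  have hζT : ζ ^ p ^ m = ζ := by
    rw [← Nat.sub_add_cancel hq.le, pow_succ, hζ.pow_eq_one, one_mul]
  have hζK : ζ ∈ K p m := IntermediateField.subset_adjoin _ _ hζT
  let z : K p m := ⟨ζ, hζK⟩
  -- The Teichmüller set consists of 0 and the powers of `ζ`, so an embedding of `K_m` is determined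
  -- by the image of `ζ`.
  have hext : ∀ φ ψ : K p m →ₐ[ℚ_[p]] ℂ_[p], φ z = ψ z → φ = ψ := fun φ ψ h => by
    refine IntermediateField.adjoin_algHom_ext ℚ_[p] fun x hx => ?_
    have hx' : x ^ p ^ m = x := hx
    rcases eq_or_ne x 0 with rfl | hx0
    · exact (map_zero φ).trans (map_zero ψ).symm
    have h1 : x ^ (p ^ m - 1) = 1 := by
      refine mul_right_cancel₀ hx0 ?_
      rw [← pow_succ, Nat.sub_add_cancel hq.le, hx', one_mul]
    have : NeZero (p ^ m - 1) := ⟨by omega⟩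
    obtain ⟨i, -, rfl⟩ := hζ.eq_pow_of_pow_eq_one h1
    have e : (⟨ζ ^ i, IntermediateField.subset_adjoin _ _ hx⟩ : K p m) = z ^ i := rfl
    exact (map_pow φ z i).trans ((congrArg (· ^ i) h).trans (map_pow ψ z i).symm)
  let ε : ℕ → K p m →ₐ[ℚ_[p]] ℂ_[p] := fun k =>
    (embIterate τ k).comp (IntermediateField.inclusion (K_le_L m π))
  have hemb : ∀ k, ε k z = ζ ^ p ^ k := fun k => by
    change embIterate τ k (IntermediateField.inclusion (K_le_L m π) z) = _
    rw [embIterate_apply, hτ.iterate_apply k (x := IntermediateField.inclusion (K_le_L m π) z) hζT]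
    rfl
  let r : Fin m → Gal(K p m/ℚ_[p]) := fun k => (ε k).restrictNormal' (K p m)
  have hr : ∀ k y, ((r k y : K p m) : ℂ_[p]) = ε k y := fun k y =>
    AlgHom.restrictNormal_commutes (ε k) (K p m) y
  have hbij : Function.Bijective r := by
    constructor
    · intro i j hij
      have h1 : ζ ^ p ^ (i : ℕ) = ζ ^ p ^ (j : ℕ) := by
        rw [← hemb, ← hemb, ← hr, ← hr, hij]
      -- This puts `p^k` below the order `p^m - 1` of `ζ`, unless `p^m = 2`, which is treated apart.
      have hle : ∀ k : Fin m, 2 * p ^ (k : ℕ) ≤ p ^ m := fun k =>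
        (Nat.mul_le_mul_right _ hpp.two_le).trans
          (by rw [← pow_succ']; exact Nat.pow_le_pow_right hpp.pos k.2)
      rcases Nat.lt_or_ge (p ^ m - 1) 2 with h2 | h2
      · have : m = 1 := by
          by_contra h3
          have h4 : p ^ 2 ≤ p ^ m := Nat.pow_le_pow_right hpp.pos (by omega)
          have h5 : 2 ^ 2 ≤ p ^ 2 := Nat.pow_le_pow_left hpp.two_le 2
          omega
        subst this
        exact Subsingleton.elim _ _
      · have hi := hle i
        have hj := hle j
        have h3 : p ^ (i : ℕ) = p ^ (j : ℕ) := hζ.pow_inj (by omega) (by omega) h1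
        exact Fin.ext (Nat.pow_right_injective hpp.two_le h3)
    · intro σ
      let φ : K p m →ₐ[ℚ_[p]] ℂ_[p] := (K p m).val.comp (σ : K p m →ₐ[ℚ_[p]] K p m)
      -- `σ` is isometric, so the image of `ζ` satisfies every integral congruence that `ζ`
      -- satisfies.
      obtain ⟨k, hk, h1⟩ := exists_eq_pow_of_norm_aeval hm (η := φ z) hζT
        (by rw [← map_pow, show z ^ p ^ m = z from Subtype.ext hζT]) (fun P hP => by
          have h2 : Polynomial.aeval (φ z) P = φ (Polynomial.aeval z P) :=
            Polynomial.aeval_algHom_apply (φ.restrictScalars ℤ) z P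
          have h3 : Polynomial.aeval ζ P = (K p m).val (Polynomial.aeval z P) :=
            Polynomial.aeval_algHom_apply ((K p m).val.restrictScalars ℤ) z P
          rw [h2, norm_algHom_eq]
          rwa [h3] at hP)
      refine ⟨⟨k, hk⟩, AlgEquiv.ext fun y => Subtype.ext ?_⟩
      rw [hr]
      exact DFunLike.congr_fun (hext (ε k) φ (by rw [hemb, h1])) y
  have h1 := congrArg (algebraMap (K p m) ℂ_[p]) (Algebra.norm_eq_prod_automorphisms ℚ_[p] x)
  rw [← IsScalarTower.algebraMap_apply, map_prod, ← hbij.prod_comp] at h1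
  rw [h1, Finset.prod_range]
  exact Finset.prod_congr rfl fun k _ => hr k x

end Extensions

/-! ### Existence and uniqueness of the matrix of `β` -/

section BetaMatrix

variable {p : ℕ} [Fact p.Prime] {π : ℂ_[p]} {d m : ℕ}

theorem admissible_toC (hm : 0 < m) (hd : 0 < d) {g : Polynomial (K p m)} (hgd : g.natDegree = d)
    (hg0 : g.coeff 0 = 0) (hgT : ∀ i, (g.coeff i : ℂ_[p]) ∈ teich p m) : Admissible d (toC g) := by
  have hq : 1 < p ^ m := Nat.one_lt_pow hm.ne' (Fact.out : p.Prime).one_lt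
  have hcoeff : ∀ i, (toC g).coeff i = (g.coeff i : ℂ_[p]) := fun i => Polynomial.coeff_map _ _
  refine ⟨?_, ?_, fun i => ?_, ?_⟩
  · rw [toC, Polynomial.natDegree_map, hgd]
  · rw [hcoeff, hg0]; rfl
  · rw [hcoeff]
    rcases norm_eq_zero_or_one_of_pow_eq hq (hgT i) with h | h <;> rw [h]
    exact zero_le_one
  · rw [hcoeff]
    refine (norm_eq_zero_or_one_of_pow_eq hq (hgT d)).resolve_left fun h => ?_
    rw [norm_eq_zero] at h
    have h1 : g.leadingCoeff = 0 := by rw [Polynomial.leadingCoeff, hgd]; exact Subtype.ext h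
    rw [Polynomial.leadingCoeff_eq_zero] at h1
    rw [h1, Polynomial.natDegree_zero] at hgd
    omega

theorem IsFrobenius.conjC_eq {τ : L p m π ≃ₐ[ℚ_[p]] L p m π} (hτ : IsFrobenius τ)
    {g : Polynomial (K p m)} (hgT : ∀ i, (g.coeff i : ℂ_[p]) ∈ teich p m) :
    conjC τ g = frobPoly (toC g) := by
  ext i
  rw [coeff_frobPoly, conjC, toC, Polynomial.coeff_map, Polynomial.coeff_map, Polynomial.coeff_map,
    Polynomial.coeff_map]
  exact congrArg Subtype.val
    (hτ.2 (IntermediateField.inclusion (K_le_L m π) (g.coeff i)) (hgT i))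

theorem toLaurent_sum_smul_X_pow (a : Fin d → ℂ_[p]) :
    toLaurent (∑ i, a i • (PowerSeries.X ^ (i : ℕ) : ℂ_[p]⟦X⟧)) = ∑ i, a i • mono (i : ℕ) := by
  rw [map_sum]
  exact Finset.sum_congr rfl fun i _ => by rw [map_smul, toLaurent_X_pow]

theorem coeff_sum_smul_X_pow (a : Fin d → ℂ_[p]) (i : Fin d) :
    PowerSeries.coeff (i : ℕ) (∑ i, a i • (PowerSeries.X ^ (i : ℕ) : ℂ_[p]⟦X⟧)) = a i := by
  rw [map_sum, Finset.sum_eq_single i]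
  · simp
  · intro j _ hj
    rw [PowerSeries.coeff_smul, PowerSeries.coeff_X_pow, if_neg fun h => hj (Fin.ext h.symm),
      smul_zero]
  · exact fun h => absurd (Finset.mem_univ _) h

theorem coeff_sum_smul_X_pow_of_le (a : Fin d → ℂ_[p]) {n : ℕ} (hn : d ≤ n) :
    PowerSeries.coeff n (∑ i, a i • (PowerSeries.X ^ (i : ℕ) : ℂ_[p]⟦X⟧)) = 0 := by
  rw [map_sum]
  refine Finset.sum_eq_zero fun i _ => ?_
  rw [PowerSeries.coeff_smul, PowerSeries.coeff_X_pow, if_neg (by omega), smul_zero]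

theorem exists_isBetaMatrix (hd : 2 ≤ d) (hm : 0 < m) (hp : 3 * d ≤ p)
    (hπ : π ^ (p - 1) = -(p : ℂ_[p])) {τ : L p m π ≃ₐ[ℚ_[p]] L p m π} (hτ : IsFrobenius τ)
    {g : Polynomial (K p m)} (hG : Admissible d (toC g))
    (hgT : ∀ i, (g.coeff i : ℂ_[p]) ∈ teich p m) :
    ∃ M : Matrix (Fin d) (Fin d) (L p m π), IsBetaMatrix τ d g M ∧
      ∀ i j : Fin (d - 1), ‖((Gam M i j : L p m π) : ℂ_[p]) - π ^ expo p d (i + 1) (j + 1) /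
        ((expo p d (i + 1) (j + 1)).factorial : ℂ_[p]) *
          (toC g ^ expo p d (i + 1) (j + 1)).coeff (p * (i + 1) - (j + 1))‖ ≤
        ‖π‖ ^ (expo p d (i + 1) (j + 1) + 1) := by
  obtain ⟨s, hs0, hs1, hs⟩ := exists_pow_eq_norm_pi hπ (show d ≠ 0 by omega)
  choose c v hcv hc hv hcL hlead using fun j : Fin d =>
    exists_frobenius_matrix hd hp hπ hs0 hs1 hs hG (L p m π).toSubfield (pi_mem_L m π)
      (fun i => by
        rw [toC, Polynomial.coeff_map]
        exact K_le_L m π (g.coeff i).2) (isClosed_L hm hπ) j.2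
  refine ⟨Matrix.of fun i j => ⟨PowerSeries.coeff (i : ℕ) (c j), hcL j i⟩, fun j => ?_,
    fun i j => ?_⟩
  · refine ⟨toLaurent (v j), overconvergent_toLaurent (C := (s ^ d)⁻¹) (pow_pos hs0 4)
      (pow_lt_one₀ hs0.le hs1 (by norm_num)) fun k => ?_, ?_⟩
    · rw [← pow_mul]; exact hv j k
    · have hcj : c j = ∑ i : Fin d, PowerSeries.coeff (i : ℕ) (c j) •
          (PowerSeries.X ^ (i : ℕ) : ℂ_[p]⟦X⟧) := by
        ext n
        rcases Nat.lt_or_ge n d with hn | hn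
        · exact (coeff_sum_smul_X_pow (fun i : Fin d => PowerSeries.coeff (i : ℕ) (c j))
            ⟨n, hn⟩).symm
        · rw [hc j n hn, coeff_sum_smul_X_pow_of_le _ hn]
      rw [hτ.conjC_eq hgT, D_toLaurent, ← toLaurent_X_pow, beta_toLaurent, hcv, map_add,
        sub_eq_iff_eq_add, add_comm]
      congr 1
      conv_lhs => rw [hcj]
      exact toLaurent_sum_smul_X_pow _
  · exact hlead ⟨j + 1, by omega⟩ (Nat.succ_pos _) (i + 1) (Nat.succ_pos _)
      (by have := i.2; omega)

theorem Overconvergent.sub {u v : ℤ → ℂ_[p]} (hu : Overconvergent u) (hv : Overconvergent v) :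
    Overconvergent (u - v) := by
  obtain ⟨r, hr, C, hC⟩ := hu
  obtain ⟨r', hr', C', hC'⟩ := hv
  have hr0 : 0 < min r r' := lt_min (by linarith) (by linarith)
  refine ⟨min r r', lt_min hr hr', max C C', fun n => ?_⟩
  rcases le_max_iff.1 (norm_sub_le_max_norm (u n) (v n)) with h | h
  · refine ((mul_le_mul h (pow_le_pow_left₀ hr0.le (min_le_left _ _) _) (by positivity)
      (norm_nonneg _)).trans (hC n)).trans (le_max_left _ _)
  · refine ((mul_le_mul h (pow_le_pow_left₀ hr0.le (min_le_right _ _) _) (by positivity)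
      (norm_nonneg _)).trans (hC' n)).trans (le_max_right _ _)

theorem D_sub (G : Polynomial ℂ_[p]) (u v : ℤ → ℂ_[p]) : D π G (u - v) = D π G u - D π G v := by
  funext n
  simp only [D, Pi.sub_apply, mul_sub, Finset.sum_sub_distrib]
  ring

/-- Two candidates for a column differ by a polynomial of degree less than `d` in the image of
`D^τ`, which is zero by `eq_zero_of_D_eq_toLaurent`. -/
theorem IsBetaMatrix.unique (hd : 2 ≤ d) (hp : 3 * d ≤ p)
    (hπ : π ^ (p - 1) = -(p : ℂ_[p])) {τ : L p m π ≃ₐ[ℚ_[p]] L p m π} (hτ : IsFrobenius τ)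
    {g : Polynomial (K p m)} (hG : Admissible d (toC g))
    (hgT : ∀ i, (g.coeff i : ℂ_[p]) ∈ teich p m) {M N : Matrix (Fin d) (Fin d) (L p m π)}
    (hM : IsBetaMatrix τ d g M) (hN : IsBetaMatrix τ d g N) : M = N := by
  ext i j
  obtain ⟨u, hu, hu'⟩ := hM j
  obtain ⟨v, hv, hv'⟩ := hN j
  rw [hτ.conjC_eq hgT] at hu' hv'
  let a : Fin d → ℂ_[p] := fun i => (M i j : ℂ_[p]) - N i j
  have hD : D π (frobPoly (toC g)) (v - u) =
      toLaurent (∑ i, a i • (PowerSeries.X ^ (i : ℕ) : ℂ_[p]⟦X⟧)) := by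
    rw [D_sub, ← hu', ← hv', toLaurent_sum_smul_X_pow, sub_sub_sub_cancel_left,
      ← Finset.sum_sub_distrib]
    exact Finset.sum_congr rfl fun i _ => (sub_smul _ _ _).symm
  have h0 := eq_zero_of_D_eq_toLaurent hd hp hπ hG.frobPoly (hv.sub hu)
    (fun n hn => coeff_sum_smul_X_pow_of_le a hn) hD
  have h1 := coeff_sum_smul_X_pow a i
  rw [h0, map_zero] at h1
  exact sub_eq_zero.1 h1.symm

end BetaMatrix

/-! ### From the leading minor of `Γ` to the norm -/

section Minors

variable {p : ℕ} [Fact p.Prime] {π : ℂ_[p]} {d m : ℕ}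

theorem map_hasseP {R S : Type*} [CommRing R] [CommRing S] (f : R →+* S) (p d n : ℕ)
    (g : Polynomial R) : f (hasseP p d n g) = hasseP p d n (g.map f) := by
  simp only [hasseP, map_sum, map_mul, map_prod, map_intCast, ← Polynomial.map_pow,
    Polynomial.coeff_map]

theorem map_minorSum {R S : Type*} [CommRing R] [CommRing S] (f : R →+* S) {N : ℕ}
    (A : Matrix (Fin N) (Fin N) R) (n : ℕ) : f (minorSum A n) = minorSum (A.map f) n := by
  simp only [minorSum, map_sum, RingHom.map_det]
  rfl

theorem map_twistedProd (τ : L p m π ≃ₐ[ℚ_[p]] L p m π) {N : ℕ}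
    (A : Matrix (Fin N) (Fin N) (L p m π)) (k : ℕ) :
    (twistedProd τ A k).map (algebraMap (L p m π) ℂ_[p]) =
      seqProd (fun k => A.map (embIterate τ k)) k := by
  induction k with
  | zero => rw [twistedProd, seqProd, Matrix.map_one _ (map_zero _) (map_one _)]
  | succ k ih =>
    rw [twistedProd, seqProd, Matrix.map_mul, ih]
    congr 1
    ext i j
    exact (embIterate_apply τ k (A i j)).symm

theorem IsFrobenius.embIterate_pi {τ : L p m π ≃ₐ[ℚ_[p]] L p m π} (hτ : IsFrobenius τ) (k : ℕ) :
    embIterate τ k ⟨π, pi_mem_L m π⟩ = π := by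
  rw [embIterate_apply, Function.iterate_fixed hτ.1]

/-- The leading term of the principal minors of the twisted product. -/
theorem congrModPow_minorSum (hd : 2 ≤ d) (hm : 0 < m) (hp : 3 * d ≤ p)
    (hπ : π ^ (p - 1) = -(p : ℂ_[p])) {τ : L p m π ≃ₐ[ℚ_[p]] L p m π} (hτ : IsFrobenius τ)
    {g : Polynomial (K p m)} (hG : Admissible d (toC g))
    {A : Matrix (Fin (d - 1)) (Fin (d - 1)) (L p m π)}
    (hA : ∀ i j : Fin (d - 1), ‖(A i j : ℂ_[p]) - π ^ expo p d (i + 1) (j + 1) /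
        ((expo p d (i + 1) (j + 1)).factorial : ℂ_[p]) *
          (toC g ^ expo p d (i + 1) (j + 1)).coeff (p * (i + 1) - (j + 1))‖ ≤
        ‖π‖ ^ (expo p d (i + 1) (j + 1) + 1)) {n : ℕ} (hn : n ≤ d - 1) :
    CongrModPow π (m * Y p d n + 1) (minorSum (twistedProd τ A m) n : L p m π)
      (algebraMap ℚ_[p] ℂ_[p] (Algebra.norm ℚ_[p] (hasseP p d n g)) /
        (denom p d n : ℂ_[p]) ^ m * π ^ (m * Y p d n)) := by
  have hpp : p.Prime := Fact.out
  have hr := norm_pi_pos hπ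
  have hr1 := (norm_pi_lt_one hπ).le
  have := finiteDimensional_L hm hπ
  let G : ℕ → Matrix (Fin (d - 1)) (Fin (d - 1)) ℂ_[p] := fun k => A.map (embIterate τ k)
  have hentry : ∀ k i j, ‖G k i j‖ ≤ ‖π‖ ^ expo p d (i + 1) (j + 1) := fun k i j => by
    change ‖embIterate τ k (A i j)‖ ≤ _
    rw [norm_algHom_eq, ← sub_add_cancel (A i j : ℂ_[p])]
    refine (IsUltrametricDist.norm_add_le_max _ _).trans (max_le ((hA i j).trans
      (pow_le_pow_of_le_one hr.le hr1 (Nat.le_succ _))) (norm_leading_le hπ hG ?_ _))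
    exact expo_lt hp (Nat.succ_pos _) (by have := i.2; omega) (Nat.succ_pos _)
      (by have := j.2; omega)
  have hmain := norm_minorSum_sub_le hr hr1 hentry (w := Y p d n)
    (fun f h hf => Y_add_le_sum_expo hpp hp (by omega) hn hf) hn hm
  let P : L p m π := IntermediateField.inclusion (K_le_L m π) (hasseP p d n g)
  have hP : (P : ℂ_[p]) = hasseP p d n (toC g) :=
    map_hasseP (algebraMap (K p m) ℂ_[p]) p d n g
  let ϖ : L p m π := ⟨π, pi_mem_L m π⟩
  have hminor := norm_det_submatrix_sub_le (A := A.map (algebraMap (L p m π) ℂ_[p])) hp hπ hG hA hn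
  -- The powers of `τ` fix `π` and are isometric, so the estimate for the leading minor of `Γ`
  -- carries over to its conjugates.
  have hdet : ∀ k, ‖((G k).submatrix (Fin.castLE hn) (Fin.castLE hn)).det -
      embIterate τ k P / (denom p d n : ℂ_[p]) * π ^ Y p d n‖ ≤ ‖π‖ ^ (Y p d n + 1) := fun k => by
    have h1 : ((G k).submatrix (Fin.castLE hn) (Fin.castLE hn)).det -
        embIterate τ k P / (denom p d n : ℂ_[p]) * π ^ Y p d n = embIterate τ k
          ((A.submatrix (Fin.castLE hn) (Fin.castLE hn)).det - P / denom p d n * ϖ ^ Y p d n) := by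
      rw [map_sub, map_mul, map_div₀, map_pow, map_natCast, hτ.embIterate_pi, AlgHom.map_det]
      rfl
    have h2 : ((A.map (algebraMap (L p m π) ℂ_[p])).submatrix (Fin.castLE hn)
        (Fin.castLE hn)).det - hasseP p d n (toC g) / (denom p d n : ℂ_[p]) * π ^ Y p d n =
        (L p m π).val ((A.submatrix (Fin.castLE hn) (Fin.castLE hn)).det -
          P / denom p d n * ϖ ^ Y p d n) := by
      rw [map_sub, map_mul, map_div₀, map_pow, map_natCast, AlgHom.map_det, ← hP]
      rfl
    rw [h1, norm_algHom_eq]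
    rw [h2] at hminor
    exact hminor
  have hbound : ∀ k, ‖embIterate τ k P / (denom p d n : ℂ_[p]) * π ^ Y p d n‖ ≤
      ‖π‖ ^ Y p d n := fun k => by
    rw [norm_mul, norm_div, norm_denom_eq_one hp hn, div_one, norm_pow, norm_algHom_eq, hP]
    refine mul_le_of_le_one_left (by positivity) ?_
    refine IsUltrametricDist.norm_sum_le_of_forall_le_of_nonneg zero_le_one fun σ _ => ?_
    rw [norm_sign_mul, norm_prod]
    exact Finset.prod_le_one (fun _ _ => norm_nonneg _) fun k _ =>
      norm_coeff_polynomial_pow_le hG _ _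
  -- The product over `k < m` of the conjugates of `𝒫_n` is its norm from `K_m` to `ℚ_p`.
  have hprod := norm_prod_sub_prod_le (Finset.range m) hr hr1 (e := fun _ => Y p d n)
    (fun k _ => hbound k) fun k _ => hdet k
  rw [Finset.sum_const, Finset.card_range, smul_eq_mul, Finset.prod_mul_distrib,
    Finset.prod_div_distrib, Finset.prod_const, Finset.prod_const, Finset.card_range,
    ← hτ.norm_eq_prod hm, ← pow_mul, mul_comm (Y p d n)] at hprod
  have hmap : ((minorSum (twistedProd τ A m) n : L p m π) : ℂ_[p]) = minorSum (seqProd G m) n :=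
    (map_minorSum (algebraMap (L p m π) ℂ_[p]) _ n).trans (by rw [map_twistedProd])
  rw [CongrModPow, hmap, ← sub_add_sub_cancel]
  exact (IsUltrametricDist.norm_add_le_max _ _).trans (max_le hmain hprod)

end Minors

end

end OpenStratum

/-! ### The theorem -/

open OpenStratum in
theorem proposition3p2 (p : ℕ) [Fact p.Prime] (d m : ℕ) (hd : 2 ≤ d) (hm : 1 ≤ m)
    (hp : 3 * d ≤ p)
    (π : ℂ_[p]) (hπ : π ^ (p - 1) = -(p : ℂ_[p]))
    (τ : L p m π ≃ₐ[ℚ_[p]] L p m π) (hτ : IsFrobenius τ)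
    (g : Polynomial (K p m)) (hgd : g.natDegree = d) (hg0 : g.coeff 0 = 0)
    (hgT : ∀ i, (g.coeff i : ℂ_[p]) ∈ teich p m) :
    (∃! M : Matrix (Fin d) (Fin d) (L p m π), IsBetaMatrix τ d g M) ∧
    ∀ M : Matrix (Fin d) (Fin d) (L p m π), IsBetaMatrix τ d g M →
      ∀ n : ℕ, 1 ≤ n → n ≤ d - 1 →
        (twistedProd τ (Gam M) m).charpolyRev.coeff n =
          (-1) ^ n * minorSum (twistedProd τ (Gam M) m) n ∧
        CongrModPow π (m * Y p d n + 1)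
          (minorSum (twistedProd τ (Gam M) m) n : L p m π)
          (algebraMap ℚ_[p] ℂ_[p] (Algebra.norm ℚ_[p] (hasseP p d n g)) /
            (denom p d n : ℂ_[p]) ^ m * π ^ (m * Y p d n)) := by
  have hm0 : 0 < m := hm
  have hG := admissible_toC hm0 (by omega) hgd hg0 hgT
  obtain ⟨M₀, hM₀, hlead⟩ := exists_isBetaMatrix hd hm0 hp hπ hτ hG hgT
  have huniq : ∀ M, IsBetaMatrix τ d g M → M = M₀ := fun M hM =>
    hM.unique hd hp hπ hτ hG hgT hM₀
  refine ⟨⟨M₀, hM₀, huniq⟩, fun M hM n _ hn => ?_⟩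
  rw [huniq M hM]
  exact ⟨charpolyRev_coeff_eq _ n, congrModPow_minorSum hd hm0 hp hπ hτ hG hlead hn⟩
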